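/- Let $N\ge 1$ and let $q\in\mathbb C^*$ be not a root of unity. Write $(a;p)_n=\prod_{k=0}^{n-1}(1-ap^k)$, $[X,Y]_q=qXY-q^{-1}YX$, and, for a multi-index $n=(n_1,\dots,n_N)$, $\mathsf N_k=n_1+\dots+n_k$ (and $\tilde{\mathsf N}_k=\tilde n_1+\dots+\tilde n_k$). Let $j_1,\dots,j_N$ be positive integers or half-integers and let $\alpha_0,\dots,\alpha_{N+2}\in\mathbb C^*$ satisfy $\alpha_{k+1}/\alpha_k=q^{-2j_k}$ for $1\le k\le N$. Assume that none of $\alpha_1^2/\alpha_0^2$, $\alpha_{N+2}^2$, $\alpha_{N+1}\alpha_{N+2}$, $\alpha_{N+1}\alpha_{N+2}/\alpha_0^2$ is an integral power of $q^2$. *Polynomials.* Let $\overline p_n(x;a,b,c,d)=\frac{(ab;q^2)_n(ac;q^2)_n(ad;q^2)_n}{a^n}\,{}_4\phi_3\!\left(q^{-2n},abcd\,q^{2n-2},az,az^{-1};ab,ac,ad;q^2,q^2\right)$, $x=\frac12(z+z^{-1})$, be the Askey–Wilson polynomials to the base $q^2$ (read as polynomials in $ab,ac,ad$, by multiplying the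 prefactor into the terminating series). With $x_k=\frac12(z_k+z_k^{-1})$ and $z_{N+1}=\alpha_{N+2}$, the normalized Gasper–Rahman polynomials are $$\widehat Q(n,z)=\frac{(\alpha_{N+1}\alpha_{N+2})^{\mathsf N_N}}{(\alpha_{N+1}\alpha_{N+2};q^2)_{\mathsf N_N}(\alpha_{N+1}\alpha_{N+2}/\alpha_0^2;q^2)_{\mathsf N_N}}\prod_{k=1}^N\frac{\overline p_{n_k}\!\left(x_k;\alpha_kq^{2\mathsf N_{k-1}},\frac{\alpha_k}{\alpha_0^2}q^{2\mathsf N_{k-1}},\frac{\alpha_{k+1}}{\alpha_k}z_{k+1},\frac{\alpha_{k+1}}{\alpha_k}z_{k+1}^{-1}\right)}{\alpha_k^{n_k}(\alpha_{k+1}^2/\alpha_k^2;q^2)_{n_k}} .$$ *Operators.* On functions of $z=(z_1,\dots,z_N)$ let $E_j$ be the shift $z_j\mapsto q^2z_j$, $\Delta_j=E_j-1$, $\nabla_j=1-E_j^{-1}$. Let $\mathcal W_0$ be multiplication by $x_1$ and $$\mathcal W_1=\frac{\alpha_0q}{2\alpha_{N+1}}\Big(\sum_{0\ne\nu\in\{-1,0,1\}^N}(-1)^{|\nu^-|}\Phi_\nu(z)\prod_{j:\nu_j=1}\Delta_j\prod_{j:\nu_j=-1}\nabla_j+1+\frac{\alpha_{N+1}^2}{q^2\alpha_0^2}\Big),$$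 where $|\nu^-|$ is the number of $j$ with $\nu_j=-1$; for $\nu\in\{0,1\}^N$ with support $i_1<\dots<i_s$, $$\Phi_\nu(z)=(1-\alpha_{i_1}z_{i_1})\Big(1-\frac{\alpha_{i_1}z_{i_1}}{\alpha_0^2}\Big)\frac{\prod_{k=2}^s\big(1-\frac{\alpha_{i_k}z_{i_k}z_{i_{k-1}}}{\alpha_{i_{k-1}}}\big)\big(1-\frac{q^2\alpha_{i_k}z_{i_k}z_{i_{k-1}}}{\alpha_{i_{k-1}}}\big)}{\prod_{k=1}^s(1-z_{i_k}^2)(1-q^2z_{i_k}^2)}\Big(1-\frac{\alpha_{N+1}\alpha_{N+2}z_{i_s}}{\alpha_{i_s}}\Big)\Big(1-\frac{\alpha_{N+1}z_{i_s}}{\alpha_{i_s}\alpha_{N+2}}\Big),$$ and in general $\Phi_\nu$ is obtained from $\Phi_{(|\nu_1|,\dots,|\nu_N|)}$ by replacing $z_j$ by $z_j^{-1}$ whenever $\nu_j=-1$. For $\omega_0,\omega_1,g_+,g_-\in\mathbb C$ let $$\mathcal I_1=\omega_0\mathcal W_0+\omega_1\mathcal W_1+g_+[\mathcal W_1,\mathcal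 W_0]_q+g_-[\mathcal W_0,\mathcal W_1]_q .$$ *Finite-dimensional modules.* Let $n$ range over $0\le n_k\le 2j_k$ and $\tilde n$ over $0\le\tilde n_{N+1-k}\le 2j_k$, let $z(\tilde n)$ be the point with $z_k=\frac{\alpha_{N+1}\alpha_{N+2}}{\alpha_k}q^{2\tilde{\mathsf N}_{N+1-k}}$, and put $\widetilde Q(n,\tilde n)=\widehat Q(n,z(\tilde n))$. Let $\mathcal V^*$ be the span of the functions $\tilde n\mapsto\widetilde Q(n,\tilde n)$ over all $n$, and $\mathcal V$ the span of the functions $n\mapsto\widetilde Q(n,\tilde n)$ over all $\tilde n$. Then each $A\in\{\mathcal W_0,\mathcal W_1,\mathcal I_1\}$ induces a unique linear operator on $\mathcal V^*$ that sends $\widetilde Q(n,\cdot)$ to $\tilde n\mapsto(A\widehat Q(n,\cdot))(z(\tilde n))$ for all $n$, and a unique linear operator on $\mathcal V$ that sends $\widetilde Q(\cdot,\tilde n)$ to $n\mapsto(A\widehat Q(n,\cdot))(z(\tilde n))$ for all $\tilde n$. On $\mathcal V^*$ the operator induced by $\mathcal I_1$ is $\omega_0X+\omega_1Y+g_+[Y,X]_q+g_-[X,Y]_q$,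 where $X,Y$ are those induced by $\mathcal W_0,\mathcal W_1$; on $\mathcal V$, where inducing operators reverses products, it is $\omega_0X'+\omega_1Y'+g_+[X',Y']_q+g_-[Y',X']_q$, where $X',Y'$ are those induced there. *Invariant subspaces.* For integers $P,P^*$ let $\mathcal W_+$, $\overline{\mathcal W}_+\subseteq\mathcal V^*$ be the spans of the $\widetilde Q(n,\cdot)$ with $\mathsf N_N\le P$, respectively $\mathsf N_N\ge P+1$, and let $\mathcal W_-$, $\overline{\mathcal W}_-\subseteq\mathcal V$ be the spans of the $\widetilde Q(\cdot,\tilde n)$ with $\tilde{\mathsf N}_N\le P^*$, respectively $\tilde{\mathsf N}_N\ge P^*+1$. Then, for the induced operators, $$\begin{aligned} \mathcal I_1\mathcal W_+\subseteq\mathcal W_+&\quad\text{if}\quad \omega_0+\tfrac{q^2-q^{-2}}2\Big(g_-\tfrac{\alpha_0q}{\alpha_{N+1}}q^{-2P-1}+g_+\tfrac{\alpha_{N+1}}{\alpha_0q}q^{2P+1}\Big)=0,\\ \mathcal I_1\mathcal W_-\subseteq\mathcal W_-&\quad\text{if}\quad \omega_1+\tfrac{q^2-q^{-2}}2\Big(g_+\tfrac{\alpha_{N+1}\alpha_{N+2}}{\alpha_1}q^{2P^*+1}+g_-\tfrac{\alpha_1}{\alpha_{N+1}\alpha_{N+2}}q^{-2P^*-1}\Big)=0,\\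 \mathcal I_1\overline{\mathcal W}_+\subseteq\overline{\mathcal W}_+&\quad\text{if}\quad \omega_0+\tfrac{q^2-q^{-2}}2\Big(g_-\tfrac{\alpha_{N+1}}{\alpha_0q}q^{2P+1}+g_+\tfrac{\alpha_0q}{\alpha_{N+1}}q^{-2P-1}\Big)=0,\\ \mathcal I_1\overline{\mathcal W}_-\subseteq\overline{\mathcal W}_-&\quad\text{if}\quad \omega_1+\tfrac{q^2-q^{-2}}2\Big(g_+\tfrac{\alpha_1}{\alpha_{N+1}\alpha_{N+2}}q^{-2P^*-1}+g_-\tfrac{\alpha_{N+1}\alpha_{N+2}}{\alpha_1}q^{2P^*+1}\Big)=0. \end{aligned}$$ -/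

import Mathlib

open Finset

/-- The `q`-shifted factorial `(a; q)_n`. -/
noncomputable def qPoch (a q : ℂ) (n : ℕ) : ℂ :=
  ∏ k ∈ range n, (1 - a * q ^ k)

/-- The Askey-Wilson polynomial `p_n(x; a, b, c, d)` to the base `q`, with `x = (z + z⁻¹) / 2`, that is
`(ab, ac, ad; q)_n a^{-n} ₄φ₃(q^{-n}, abcd q^{n-1}, a z, a z⁻¹; ab, ac, ad; q, q)`.
The prefactor is distributed over the terms of the terminating series by means of
`(u; q)_n = (u; q)_k (u q^k; q)_{n-k}`, so that the formula is polynomial in `ab`, `ac`, `ad`. -/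
noncomputable def askeyWilson (q : ℂ) (n : ℕ) (z a b c d : ℂ) : ℂ :=
  (a ^ n)⁻¹ * ∑ k ∈ range (n + 1),
    qPoch (q ^ (-(n : ℤ))) q k * qPoch (a * b * c * d * q ^ ((n : ℤ) - 1)) q k *
      qPoch (a * z) q k * qPoch (a * z⁻¹) q k / qPoch q q k * q ^ k *
      (qPoch (a * b * q ^ k) q (n - k) * qPoch (a * c * q ^ k) q (n - k) *
        qPoch (a * d * q ^ k) q (n - k))

section GasperRahman

variable {N : ℕ}

/-- `partialSum n j = n_1 + ⋯ + n_j` (the entry `n_{i+1}` is `n i`). -/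
def partialSum (n : Fin N → ℕ) (j : ℕ) : ℕ :=
  ∑ i : Fin N, if i.val < j then n i else 0

/-- The coordinate `z_k` for `1 ≤ k ≤ N` (stored as `z (k-1)`), and `z_{N+1} = α_{N+2}`. -/
noncomputable def zCoord (α : ℕ → ℂ) (z : Fin N → ℂ) (k : ℕ) : ℂ :=
  if h : k - 1 < N then z ⟨k - 1, h⟩ else α (N + 2)

/-- The Gasper-Rahman polynomial `Q^{(N)}({n}, {x}, {α})`, `x_k = (z_k + z_k⁻¹) / 2`. The parameters are
`α 0, …, α (N + 2)`; the other values of `α` are never used. -/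
noncomputable def gasperRahman (q : ℂ) (α : ℕ → ℂ) (n : Fin N → ℕ) (z : Fin N → ℂ) : ℂ :=
  ∏ i : Fin N,
    askeyWilson (q ^ 2) (n i) (z i)
      (α (i + 1) * q ^ (2 * partialSum n i))
      (α (i + 1) / α 0 ^ 2 * q ^ (2 * partialSum n i))
      (α (i + 2) / α (i + 1) * zCoord α z (i + 2))
      (α (i + 2) / α (i + 1) * (zCoord α z (i + 2))⁻¹)

/-- The normalized Gasper-Rahman polynomial `Q̂^{(N)}({n}, {x}, {α})`. -/
noncomputable def gasperRahmanHat (q : ℂ) (α : ℕ → ℂ) (n : Fin N → ℕ) (z : Fin N → ℂ) : ℂ :=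
  (α (N + 1) * α (N + 2)) ^ (∑ i, n i) /
      (qPoch (α (N + 1) * α (N + 2)) (q ^ 2) (∑ i, n i) *
        qPoch (α (N + 1) * α (N + 2) / α 0 ^ 2) (q ^ 2) (∑ i, n i)) *
    (1 / ∏ i : Fin N, (α (i + 1) ^ n i * qPoch (α (i + 2) ^ 2 / α (i + 1) ^ 2) (q ^ 2) (n i))) *
    gasperRahman q α n z

/-! ### `q`-difference operators, acting on functions of `z = (z_1, …, z_N)` -/

/-- `(f ↦ f(z_1, …, c z_j, …, z_N))`. -/
noncomputable def scaleShift (c : ℂ) (j : Fin N) : Module.End ℂ ((Fin N → ℂ) → ℂ) :=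
  LinearMap.funLeft ℂ ℂ fun z => Function.update z j (c * z j)

/-- The factor in the `j`-th coordinate of `Δ^{ν⁺} ∇^{ν⁻}`: the forward difference `Δ_{z_j} = E_{z_j} - 1`
if `ν_j = 1`, the backward difference `∇_{z_j} = 1 - E_{z_j}⁻¹` if `ν_j = -1`, and the identity if `ν_j = 0`.
Here `E_{z_j}` is the `q²`-shift of `z_j`. -/
noncomputable def coordDiff (q : ℂ) (j : Fin N) : SignType → Module.End ℂ ((Fin N → ℂ) → ℂ)
  | .pos => scaleShift (q ^ 2) j - 1
  | .neg => 1 - scaleShift ((q ^ 2)⁻¹) j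
  | .zero => 1

/-- `Δ^{ν⁺} ∇^{ν⁻}` (the factors commute). -/
noncomputable def multiDiff (q : ℂ) (ν : Fin N → SignType) : Module.End ℂ ((Fin N → ℂ) → ℂ) :=
  ((List.finRange N).map fun j => coordDiff q j (ν j)).prod

/-- The positions of the nonzero entries of `ν`. -/
def signSupport (ν : Fin N → SignType) : Finset (Fin N) :=
  univ.filter fun i => ν i ≠ 0

/-- `Φ_ν` for `ν` replaced by its indicator vector, where `S = {i_1 < ⋯ < i_s}` is the support of `ν`:
the first product singles out `i_1`, the second one runs over the pairs `(i_{k-1}, i_k)` of consecutive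
elements of `S`, and the last one singles out `i_s`. -/
noncomputable def PhiSupport (q : ℂ) (α : ℕ → ℂ) (S : Finset (Fin N)) (z : Fin N → ℂ) : ℂ :=
  (∏ i ∈ S, if ∀ l ∈ S, i ≤ l then
      (1 - α (i + 1) * z i) * (1 - α (i + 1) * z i / α 0 ^ 2) else 1) *
    (∏ i ∈ S, ∏ k ∈ S, if i < k ∧ ∀ l ∈ S, ¬ (i < l ∧ l < k) then
      (1 - α (k + 1) * z k * z i / α (i + 1)) *
        (1 - q ^ 2 * α (k + 1) * z k * z i / α (i + 1)) else 1) /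
    (∏ i ∈ S, ((1 - z i ^ 2) * (1 - q ^ 2 * z i ^ 2))) *
    (∏ i ∈ S, if ∀ l ∈ S, l ≤ i then
      (1 - α (N + 1) * α (N + 2) * z i / α (i + 1)) *
        (1 - α (N + 1) * z i / (α (i + 1) * α (N + 2))) else 1)

/-- `Φ_ν = I^{ν⁻}(Φ_{ν⁺ + ν⁻})`, where `I^{ν⁻}` inverts the coordinates `z_j` with `ν_j = -1`. -/
noncomputable def Phi (q : ℂ) (α : ℕ → ℂ) (ν : Fin N → SignType) (z : Fin N → ℂ) : ℂ :=
  PhiSupport q α (signSupport ν) fun i => if ν i = -1 then (z i)⁻¹ else z i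

/-- The `q`-difference operator `𝔻*_{z}^{(N)}`. -/
noncomputable def qDiffOp (q : ℂ) (α : ℕ → ℂ) : Module.End ℂ ((Fin N → ℂ) → ℂ) :=
  (α 0 * q / α (N + 1)) •
    ((∑ ν ∈ (univ : Finset (Fin N → SignType)).erase 0,
        ((-1 : ℂ) ^ (univ.filter fun i => ν i = -1).card) •
          (LinearMap.mulLeft ℂ (Phi q α ν) * multiDiff q ν)) +
      (1 + α (N + 1) ^ 2 / (q ^ 2 * α 0 ^ 2)) • 1)

/-- `𝒲₀^{(N)}`: multiplication by `x_1 = (z_1 + z_1⁻¹) / 2`. -/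
noncomputable def opW0 [NeZero N] : Module.End ℂ ((Fin N → ℂ) → ℂ) :=
  LinearMap.mulLeft ℂ fun z : Fin N → ℂ => (z 0 + (z 0)⁻¹) / 2

/-- `𝒲₁^{(N)} = ½ 𝔻*_{z}^{(N)}`. -/
noncomputable def opW1 (q : ℂ) (α : ℕ → ℂ) : Module.End ℂ ((Fin N → ℂ) → ℂ) :=
  (1 / 2 : ℂ) • qDiffOp q α

end GasperRahman

/-- The `q`-commutator `[X, Y]_q = q X Y - q⁻¹ Y X`. -/
noncomputable def qComm {A : Type*} [Ring A] [Algebra ℂ A] (q : ℂ) (X Y : A) : A :=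
  q • (X * Y) - q⁻¹ • (Y * X)

/-- The first element of the `q`-Dolan-Grady hierarchy,
`I₁ = ω₀ W₀ + ω₁ W₁ + g₊ G₁ + g₋ G̃₁` with `G₁ = [W₁, W₀]_q` and `G̃₁ = [W₀, W₁]_q`. -/
noncomputable def dolanGradyFirst {A : Type*} [Ring A] [Algebra ℂ A] (q ω₀ ω₁ gp gm : ℂ)
    (W₀ W₁ : A) : A :=
  ω₀ • W₀ + ω₁ • W₁ + gp • qComm q W₁ W₀ + gm • qComm q W₀ W₁

section FiniteModules

variable {N : ℕ}

/-- The multi-indices with `0 ≤ n_k ≤ J_k`. -/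
abbrev Box (J : Fin N → ℕ) : Type := (k : Fin N) → Fin (J k + 1)

/-- The dual multi-indices, with `0 ≤ ñ_{N+1-k} ≤ J_k`. -/
abbrev DualBox (J : Fin N → ℕ) : Type := Box fun k => J k.rev

/-- The underlying natural numbers of a multi-index. -/
def Box.toNat {J : Fin N → ℕ} (n : Box J) : Fin N → ℕ := fun k => (n k : ℕ)

/-- The total degree `n_1 + ⋯ + n_N`. -/
def Box.deg {J : Fin N → ℕ} (n : Box J) : ℕ := ∑ k, (n k : ℕ)

/-- The discrete support `z_k = (α_{N+1} α_{N+2} / α_k) q^{2(ñ_1 + ⋯ + ñ_{N+1-k})}`. -/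
noncomputable def gridPoint (q : ℂ) (α : ℕ → ℂ) {J : Fin N → ℕ} (m : DualBox J) : Fin N → ℂ :=
  fun i => α (N + 1) * α (N + 2) / α (i + 1) * q ^ (2 * partialSum m.toNat (N - i))

/-- The array `(n, ñ) ↦ (A Q̂^{(N)}({n}, ·, {α}))` at the grid point of `ñ`, for an operator `A` on
functions of `z`. -/
noncomputable def gridValue (q : ℂ) (α : ℕ → ℂ) (J : Fin N → ℕ)
    (A : Module.End ℂ ((Fin N → ℂ) → ℂ)) (n : Box J) (m : DualBox J) : ℂ :=
  A (gasperRahmanHat q α n.toNat) (gridPoint q α m)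

/-- The polynomials on the discrete support, `Q̃^{(N)}({n}, {ñ}, {α})`. -/
noncomputable def gridPoly (q : ℂ) (α : ℕ → ℂ) (J : Fin N → ℕ) (n : Box J) (m : DualBox J) : ℂ :=
  gridValue q α J 1 n m

/-- The span of the functions `ñ ↦ Q̃({n}, {ñ})` for `n ∈ S`. -/
noncomputable def spanPoly (q : ℂ) (α : ℕ → ℂ) (J : Fin N → ℕ) (S : Set (Box J)) :
    Submodule ℂ (DualBox J → ℂ) :=
  Submodule.span ℂ ((fun n => gridPoly q α J n) '' S)

/-- The span of the functions `n ↦ Q̃({n}, {ñ})` for `ñ ∈ S`. -/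
noncomputable def dualSpanPoly (q : ℂ) (α : ℕ → ℂ) (J : Fin N → ℕ) (S : Set (DualBox J)) :
    Submodule ℂ (Box J → ℂ) :=
  Submodule.span ℂ ((fun m n => gridPoly q α J n m) '' S)

/-- The finite-dimensional module `𝒱*`, spanned by the `Q̃({n}, ·)` for all `n`. -/
noncomputable abbrev modV (q : ℂ) (α : ℕ → ℂ) (J : Fin N → ℕ) : Submodule ℂ (DualBox J → ℂ) :=
  spanPoly q α J Set.univ

/-- The finite-dimensional module `𝒱`, spanned by the `Q̃(·, {ñ})` for all `ñ`. -/
noncomputable abbrev dualModV (q : ℂ) (α : ℕ → ℂ) (J : Fin N → ℕ) : Submodule ℂ (Box J → ℂ) :=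
  dualSpanPoly q α J Set.univ

/-- `T` is induced on `𝒱*` by `A`: it has the action of `A` on the spanning vectors `Q̃({n}, ·)`. -/
def IsInduced (q : ℂ) (α : ℕ → ℂ) (J : Fin N → ℕ) (A : Module.End ℂ ((Fin N → ℂ) → ℂ))
    (T : Module.End ℂ (modV q α J)) : Prop :=
  ∀ (n : Box J) (v : modV q α J), (v : DualBox J → ℂ) = gridPoly q α J n →
    (T v : DualBox J → ℂ) = gridValue q α J A n

/-- `T` is induced on `𝒱` by `A`: it has the action of `A` on the spanning vectors `Q̃(·, {ñ})`. -/
def IsDualInduced (q : ℂ) (α : ℕ → ℂ) (J : Fin N → ℕ) (A : Module.End ℂ ((Fin N → ℂ) → ℂ))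
    (T : Module.End ℂ (dualModV q α J)) : Prop :=
  ∀ (m : DualBox J) (v : dualModV q α J), (v : Box J → ℂ) = (fun n => gridPoly q α J n m) →
    (T v : Box J → ℂ) = fun n => gridValue q α J A n m

/-- `T U ⊆ U`, for a subspace `U` of the ambient space of `V` that lies in `V`. -/
def LeavesInvariant {E : Type*} [AddCommGroup E] [Module ℂ E] {V : Submodule ℂ E}
    (T : Module.End ℂ V) (U : Submodule ℂ E) : Prop :=
  U ≤ V ∧ ∀ v : V, (v : E) ∈ U → (T v : E) ∈ U

end FiniteModules

/-! ### Shifted factorials -/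

/-! The polynomials on the grid are bispectral. There `𝒲₀` multiplies by an eigenvalue depending
only on the degree of `ñ`, and `𝒲₁` has the polynomials as eigenfunctions with an eigenvalue
depending only on the degree of `n`. Each operator, written in the basis labels of the other,
changes the degree by at most one. Both eigenvalues have the form `θ_k = (γ q^{2k} + γ⁻¹ q^{-2k}) /
2`, so that `q θ_{k+1} - q⁻¹ θ_k` and `q θ_k - q⁻¹ θ_{k+1}` are single exponentials. The weight of a
transition between degrees `P` and `P + 1` in `I₁` is therefore a matrix entry times a scalar that
is exactly the left side of the stated condition. When it vanishes, nothing leaves the subspace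
(`dolanGradyFirst_invariant_deg`).

For the eigenvalue equation, the difference operator is rewritten as a nearest-neighbour sum over
states in `{-1, 0, 1}` at each site (`phiGen_eq_phiRec`, `diffSum_eq_nnSum`). With the state of the
second site fixed, the Askey-Wilson factor in the first variable can be summed out
(`sum_site_askeyWilson`), which leaves the same sum in one variable fewer with a shifted left
boundary (`nnSum_grProd`). The two one-variable relations needed, `askeyWilson_qDiff` and
`askeyWilson_contiguous`, are compositions of two instances of `askeyWilson_lower`. They use the
full symmetry in the parameters, which follows by induction from `askeyWilson_raise`.

For tridiagonality of `𝒲₁`, the zeros of the bond weights keep the shifts on the grid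
(`bond_ne_zero`, `exists_gridMatrix`). For `𝒲₀`, each Askey-Wilson factor on the grid is a
terminating `₄φ₃` that is symmetric under exchange of its two indices. Hence the grid polynomials
are self-dual under `n ↔ ñ` with parameters `dualParam` (`gasperRahmanHat_dual`), and the recurrence
in `n` is the `𝒲₁` equation of the dual family (`exists_recurrence`). -/

theorem qPoch_zero (a p : ℂ) : qPoch a p 0 = 1 := by simp [qPoch]

theorem qPoch_succ (a p : ℂ) (n : ℕ) : qPoch a p (n + 1) = qPoch a p n * (1 - a * p ^ n) := by
  simp [qPoch, prod_range_succ]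

theorem qPoch_succ_left (a p : ℂ) (n : ℕ) :
    qPoch a p (n + 1) = (1 - a) * qPoch (a * p) p n := by
  simp only [qPoch, prod_range_succ', pow_zero, mul_one]
  rw [mul_comm]
  congr 1
  exact prod_congr rfl fun k _ => by ring

theorem one_sub_mul_qPoch (a p : ℂ) (n : ℕ) :
    (1 - a) * qPoch (a * p) p n = qPoch a p n * (1 - a * p ^ n) := by
  rw [← qPoch_succ_left, qPoch_succ]

theorem qPoch_add (a p : ℂ) (m n : ℕ) :
    qPoch a p (m + n) = qPoch a p m * qPoch (a * p ^ m) p n := by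
  simp only [qPoch, prod_range_add]
  congr 1
  exact prod_congr rfl fun k _ => by ring

/-! ### Askey-Wilson polynomials -/

/-- The coefficients of `a ^ n * askeyWilson p n z a b c d` in the basis `(az, a/z; p)_k`. -/
noncomputable def awCoeff (p : ℂ) (n k : ℕ) (a b c d : ℂ) : ℂ :=
  qPoch (p ^ (-(n : ℤ))) p k * qPoch (a * b * c * d * p ^ ((n : ℤ) - 1)) p k / qPoch p p k * p ^ k *
    (qPoch (a * b * p ^ k) p (n - k) * qPoch (a * c * p ^ k) p (n - k) *
      qPoch (a * d * p ^ k) p (n - k))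

theorem askeyWilson_eq (p : ℂ) (n : ℕ) (z a b c d : ℂ) :
    askeyWilson p n z a b c d = (a ^ n)⁻¹ * ∑ k ∈ range (n + 1),
      awCoeff p n k a b c d * (qPoch (a * z) p k * qPoch (a * z⁻¹) p k) := by
  unfold askeyWilson awCoeff
  congr 1
  exact sum_congr rfl fun k _ => by ring

theorem askeyWilson_swap_cd (p : ℂ) (n : ℕ) (z a b c d : ℂ) :
    askeyWilson p n z a b c d = askeyWilson p n z a b d c := by
  unfold askeyWilson
  congr 1
  refine sum_congr rfl fun k _ => ?_
  rw [show a * b * d * c = a * b * c * d by ring]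
  ring

theorem askeyWilson_swap_bc (p : ℂ) (n : ℕ) (z a b c d : ℂ) :
    askeyWilson p n z a b c d = askeyWilson p n z a c b d := by
  unfold askeyWilson
  congr 1
  refine sum_congr rfl fun k _ => ?_
  rw [show a * c * b * d = a * b * c * d by ring]
  ring

/-- Replacing `(z, a)` by `(qz, aq)` leaves `a/z` fixed and multiplies `az` by `q²`, so one shifted
factorial stays and the other moves by one step. This is what lets first-order shifts act termwise
on the series. -/
theorem awBasis_shift_up {q z : ℂ} (hq : q ≠ 0) (hz : z ≠ 0) (a : ℂ) (k : ℕ) :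
    (1 - a * z) * (qPoch (a * q * (q * z)) (q ^ 2) k * qPoch (a * q * (q * z)⁻¹) (q ^ 2) k) =
      (1 - a * z * (q ^ 2) ^ k) * (qPoch (a * z) (q ^ 2) k * qPoch (a * z⁻¹) (q ^ 2) k) := by
  rw [show a * q * (q * z) = a * z * q ^ 2 by ring,
    show a * q * (q * z)⁻¹ = a * z⁻¹ by field_simp, ← mul_assoc, one_sub_mul_qPoch]
  ring

theorem awBasis_shift_down {q z : ℂ} (hq : q ≠ 0) (hz : z ≠ 0) (a : ℂ) (k : ℕ) :
    (1 - a * z⁻¹) * (qPoch (a * q * (q⁻¹ * z)) (q ^ 2) k * qPoch (a * q * (q⁻¹ * z)⁻¹) (q ^ 2) k) =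
      (1 - a * z⁻¹ * (q ^ 2) ^ k) * (qPoch (a * z) (q ^ 2) k * qPoch (a * z⁻¹) (q ^ 2) k) := by
  have h := awBasis_shift_up hq (inv_ne_zero hz) a k
  rw [inv_inv, show (q * z⁻¹)⁻¹ = q⁻¹ * z by rw [mul_inv, inv_inv],
    show q * z⁻¹ = (q⁻¹ * z)⁻¹ by rw [mul_inv, inv_inv]] at h
  linear_combination h

/-- The parameter-lowering relation: two of the parameters go down, the other two go up. -/
theorem askeyWilson_lower {q z a : ℂ} (hq : q ≠ 0) (hz : z ≠ 0) (n : ℕ) (b c d : ℂ) :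
    z⁻¹ * (1 - a * z) * (1 - b * z) * askeyWilson (q ^ 2) n (q * z) (a * q) (b * q) c d -
        z * (1 - a * z⁻¹) * (1 - b * z⁻¹) *
          askeyWilson (q ^ 2) n (q⁻¹ * z) (a * q) (b * q) c d =
      (z⁻¹ - z) * (1 - a * b * (q ^ 2) ^ n) * (q ^ n)⁻¹ *
        askeyWilson (q ^ 2) n z a b (c * q) (d * q) := by
  simp only [askeyWilson_eq, mul_sum, ← sum_sub_distrib]
  refine sum_congr rfl fun k hk => ?_
  have hk' : k ≤ n := by simpa [Nat.lt_succ_iff] using hk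
  have hup := awBasis_shift_up hq hz a k
  have hdown := awBasis_shift_down hq hz a k
  set w := qPoch (a * z) (q ^ 2) k * qPoch (a * z⁻¹) (q ^ 2) k
  -- Raising `a, b` and raising `c, d` give the same `abcd`, `ac` and `ad`; only the factorial in
  -- `ab` differs, by one step.
  have hco : awCoeff (q ^ 2) n k (a * q) (b * q) c d * (1 - a * b * (q ^ 2) ^ k) =
      awCoeff (q ^ 2) n k a b (c * q) (d * q) * (1 - a * b * (q ^ 2) ^ n) := by
    have h := one_sub_mul_qPoch (a * b * (q ^ 2) ^ k) (q ^ 2) (n - k)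
    rw [mul_assoc (a * b) _ ((q ^ 2) ^ (n - k)), ← pow_add, Nat.add_sub_cancel' hk',
      mul_assoc (a * b), mul_comm ((q ^ 2) ^ k)] at h
    unfold awCoeff
    rw [show a * q * (b * q) * c * d = a * b * (c * q) * (d * q) by ring,
      show a * q * (b * q) * (q ^ 2) ^ k = a * b * (q ^ 2 * (q ^ 2) ^ k) by ring,
      show a * q * c = a * (c * q) by ring, show a * q * d = a * (d * q) by ring]
    linear_combination
      (qPoch ((q ^ 2) ^ (-(n : ℤ))) (q ^ 2) k *
        qPoch (a * b * (c * q) * (d * q) * (q ^ 2) ^ ((n : ℤ) - 1)) (q ^ 2) k /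
        qPoch (q ^ 2) (q ^ 2) k * (q ^ 2) ^ k *
        (qPoch (a * (c * q) * (q ^ 2) ^ k) (q ^ 2) (n - k) *
          qPoch (a * (d * q) * (q ^ 2) ^ k) (q ^ 2) (n - k))) * h
  set C := awCoeff (q ^ 2) n k (a * q) (b * q) c d
  -- The `k`-dependent factor produced here is traded for an `n`-dependent one by `hco`, so it
  -- leaves the sum.
  have hid : z⁻¹ * (1 - a * z * (q ^ 2) ^ k) * (1 - b * z) -
      z * (1 - a * z⁻¹ * (q ^ 2) ^ k) * (1 - b * z⁻¹) = (z⁻¹ - z) * (1 - a * b * (q ^ 2) ^ k) := by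
    field_simp
    ring
  rw [mul_pow, mul_inv]
  linear_combination ((a ^ n)⁻¹ * (q ^ n)⁻¹ * C) * (z⁻¹ * (1 - b * z) * hup
    - z * (1 - b * z⁻¹) * hdown + w * hid) + (z⁻¹ - z) * (a ^ n)⁻¹ * (q ^ n)⁻¹ * w * hco

/-- The Pochhammer part of comparing coefficients in the raising relation, with `s = abcd`; the
factors in `ab`, `ac`, `ad` are common to all terms and are split off by the caller. -/
theorem awCoeff_raise_aux {p s : ℂ} (hp : p ≠ 0) (hp1 : ∀ m : ℕ, 0 < m → p ^ m ≠ 1) (n k : ℕ) :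
    qPoch (p ^ (-(n : ℤ))) p (k + 1) * qPoch (s * p ^ (n + 1)) p (k + 1) / qPoch p p (k + 1) -
        qPoch (p ^ (-(n : ℤ))) p k * qPoch (s * p ^ (n + 1)) p k / qPoch p p k * (1 - s * p ^ k) =
      p ^ (k + 1) * (qPoch (p ^ (-((n + 1 : ℕ) : ℤ))) p (k + 1) * qPoch (s * p ^ n) p (k + 1) /
        qPoch p p (k + 1)) := by
  have h1 : qPoch p p (k + 1) = qPoch p p k * (1 - p ^ (k + 1)) := by rw [qPoch_succ, ← pow_succ']
  have h2 : (1 : ℂ) - p ^ (k + 1) ≠ 0 := sub_ne_zero.2 (hp1 _ k.succ_pos).symm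
  have h3 : p ^ (-((n + 1 : ℕ) : ℤ)) * p = p ^ (-(n : ℤ)) := by
    rw [← zpow_add_one₀ hp]; congr 1; push_cast; ring
  have h4 := qPoch_succ_left (p ^ (-((n + 1 : ℕ) : ℤ))) p k
  rw [h3] at h4
  have h5 := qPoch_succ_left (s * p ^ n) p k
  rw [mul_assoc, ← pow_succ] at h5
  rw [h4, h5, h1, qPoch_succ (p ^ (-(n : ℤ))), qPoch_succ (s * p ^ (n + 1))]
  have h6 : p ^ (-((n + 1 : ℕ) : ℤ)) = (p ^ (n + 1))⁻¹ := by rw [zpow_neg, zpow_natCast]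
  have h7 : p ^ (-(n : ℤ)) = (p ^ n)⁻¹ := by rw [zpow_neg, zpow_natCast]
  generalize qPoch (p ^ (-(n : ℤ))) p k = X
  generalize qPoch (s * p ^ (n + 1)) p k = Y
  generalize qPoch p p k = Z at *
  rw [h6, h7]
  field_simp
  ring

/-- The parameter-raising relation, which is symmetric in the four parameters. -/
theorem askeyWilson_raise {q z a : ℂ} (hq : q ≠ 0) (hq1 : ∀ m : ℕ, 0 < m → q ^ m ≠ 1)
    (hz : z ≠ 0) (ha : a ≠ 0) (n : ℕ) (b c d : ℂ) :
    z⁻¹ ^ 2 * (1 - a * z) * (1 - b * z) * (1 - c * z) * (1 - d * z) *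
          askeyWilson (q ^ 2) n (q * z) (a * q) (b * q) (c * q) (d * q) -
        z ^ 2 * (1 - a * z⁻¹) * (1 - b * z⁻¹) * (1 - c * z⁻¹) * (1 - d * z⁻¹) *
          askeyWilson (q ^ 2) n (q⁻¹ * z) (a * q) (b * q) (c * q) (d * q) =
      (z⁻¹ - z) * (q ^ n)⁻¹ * askeyWilson (q ^ 2) (n + 1) z a b c d := by
  have hp : q ^ 2 ≠ 0 := pow_ne_zero _ hq
  have hp1 : ∀ m : ℕ, 0 < m → (q ^ 2) ^ m ≠ 1 := fun m hm => by
    rw [← pow_mul]; exact hq1 _ (by omega)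
  set p := q ^ 2 with hpdef
  set φ : ℕ → ℂ := fun k => qPoch (a * z) p k * qPoch (a * z⁻¹) p k with hφ
  -- the action on a basis element
  have hbasis : ∀ k, z⁻¹ ^ 2 * (1 - a * z) * (1 - b * z) * (1 - c * z) * (1 - d * z) *
        (qPoch (a * q * (q * z)) p k * qPoch (a * q * (q * z)⁻¹) p k) -
      z ^ 2 * (1 - a * z⁻¹) * (1 - b * z⁻¹) * (1 - c * z⁻¹) * (1 - d * z⁻¹) *
        (qPoch (a * q * (q⁻¹ * z)) p k * qPoch (a * q * (q⁻¹ * z)⁻¹) p k) =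
      (z⁻¹ - z) * (a⁻¹ * (p ^ k)⁻¹ * (1 - a * b * p ^ k) * (1 - a * c * p ^ k) *
        (1 - a * d * p ^ k) * φ k - a⁻¹ * (p ^ k)⁻¹ * (1 - a * b * c * d * p ^ k) * φ (k + 1)) := by
    intro k
    have hup := awBasis_shift_up hq hz a k
    have hdown := awBasis_shift_down hq hz a k
    have hs : φ (k + 1) = (1 - a * z * p ^ k) * (1 - a * z⁻¹ * p ^ k) * φ k := by
      simp only [hφ, qPoch_succ]; ring
    rw [hs]
    have hpk : p ^ k ≠ 0 := pow_ne_zero _ hp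
    -- The left side is antisymmetric under `z ↔ z⁻¹` with exponents between `-2` and `2`. Its
    -- quotient by `z⁻¹ - z` is thus linear in `z + z⁻¹`, a combination of `1` and the ratio of
    -- consecutive basis elements.
    have hid : z⁻¹ ^ 2 * (1 - a * z * p ^ k) * (1 - b * z) * (1 - c * z) * (1 - d * z) -
        z ^ 2 * (1 - a * z⁻¹ * p ^ k) * (1 - b * z⁻¹) * (1 - c * z⁻¹) * (1 - d * z⁻¹) =
        (z⁻¹ - z) * (a⁻¹ * (p ^ k)⁻¹ * (1 - a * b * p ^ k) * (1 - a * c * p ^ k) *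
        (1 - a * d * p ^ k) - a⁻¹ * (p ^ k)⁻¹ * (1 - a * b * c * d * p ^ k) *
          ((1 - a * z * p ^ k) * (1 - a * z⁻¹ * p ^ k))) := by
      generalize p ^ k = r at *
      field_simp
      ring
    simp only [← hpdef] at hup hdown
    linear_combination z⁻¹ ^ 2 * (1 - b * z) * (1 - c * z) * (1 - d * z) * hup
      - z ^ 2 * (1 - b * z⁻¹) * (1 - c * z⁻¹) * (1 - d * z⁻¹) * hdown + φ k * hid
  -- comparison of coefficients
  set C : ℕ → ℂ := fun k => awCoeff p n k (a * q) (b * q) (c * q) (d * q) with hC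
  have harg : a * q * (b * q) * (c * q) * (d * q) * p ^ ((n : ℤ) - 1) =
      a * b * c * d * p ^ (n + 1) := by
    rw [zpow_sub_one₀ hp, zpow_natCast, pow_succ, hpdef]
    field_simp
  have harg' : a * b * c * d * p ^ (((n + 1 : ℕ) : ℤ) - 1) = a * b * c * d * p ^ n := by
    congr 1; rw [← zpow_natCast]; congr 1; push_cast; ring
  have h0 : C 0 * ((1 - a * b) * (1 - a * c) * (1 - a * d)) = awCoeff p (n + 1) 0 a b c d := by
    simp only [hC, awCoeff, qPoch_zero, pow_zero, mul_one, Nat.sub_zero, qPoch_succ_left]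
    rw [show a * q * (b * q) = a * b * p by rw [hpdef]; ring,
      show a * q * (c * q) = a * c * p by rw [hpdef]; ring,
      show a * q * (d * q) = a * d * p by rw [hpdef]; ring]
    ring
  have hmain : ∀ k < n, C (k + 1) * ((p ^ (k + 1))⁻¹ * (1 - a * b * p ^ (k + 1)) *
        (1 - a * c * p ^ (k + 1)) * (1 - a * d * p ^ (k + 1))) -
      C k * ((p ^ k)⁻¹ * (1 - a * b * c * d * p ^ k)) = awCoeff p (n + 1) (k + 1) a b c d := by
    intro k hk
    have haux := awCoeff_raise_aux (s := a * b * c * d) hp hp1 n k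
    simp only [hC, awCoeff, harg, harg']
    have hs : ∀ x, qPoch (x * p ^ (k + 1)) p (n + 1 - (k + 1)) =
        (1 - x * p ^ (k + 1)) * qPoch (x * p * p ^ (k + 1)) p (n - (k + 1)) := by
      intro x
      obtain ⟨m, rfl⟩ : ∃ m, n = k + 1 + m := ⟨n - (k + 1), by omega⟩
      rw [show k + 1 + m + 1 - (k + 1) = m + 1 by omega, qPoch_succ_left,
        show k + 1 + m - (k + 1) = m by omega]
      congr 2; ring
    have hs' : ∀ x, qPoch (x * p * p ^ k) p (n - k) =
        (1 - x * p ^ (k + 1)) * qPoch (x * p * p ^ (k + 1)) p (n - (k + 1)) := by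
      intro x
      rw [← hs, show x * p * p ^ k = x * p ^ (k + 1) by ring, show n + 1 - (k + 1) = n - k by omega]
    rw [show a * q * (b * q) = a * b * p by rw [hpdef]; ring,
      show a * q * (c * q) = a * c * p by rw [hpdef]; ring,
      show a * q * (d * q) = a * d * p by rw [hpdef]; ring, hs, hs, hs, hs', hs', hs']
    have hpk : p ^ k ≠ 0 := pow_ne_zero _ hp
    have hpk' : p ^ (k + 1) ≠ 0 := pow_ne_zero _ hp
    have e1 : p ^ (k + 1) * (p ^ (k + 1))⁻¹ = 1 := mul_inv_cancel₀ hpk'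
    have e2 : p ^ k * (p ^ k)⁻¹ = 1 := mul_inv_cancel₀ hpk
    generalize (p ^ (k + 1))⁻¹ = r1 at *
    generalize (p ^ k)⁻¹ = r2 at *
    linear_combination
      ((1 - a * b * p ^ (k + 1)) * (1 - a * c * p ^ (k + 1)) * (1 - a * d * p ^ (k + 1)) *
        (qPoch (a * b * p * p ^ (k + 1)) p (n - (k + 1)) *
          qPoch (a * c * p * p ^ (k + 1)) p (n - (k + 1)) *
          qPoch (a * d * p * p ^ (k + 1)) p (n - (k + 1)))) *
      (haux + qPoch (p ^ (-(n : ℤ))) p (k + 1) * qPoch (a * b * c * d * p ^ (n + 1)) p (k + 1) /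
          qPoch p p (k + 1) * e1 - qPoch (p ^ (-(n : ℤ))) p k *
          qPoch (a * b * c * d * p ^ (n + 1)) p k / qPoch p p k * (1 - a * b * c * d * p ^ k) * e2)
  -- The analogue of `hmain` at `k = n`, where the upper neighbour is absent because `(p⁻ⁿ; p)_{n+1}
  -- = 0`.
  have htop : -(C n * ((p ^ n)⁻¹ * (1 - a * b * c * d * p ^ n))) =
      awCoeff p (n + 1) (n + 1) a b c d := by
    have haux := awCoeff_raise_aux (s := a * b * c * d) hp hp1 n n
    have hzero : qPoch (p ^ (-(n : ℤ))) p (n + 1) = 0 := by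
      rw [qPoch_succ, zpow_neg, zpow_natCast, inv_mul_cancel₀ (pow_ne_zero _ hp), sub_self, mul_zero]
    rw [hzero, zero_mul, zero_div, zero_sub] at haux
    simp only [hC, awCoeff, harg, harg', Nat.sub_self, qPoch_zero, mul_one]
    have e2 : p ^ n * (p ^ n)⁻¹ = 1 := mul_inv_cancel₀ (pow_ne_zero _ hp)
    generalize (p ^ n)⁻¹ = r2 at *
    linear_combination haux - qPoch (p ^ (-(n : ℤ))) p n *
      qPoch (a * b * c * d * p ^ (n + 1)) p n / qPoch p p n * (1 - a * b * c * d * p ^ n) * e2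
  have hsum : ∑ k ∈ range (n + 1), C k * ((p ^ k)⁻¹ * (1 - a * b * p ^ k) * (1 - a * c * p ^ k) *
        (1 - a * d * p ^ k) * φ k - (p ^ k)⁻¹ * (1 - a * b * c * d * p ^ k) * φ (k + 1)) =
      ∑ k ∈ range (n + 2), awCoeff p (n + 1) k a b c d * φ k := by
    simp only [mul_sub (C _), sum_sub_distrib]
    rw [sum_range_succ', sum_range_succ (fun k => C k * ((p ^ k)⁻¹ * (1 - a * b * c * d * p ^ k) *
      φ (k + 1))), sum_range_succ', sum_range_succ, ← h0, ← htop]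
    have : ∑ k ∈ range n, awCoeff p (n + 1) (k + 1) a b c d * φ (k + 1) =
        ∑ k ∈ range n, (C (k + 1) * ((p ^ (k + 1))⁻¹ * (1 - a * b * p ^ (k + 1)) *
          (1 - a * c * p ^ (k + 1)) * (1 - a * d * p ^ (k + 1)) * φ (k + 1)) -
          C k * ((p ^ k)⁻¹ * (1 - a * b * c * d * p ^ k) * φ (k + 1))) :=
      sum_congr rfl fun k hk => by rw [← hmain k (mem_range.1 hk)]; ring
    rw [this, sum_sub_distrib]
    simp only [pow_zero, inv_one, mul_one, one_mul]
    ring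
  have haq : (a ^ (n + 1))⁻¹ = (a ^ n)⁻¹ * a⁻¹ := by rw [pow_succ, mul_inv]
  rw [askeyWilson_eq, askeyWilson_eq, askeyWilson_eq, ← hsum, haq, mul_pow, mul_inv]
  simp only [mul_sum, ← sum_sub_distrib]
  refine sum_congr rfl fun k _ => ?_
  have h := hbasis k
  linear_combination (a ^ n)⁻¹ * (q ^ n)⁻¹ * C k * h

/-- Avoiding all integral powers, rather than finitely many, makes the hypothesis stable under the
shifts of `z` used in the inductions. -/
theorem generic_mul_left {q z : ℂ} (hq : q ≠ 0) (h : ∀ m : ℤ, z ^ 2 ≠ (q ^ 2) ^ m) (j : ℤ) :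
    ∀ m : ℤ, (q ^ j * z) ^ 2 ≠ (q ^ 2) ^ m := by
  intro m hm
  refine h (m - j) ?_
  have hp : q ^ 2 ≠ 0 := pow_ne_zero _ hq
  rw [zpow_sub₀ hp, ← hm, mul_pow, show (q ^ j) ^ 2 = (q ^ 2) ^ j by
    rw [← zpow_natCast, ← zpow_natCast, ← zpow_mul, ← zpow_mul, mul_comm]]
  field_simp

/-- The symmetry of the Askey-Wilson polynomials (Sears' transformation). -/
theorem askeyWilson_swap_ab {q : ℂ} (hq : q ≠ 0) (hq1 : ∀ m : ℕ, 0 < m → q ^ m ≠ 1) (n : ℕ) :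
    ∀ {z a b : ℂ} (c d : ℂ), z ≠ 0 → (∀ m : ℤ, z ^ 2 ≠ (q ^ 2) ^ m) → a ≠ 0 → b ≠ 0 →
      askeyWilson (q ^ 2) n z a b c d = askeyWilson (q ^ 2) n z b a c d := by
  induction n with
  | zero => intros; simp [askeyWilson, qPoch]
  | succ n ih =>
    intro z a b c d hz hgen ha hb
    have h1 := askeyWilson_raise hq hq1 hz ha n b c d
    have h2 := askeyWilson_raise hq hq1 hz hb n a c d
    have hup := generic_mul_left hq hgen 1
    have hdown := generic_mul_left hq hgen (-1)
    rw [zpow_one] at hup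
    rw [zpow_neg_one] at hdown
    -- The left side of the raising relation has symmetric coefficients and polynomials of degree
    -- `n`. Once the induction hypothesis aligns their parameters, the two degree `n + 1`
    -- polynomials share the same left side.
    rw [ih (c * q) (d * q) (mul_ne_zero hq hz) hup (mul_ne_zero hb hq) (mul_ne_zero ha hq),
      ih (c * q) (d * q) (mul_ne_zero (inv_ne_zero hq) hz) hdown (mul_ne_zero hb hq)
        (mul_ne_zero ha hq)] at h2
    have hne : (z⁻¹ - z) * (q ^ n)⁻¹ ≠ 0 := by
      refine mul_ne_zero (fun h => hgen 0 ?_) (inv_ne_zero (pow_ne_zero _ hq))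
      rw [sub_eq_zero] at h
      nth_rw 1 [zpow_zero, sq, ← h, inv_mul_cancel₀ hz]
    refine mul_left_cancel₀ hne ?_
    rw [← h1, ← h2]
    ring

/-! ### Second-order relations from pairs of first-order ones. -/

theorem generic_ne_zero {q z : ℂ}
    (h : ∀ m : ℤ, z ^ 2 ≠ (q ^ 2) ^ m) :
    1 - z ^ 2 ≠ 0 ∧ 1 - q ^ 2 * z ^ 2 ≠ 0 ∧ z ^ 2 - 1 ≠ 0 ∧ z ^ 2 - q ^ 2 ≠ 0 := by
  have h0 := h 0
  have h1 := h 1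
  have h2 := h (-1)
  rw [zpow_zero] at h0
  rw [zpow_one] at h1
  rw [zpow_neg_one] at h2
  refine ⟨sub_ne_zero.2 (Ne.symm h0), fun h => h2 ?_, sub_ne_zero.2 h0,
    sub_ne_zero.2 h1⟩
  exact eq_inv_of_mul_eq_one_right (sub_eq_zero.1 h).symm

/-- Here `h2` and `h3` express the intermediate values at `qz` and `q⁻¹z` through `f` at `q²z`, `z`,
`q⁻²z`; substituting them into `h1` eliminates them and leaves a three-term relation. -/
theorem second_order_of_first_order {q z : ℂ} (hq : q ≠ 0) (hz : z ≠ 0)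
    (h : ∀ m : ℤ, z ^ 2 ≠ (q ^ 2) ^ m) {u v u' v' Gp Gm f₁ f₀ f₂ R : ℂ}
    (h1 : z⁻¹ * (1 - u * z) * (1 - v * z) * Gp - z * (1 - u * z⁻¹) * (1 - v * z⁻¹) * Gm =
      (z⁻¹ - z) * R)
    (h2 : (q * z)⁻¹ * (1 - u' * q⁻¹ * (q * z)) * (1 - v' * q⁻¹ * (q * z)) * f₁ -
      q * z * (1 - u' * q⁻¹ * (q * z)⁻¹) * (1 - v' * q⁻¹ * (q * z)⁻¹) * f₀ =
      ((q * z)⁻¹ - q * z) * Gp)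
    (h3 : (q⁻¹ * z)⁻¹ * (1 - u' * q⁻¹ * (q⁻¹ * z)) * (1 - v' * q⁻¹ * (q⁻¹ * z)) * f₀ -
      q⁻¹ * z * (1 - u' * q⁻¹ * (q⁻¹ * z)⁻¹) * (1 - v' * q⁻¹ * (q⁻¹ * z)⁻¹) * f₂ =
      ((q⁻¹ * z)⁻¹ - q⁻¹ * z) * Gm) :
    (1 - u * z) * (1 - v * z) * (1 - u' * z) * (1 - v' * z) /
          ((1 - z ^ 2) * (1 - q ^ 2 * z ^ 2)) * f₁ +
        (1 - u * z⁻¹) * (1 - v * z⁻¹) * (1 - u' * z⁻¹) * (1 - v' * z⁻¹) /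
          ((1 - z⁻¹ ^ 2) * (1 - q ^ 2 * z⁻¹ ^ 2)) * f₂ -
      ((1 - u * z) * (1 - v * z) * (q * z - u' * q⁻¹) * (q * z - v' * q⁻¹) /
          ((1 - z ^ 2) * (1 - q ^ 2 * z ^ 2)) +
        (1 - u * z⁻¹) * (1 - v * z⁻¹) * (q * z⁻¹ - u' * q⁻¹) * (q * z⁻¹ - v' * q⁻¹) /
          ((1 - z⁻¹ ^ 2) * (1 - q ^ 2 * z⁻¹ ^ 2))) * f₀ = R := by
  obtain ⟨n1, n2, n3, n4⟩ := generic_ne_zero h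
  have e1 : R = ((1 - u * z) * (1 - v * z) * Gp - (z - u) * (z - v) * Gm) / (1 - z ^ 2) := by
    rw [eq_div_iff n1]
    field_simp at h1
    linear_combination -h1
  have e2 : Gp = ((1 - u' * z) * (1 - v' * z) * f₁ -
      (q * z - u' * q⁻¹) * (q * z - v' * q⁻¹) * f₀) / (1 - q ^ 2 * z ^ 2) := by
    rw [eq_div_iff n2]
    field_simp at h2 ⊢
    linear_combination -h2
  have e3 : Gm = ((z - u') * (z - v') * f₂ -
      (q - u' * q⁻¹ * z) * (q - v' * q⁻¹ * z) * f₀) / (z ^ 2 - q ^ 2) := by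
    rw [eq_div_iff n4]
    field_simp at h3 ⊢
    linear_combination h3
  rw [e1, e2, e3]
  field_simp
  ring

/-- The Askey-Wilson `q`-difference equation, in the form that enters the elimination of a variable. -/
theorem askeyWilson_qDiff {q z a b c d : ℂ} (hq : q ≠ 0) (hq1 : ∀ m : ℕ, 0 < m → q ^ m ≠ 1)
    (hz : z ≠ 0) (h : ∀ m : ℤ, z ^ 2 ≠ (q ^ 2) ^ m) (ha : a ≠ 0) (hc : c ≠ 0) (n : ℕ) :
    (1 - a * z) * (1 - b * z) * ((1 - c * z) * (1 - d * z)) /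
          ((1 - z ^ 2) * (1 - q ^ 2 * z ^ 2)) * askeyWilson (q ^ 2) n (q ^ 2 * z) a b c d +
        (1 - a * z⁻¹) * (1 - b * z⁻¹) * ((1 - c * z⁻¹) * (1 - d * z⁻¹)) /
          ((1 - z⁻¹ ^ 2) * (1 - q ^ 2 * z⁻¹ ^ 2)) * askeyWilson (q ^ 2) n ((q ^ 2)⁻¹ * z) a b c d +
      (1 - (a + b) * (z + z⁻¹) / (1 + q ^ 2) + a * b / q ^ 2) *
          (1 - (c + d) * (z + z⁻¹) / (1 + q ^ 2) + c * d / q ^ 2) /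
          ((1 - q ^ 2 * z ^ 2) * (1 - q ^ 2 * z⁻¹ ^ 2) / (q ^ 2 * (1 + q ^ 2))) *
        askeyWilson (q ^ 2) n z a b c d =
    ((q ^ 2) ^ n)⁻¹ * (1 - (q ^ 2) ^ n * ((a + b) * (c + d)) / (1 + q ^ 2) +
      a * b * c * d * ((q ^ 2) ^ n) ^ 2 / q ^ 2) * askeyWilson (q ^ 2) n z a b c d := by
  obtain ⟨n1, n2, n3, n4⟩ := generic_ne_zero h
  have nq : 1 + q ^ 2 ≠ 0 := fun h => hq1 4 (by norm_num) (by linear_combination (q ^ 2 - 1) * h)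
  have hperm : ∀ {y : ℂ}, y ≠ 0 → (∀ m : ℤ, y ^ 2 ≠ (q ^ 2) ^ m) → ∀ {a b c d : ℂ}, a ≠ 0 → c ≠ 0 →
      askeyWilson (q ^ 2) n y c d a b = askeyWilson (q ^ 2) n y a b c d := by
    intro y hy hy' a b c d ha hc
    rw [askeyWilson_swap_bc, askeyWilson_swap_cd, askeyWilson_swap_ab hq hq1 n _ _ hy hy' hc ha,
      askeyWilson_swap_bc]
  have gup := generic_mul_left hq h 1
  have gdown := generic_mul_left hq h (-1)
  have gup2 := generic_mul_left hq h 2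
  have gdown2 := generic_mul_left hq h (-2)
  rw [zpow_one] at gup
  rw [zpow_neg_one] at gdown
  rw [zpow_ofNat] at gup2
  rw [zpow_neg, zpow_ofNat] at gdown2
  have hqz := mul_ne_zero hq hz
  have hqz' := mul_ne_zero (inv_ne_zero hq) hz
  have hcq : c * q⁻¹ ≠ 0 := mul_ne_zero hc (inv_ne_zero hq)
  -- The intermediate polynomial has parameters `aq, bq, c/q, d/q`. The relations `i2`, `i3` pass
  -- from `a, b, c, d` to it by pairing `c` with `d`, and `i1` returns by pairing `a` with `b`.
  have i1 := askeyWilson_lower (a := a) hq hz n b (c * q⁻¹) (d * q⁻¹)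
  have i2 := askeyWilson_lower (a := c * q⁻¹) hq hqz n (d * q⁻¹) a b
  have i3 := askeyWilson_lower (a := c * q⁻¹) hq hqz' n (d * q⁻¹) a b
  rw [inv_mul_cancel_right₀ hq, inv_mul_cancel_right₀ hq] at i1 i2 i3
  rw [show q * (q * z) = q ^ 2 * z by ring, inv_mul_cancel_left₀ hq,
    hperm (mul_ne_zero (pow_ne_zero _ hq) hz) gup2 ha hc, hperm hz h ha hc,
    hperm hqz gup (mul_ne_zero ha hq) hcq] at i2
  rw [show q⁻¹ * (q⁻¹ * z) = (q ^ 2)⁻¹ * z by rw [sq, mul_inv, mul_assoc], mul_inv_cancel_left₀ hq,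
    hperm (mul_ne_zero (inv_ne_zero (pow_ne_zero _ hq)) hz) gdown2 ha hc, hperm hz h ha hc,
    hperm hqz' gdown (mul_ne_zero ha hq) hcq] at i3
  have key := second_order_of_first_order hq hz h (u := a) (v := b) (u' := c) (v' := d)
    (Gp := (1 - c * q⁻¹ * (d * q⁻¹) * (q ^ 2) ^ n) * (q ^ n)⁻¹ *
      askeyWilson (q ^ 2) n (q * z) (a * q) (b * q) (c * q⁻¹) (d * q⁻¹))
    (Gm := (1 - c * q⁻¹ * (d * q⁻¹) * (q ^ 2) ^ n) * (q ^ n)⁻¹ *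
      askeyWilson (q ^ 2) n (q⁻¹ * z) (a * q) (b * q) (c * q⁻¹) (d * q⁻¹))
    (f₁ := askeyWilson (q ^ 2) n (q ^ 2 * z) a b c d)
    (f₀ := askeyWilson (q ^ 2) n z a b c d)
    (f₂ := askeyWilson (q ^ 2) n ((q ^ 2)⁻¹ * z) a b c d)
    (R := (1 - c * q⁻¹ * (d * q⁻¹) * (q ^ 2) ^ n) * (q ^ n)⁻¹ *
      ((1 - a * b * (q ^ 2) ^ n) * (q ^ n)⁻¹ * askeyWilson (q ^ 2) n z a b c d))
    (by linear_combination (1 - c * q⁻¹ * (d * q⁻¹) * (q ^ 2) ^ n) * (q ^ n)⁻¹ * i1)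
    (by linear_combination i2) (by linear_combination i3)
  -- The factorized diagonal coefficient differs from the one in `key` by a constant free of `z` and
  -- `n`. The same constant is added to the eigenvalue in `hR`.
  have hK : (1 - (a + b) * (z + z⁻¹) / (1 + q ^ 2) + a * b / q ^ 2) *
          (1 - (c + d) * (z + z⁻¹) / (1 + q ^ 2) + c * d / q ^ 2) /
          ((1 - q ^ 2 * z ^ 2) * (1 - q ^ 2 * z⁻¹ ^ 2) / (q ^ 2 * (1 + q ^ 2))) =
      a * b + c * d / q ^ 2 - (a + b) * (c + d) / (1 + q ^ 2) -
      ((1 - a * z) * (1 - b * z) * (q * z - c * q⁻¹) * (q * z - d * q⁻¹) /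
          ((1 - z ^ 2) * (1 - q ^ 2 * z ^ 2)) +
        (1 - a * z⁻¹) * (1 - b * z⁻¹) * (q * z⁻¹ - c * q⁻¹) * (q * z⁻¹ - d * q⁻¹) /
          ((1 - z⁻¹ ^ 2) * (1 - q ^ 2 * z⁻¹ ^ 2))) := by
    rw [show 1 - z⁻¹ ^ 2 = -(1 - z ^ 2) / z ^ 2 by field_simp; ring,
      show 1 - q ^ 2 * z⁻¹ ^ 2 = (z ^ 2 - q ^ 2) / z ^ 2 by field_simp]
    clear * - hq hz n1 n2 n4 nq
    generalize h1 : 1 - z ^ 2 = D1 at *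
    generalize h2 : 1 - q ^ 2 * z ^ 2 = D2 at *
    generalize h4 : z ^ 2 - q ^ 2 = D4 at *
    generalize h5 : 1 + q ^ 2 = D5 at *
    field_simp
    subst h1 h2 h4 h5
    ring
  have hR : ((q ^ 2) ^ n)⁻¹ * (1 - (q ^ 2) ^ n * ((a + b) * (c + d)) / (1 + q ^ 2) +
      a * b * c * d * ((q ^ 2) ^ n) ^ 2 / q ^ 2) =
      (1 - c * q⁻¹ * (d * q⁻¹) * (q ^ 2) ^ n) * (q ^ n)⁻¹ * ((1 - a * b * (q ^ 2) ^ n) * (q ^ n)⁻¹) +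
      (a * b + c * d / q ^ 2 - (a + b) * (c + d) / (1 + q ^ 2)) := by
    have hr : q ^ n ≠ 0 := pow_ne_zero _ hq
    rw [show (q ^ 2) ^ n = (q ^ n) ^ 2 by ring]
    generalize q ^ n = r at *
    field_simp
    ring
  rw [hK, hR]
  linear_combination key

/-- The contiguous relation that enters the elimination of a variable. -/
theorem askeyWilson_contiguous {q z a b c d : ℂ} (hq : q ≠ 0)
    (hq1 : ∀ m : ℕ, 0 < m → q ^ m ≠ 1) (hz : z ≠ 0) (h : ∀ m : ℤ, z ^ 2 ≠ (q ^ 2) ^ m)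
    (ha : a ≠ 0) (hb : b ≠ 0) (n : ℕ) :
    (1 - a * z) * (1 - b * z) * ((1 - c * z) * (1 - q ^ 2 * c * z)) /
          ((1 - z ^ 2) * (1 - q ^ 2 * z ^ 2)) *
          askeyWilson (q ^ 2) n (q ^ 2 * z) a b (q ^ 2 * c) ((q ^ 2)⁻¹ * d) +
        (1 - a * z⁻¹) * (1 - b * z⁻¹) * ((1 - c * z⁻¹) * (1 - q ^ 2 * c * z⁻¹)) /
          ((1 - z⁻¹ ^ 2) * (1 - q ^ 2 * z⁻¹ ^ 2)) *
          askeyWilson (q ^ 2) n ((q ^ 2)⁻¹ * z) a b (q ^ 2 * c) ((q ^ 2)⁻¹ * d) +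
      (1 - (a + b) * (z + z⁻¹) / (1 + q ^ 2) + a * b / q ^ 2) *
          ((1 - c * z) * (1 - c * z⁻¹)) /
          ((1 - q ^ 2 * z ^ 2) * (1 - q ^ 2 * z⁻¹ ^ 2) / (q ^ 2 * (1 + q ^ 2))) *
        askeyWilson (q ^ 2) n z a b (q ^ 2 * c) ((q ^ 2)⁻¹ * d) =
    ((q ^ 2) ^ n)⁻¹ * ((1 - (q ^ 2) ^ n * (a * c)) * (1 - (q ^ 2) ^ n * (b * c))) *
      askeyWilson (q ^ 2) n z a b c d := by
  obtain ⟨n1, n2, n3, n4⟩ := generic_ne_zero h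
  have nq : 1 + q ^ 2 ≠ 0 := fun h => hq1 4 (by norm_num) (by linear_combination (q ^ 2 - 1) * h)
  have hperm : ∀ {y : ℂ}, y ≠ 0 → (∀ m : ℤ, y ^ 2 ≠ (q ^ 2) ^ m) → ∀ {a b c d : ℂ}, a ≠ 0 → b ≠ 0 →
      askeyWilson (q ^ 2) n y b c a d = askeyWilson (q ^ 2) n y a b c d := by
    intro y hy hy' a b c d ha hb
    rw [askeyWilson_swap_bc, askeyWilson_swap_ab hq hq1 n _ _ hy hy' hb ha]
  have gup := generic_mul_left hq h 1
  have gdown := generic_mul_left hq h (-1)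
  have gup2 := generic_mul_left hq h 2
  have gdown2 := generic_mul_left hq h (-2)
  rw [zpow_one] at gup
  rw [zpow_neg_one] at gdown
  rw [zpow_ofNat] at gup2
  rw [zpow_neg, zpow_ofNat] at gdown2
  have hqz := mul_ne_zero hq hz
  have hqz' := mul_ne_zero (inv_ne_zero hq) hz
  have hbq : b * q⁻¹ ≠ 0 := mul_ne_zero hb (inv_ne_zero hq)
  -- Now `a` is paired with `c`, and `b` with `q²c`. The route no longer closes up: it starts at `a,
  -- b, q²c, q⁻²d` and ends at `a, b, c, d`.
  have i1 := askeyWilson_lower (a := a) hq hz n c (b * q⁻¹) (d * q⁻¹)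
  have i2 := askeyWilson_lower (a := b * q⁻¹) hq hqz n (q ^ 2 * c * q⁻¹) a ((q ^ 2)⁻¹ * d)
  have i3 := askeyWilson_lower (a := b * q⁻¹) hq hqz' n (q ^ 2 * c * q⁻¹) a ((q ^ 2)⁻¹ * d)
  rw [inv_mul_cancel_right₀ hq, inv_mul_cancel_right₀ hq] at i1 i2 i3
  have ed : (q ^ 2)⁻¹ * d * q = d * q⁻¹ := by field_simp
  have ec : q ^ 2 * c * q⁻¹ = c * q := by field_simp
  rw [askeyWilson_swap_bc, askeyWilson_swap_bc _ _ _ _ _ (b * q⁻¹),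
    askeyWilson_swap_bc _ _ _ a c] at i1
  rw [show q * (q * z) = q ^ 2 * z by ring, inv_mul_cancel_left₀ hq,
    hperm (mul_ne_zero (pow_ne_zero _ hq) hz) gup2 ha hb, hperm hz h ha hb,
    hperm hqz gup (mul_ne_zero ha hq) hbq, ed] at i2
  rw [show q⁻¹ * (q⁻¹ * z) = (q ^ 2)⁻¹ * z by rw [sq, mul_inv, mul_assoc], mul_inv_cancel_left₀ hq,
    hperm (mul_ne_zero (inv_ne_zero (pow_ne_zero _ hq)) hz) gdown2 ha hb, hperm hz h ha hb,
    hperm hqz' gdown (mul_ne_zero ha hq) hbq, ed] at i3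
  set l := (1 - b * q⁻¹ * (q ^ 2 * c * q⁻¹) * (q ^ 2) ^ n) * (q ^ n)⁻¹ with hl
  have key := second_order_of_first_order hq hz h (u := a) (v := c) (u' := b) (v' := q ^ 2 * c)
    (Gp := l * askeyWilson (q ^ 2) n (q * z) (a * q) (b * q⁻¹) (q ^ 2 * c * q⁻¹) (d * q⁻¹))
    (Gm := l * askeyWilson (q ^ 2) n (q⁻¹ * z) (a * q) (b * q⁻¹) (q ^ 2 * c * q⁻¹) (d * q⁻¹))
    (f₁ := askeyWilson (q ^ 2) n (q ^ 2 * z) a b (q ^ 2 * c) ((q ^ 2)⁻¹ * d))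
    (f₀ := askeyWilson (q ^ 2) n z a b (q ^ 2 * c) ((q ^ 2)⁻¹ * d))
    (f₂ := askeyWilson (q ^ 2) n ((q ^ 2)⁻¹ * z) a b (q ^ 2 * c) ((q ^ 2)⁻¹ * d))
    (R := l * ((1 - a * c * (q ^ 2) ^ n) * (q ^ n)⁻¹ * askeyWilson (q ^ 2) n z a b c d))
    (by rw [ec]; linear_combination l * i1)
    (by linear_combination i2) (by linear_combination i3)
  have hK : (1 - (a + b) * (z + z⁻¹) / (1 + q ^ 2) + a * b / q ^ 2) *
          ((1 - c * z) * (1 - c * z⁻¹)) /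
          ((1 - q ^ 2 * z ^ 2) * (1 - q ^ 2 * z⁻¹ ^ 2) / (q ^ 2 * (1 + q ^ 2))) =
      -((1 - a * z) * (1 - c * z) * (q * z - b * q⁻¹) * (q * z - q ^ 2 * c * q⁻¹) /
          ((1 - z ^ 2) * (1 - q ^ 2 * z ^ 2)) +
        (1 - a * z⁻¹) * (1 - c * z⁻¹) * (q * z⁻¹ - b * q⁻¹) * (q * z⁻¹ - q ^ 2 * c * q⁻¹) /
          ((1 - z⁻¹ ^ 2) * (1 - q ^ 2 * z⁻¹ ^ 2))) := by
    rw [show 1 - z⁻¹ ^ 2 = -(1 - z ^ 2) / z ^ 2 by field_simp; ring,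
      show 1 - q ^ 2 * z⁻¹ ^ 2 = (z ^ 2 - q ^ 2) / z ^ 2 by field_simp]
    clear * - hq hz n1 n2 n4 nq
    generalize h1 : 1 - z ^ 2 = D1 at *
    generalize h2 : 1 - q ^ 2 * z ^ 2 = D2 at *
    generalize h4 : z ^ 2 - q ^ 2 = D4 at *
    generalize h5 : 1 + q ^ 2 = D5 at *
    field_simp
    subst h1 h2 h4 h5
    ring
  have hR : ((q ^ 2) ^ n)⁻¹ * ((1 - (q ^ 2) ^ n * (a * c)) * (1 - (q ^ 2) ^ n * (b * c))) =
      l * ((1 - a * c * (q ^ 2) ^ n) * (q ^ n)⁻¹) := by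
    rw [hl, show (q ^ 2) ^ n = (q ^ n) ^ 2 by ring]
    generalize q ^ n = r at *
    field_simp
  rw [hK, hR]
  linear_combination key

/-! ### Nearest-neighbour form of the `q`-difference operator

A quadratic polynomial `L₀ + L₁ u + L₂ u²` is stored as the triple `L = (L₀, L₁, L₂)`. -/

/-- The value of a quadratic polynomial. -/
noncomputable def quadEval (L : ℂ × ℂ × ℂ) (u : ℂ) : ℂ := L.1 + L.2.1 * u + L.2.2 * u ^ 2

/-- The weight of the bond between the boundary datum `L` and a site with parameter `β`,
coordinate `z` and state `s`. -/
noncomputable def siteEval (p β z : ℂ) (L : ℂ × ℂ × ℂ) : SignType → ℂ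
  | .pos => quadEval L (β * z)
  | .neg => quadEval L (β * z⁻¹)
  | .zero => L.1 + L.2.1 * (β * (z + z⁻¹)) / (1 + p) + L.2.2 * β ^ 2 / p

/-- The denominator attached to a site in state `s`. -/
noncomputable def siteDen (p z : ℂ) : SignType → ℂ
  | .pos => (1 - z ^ 2) * (1 - p * z ^ 2)
  | .neg => (1 - z⁻¹ ^ 2) * (1 - p * z⁻¹ ^ 2)
  | .zero => (1 - p * z ^ 2) * (1 - p * z⁻¹ ^ 2) / (p * (1 + p))

/-- The boundary datum that a site in state `s` presents to the next site. -/
noncomputable def siteNext (p β z : ℂ) : SignType → ℂ × ℂ × ℂ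
  | .pos => (1, -(1 + p) * z / β, p * z ^ 2 / β ^ 2)
  | .neg => (1, -(1 + p) * z⁻¹ / β, p * z⁻¹ ^ 2 / β ^ 2)
  | .zero => (1, -(z + z⁻¹) / β, 1 / β ^ 2)

/-- The factor by which a shift in direction `s` multiplies a coordinate. -/
noncomputable def shiftFactor (p : ℂ) : SignType → ℂ
  | .pos => p
  | .neg => p⁻¹
  | .zero => 1

/-- The nearest-neighbour sum with left boundary datum `L` and right boundary `(β N, ζ)`. -/
noncomputable def nnSum (p ζ : ℂ) : (N : ℕ) → (ℕ → ℂ) → ℂ × ℂ × ℂ → ((Fin N → ℂ) → ℂ) →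
    (Fin N → ℂ) → ℂ
  | 0, β, L, f, z => siteEval p (β 0) ζ L 0 * f z
  | N + 1, β, L, f, z => ∑ s : SignType, siteEval p (β 0) (z 0) L s / siteDen p (z 0) s *
      nnSum p ζ N (fun i => β (i + 1)) (siteNext p (β 0) (z 0) s)
        (fun y => f (Fin.cons (shiftFactor p s * z 0) y)) (Fin.tail z)

/-- The sum of difference operators with left boundary datum `L` and right boundary `(β N, ζ)`. -/
noncomputable def diffSum (p ζ : ℂ) : (N : ℕ) → (ℕ → ℂ) → ℂ × ℂ × ℂ → ((Fin N → ℂ) → ℂ) →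
    (Fin N → ℂ) → ℂ
  | 0, β, L, f, z => siteEval p (β 0) ζ L 0 * f z
  | N + 1, β, L, f, z =>
      diffSum p ζ N (fun i => β (i + 1)) L (fun y => f (Fin.cons (z 0) y)) (Fin.tail z) +
      ∑ s ∈ ({-1, 1} : Finset SignType), siteEval p (β 0) (z 0) L s / siteDen p (z 0) s *
        (diffSum p ζ N (fun i => β (i + 1)) (siteNext p (β 0) (z 0) s)
            (fun y => f (Fin.cons (shiftFactor p s * z 0) y)) (Fin.tail z) -
          diffSum p ζ N (fun i => β (i + 1)) (siteNext p (β 0) (z 0) s)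
            (fun y => f (Fin.cons (z 0) y)) (Fin.tail z))

theorem siteEval_add (p β z : ℂ) (L L' : ℂ × ℂ × ℂ) (s : SignType) :
    siteEval p β z (L + L') s = siteEval p β z L s + siteEval p β z L' s := by
  cases s <;> simp [siteEval, quadEval] <;> ring

theorem siteEval_smul (p β z c : ℂ) (L : ℂ × ℂ × ℂ) (s : SignType) :
    siteEval p β z (c • L) s = c * siteEval p β z L s := by
  cases s <;> simp [siteEval, quadEval] <;> ring

theorem nnSum_add (p ζ : ℂ) (N : ℕ) (β : ℕ → ℂ) (L L' : ℂ × ℂ × ℂ) (f : (Fin N → ℂ) → ℂ)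
    (z : Fin N → ℂ) :
    nnSum p ζ N β (L + L') f z = nnSum p ζ N β L f z + nnSum p ζ N β L' f z := by
  cases N with
  | zero => simp only [nnSum, siteEval_add, add_mul]
  | succ N => simp only [nnSum, siteEval_add, add_div, add_mul, sum_add_distrib]

theorem nnSum_smul (p ζ : ℂ) (N : ℕ) (β : ℕ → ℂ) (c : ℂ) (L : ℂ × ℂ × ℂ) (f : (Fin N → ℂ) → ℂ)
    (z : Fin N → ℂ) : nnSum p ζ N β (c • L) f z = c * nnSum p ζ N β L f z := by
  cases N with
  | zero => simp only [nnSum, siteEval_smul, mul_assoc]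
  | succ N => simp only [nnSum, siteEval_smul, mul_div_assoc, mul_assoc, mul_sum]

theorem nnSum_const_mul (p ζ : ℂ) (N : ℕ) (β : ℕ → ℂ) (c : ℂ) (L : ℂ × ℂ × ℂ)
    (f : (Fin N → ℂ) → ℂ) (z : Fin N → ℂ) :
    nnSum p ζ N β L (fun y => c * f y) z = c * nnSum p ζ N β L f z := by
  induction N generalizing β L with
  | zero => simp only [nnSum]; ring
  | succ N ih =>
    simp only [nnSum, ih, mul_sum]
    exact sum_congr rfl fun s _ => by ring

/-- The three functionals `siteEval` vanish on the quadratics `siteNext` of the other states and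
take the value `siteDen` on their own. The formula is the expansion of `L` in the resulting dual
basis. -/
theorem quad_decomposition {q z β : ℂ} (hq : q ≠ 0) (nq : 1 + q ^ 2 ≠ 0) (hz : z ≠ 0)
    (h : ∀ m : ℤ, z ^ 2 ≠ (q ^ 2) ^ m) (hβ : β ≠ 0) (L : ℂ × ℂ × ℂ) :
    L = (siteEval (q ^ 2) β z L 0 / siteDen (q ^ 2) z 0) • siteNext (q ^ 2) β z 0 +
      ((siteEval (q ^ 2) β z L (-1) / siteDen (q ^ 2) z (-1)) • siteNext (q ^ 2) β z (-1) +
      (siteEval (q ^ 2) β z L 1 / siteDen (q ^ 2) z 1) • siteNext (q ^ 2) β z 1) := by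
  obtain ⟨n1, n2, n3, n4⟩ := generic_ne_zero h
  obtain ⟨a, b, c⟩ := L
  change (a, b, c) =
    (siteEval (q ^ 2) β z (a, b, c) .zero / siteDen (q ^ 2) z .zero) • siteNext (q ^ 2) β z .zero +
      ((siteEval (q ^ 2) β z (a, b, c) .neg / siteDen (q ^ 2) z .neg) • siteNext (q ^ 2) β z .neg +
      (siteEval (q ^ 2) β z (a, b, c) .pos / siteDen (q ^ 2) z .pos) • siteNext (q ^ 2) β z .pos)
  simp only [siteEval, siteDen, siteNext, quadEval]
  rw [show 1 - z⁻¹ ^ 2 = -(1 - z ^ 2) / z ^ 2 by field_simp; ring,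
      show 1 - q ^ 2 * z⁻¹ ^ 2 = (z ^ 2 - q ^ 2) / z ^ 2 by field_simp]
  clear * - hq hz n1 n2 n4 nq hβ
  generalize h1 : 1 - z ^ 2 = D1 at *
  generalize h2 : 1 - q ^ 2 * z ^ 2 = D2 at *
  generalize h4 : z ^ 2 - q ^ 2 = D4 at *
  generalize h5 : 1 + q ^ 2 = D5 at *
  refine Prod.ext ?_ (Prod.ext ?_ ?_) <;>
  · simp only [Prod.smul_mk, Prod.mk_add_mk, smul_eq_mul]
    field_simp
    subst h1 h2 h4 h5
    ring

/-- Expanding the differences at the first site, the unshifted terms carry `L` minus its components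
along the states `±1`. By `quad_decomposition` this is the component along the state `0`. -/
theorem diffSum_eq_nnSum {q ζ : ℂ} (hq : q ≠ 0) (nq : 1 + q ^ 2 ≠ 0) :
    ∀ (N : ℕ) (β : ℕ → ℂ) (L : ℂ × ℂ × ℂ) (f : (Fin N → ℂ) → ℂ) (z : Fin N → ℂ),
      (∀ i, z i ≠ 0) → (∀ i, ∀ m : ℤ, z i ^ 2 ≠ (q ^ 2) ^ m) → (∀ i < N, β i ≠ 0) →
      diffSum (q ^ 2) ζ N β L f z = nnSum (q ^ 2) ζ N β L f z
  | 0, _, _, _, _ => fun _ _ _ => rfl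
  | N + 1, β, L, f, z => by
    intro hz hgen hβ
    have ih := fun L' f' => diffSum_eq_nnSum (ζ := ζ) hq nq N (fun i => β (i + 1)) L' f' (Fin.tail z)
      (fun i => hz i.succ) (fun i => hgen i.succ) (fun i hi => hβ (i + 1) (by omega))
    have hdec := congrArg (fun L' => nnSum (q ^ 2) ζ N (fun i => β (i + 1)) L'
      (fun y => f (Fin.cons (z 0) y)) (Fin.tail z))
      (quad_decomposition hq nq (hz 0) (hgen 0) (hβ 0 (by omega)) L)
    simp only [nnSum_add, nnSum_smul] at hdec
    simp only [diffSum, nnSum, ih, SignType.univ_eq]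
    rw [sum_insert (by decide), sum_insert (by decide), sum_singleton, sum_insert (by decide),
      sum_singleton, hdec, show shiftFactor (q ^ 2) 0 = 1 from rfl, one_mul]
    ring

/-! ### The coefficients `Phi` -/

/-- The coefficients of `diffSum`, with left boundary datum `L` and right boundary `(β N, ζ)`. -/
noncomputable def phiRec (p ζ : ℂ) : (N : ℕ) → (ℕ → ℂ) → ℂ × ℂ × ℂ → (Fin N → SignType) →
    (Fin N → ℂ) → ℂ
  | 0, β, L, _, _ => siteEval p (β 0) ζ L 0
  | N + 1, β, L, ν, z => if ν 0 = 0 then phiRec p ζ N (fun i => β (i + 1)) L (Fin.tail ν) (Fin.tail z)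
      else siteEval p (β 0) (z 0) L (ν 0) / siteDen p (z 0) (ν 0) *
        phiRec p ζ N (fun i => β (i + 1)) (siteNext p (β 0) (z 0) (ν 0)) (Fin.tail ν) (Fin.tail z)

/-- `PhiSupport` with a general left boundary datum. -/
noncomputable def phiGen (p ζ : ℂ) {N : ℕ} (β : ℕ → ℂ) (L : ℂ × ℂ × ℂ) (S : Finset (Fin N))
    (y : Fin N → ℂ) : ℂ :=
  (∏ i ∈ S, if ∀ l ∈ S, i ≤ l then quadEval L (β i * y i) else 1) *
    (∏ i ∈ S, ∏ k ∈ S, if i < k ∧ ∀ l ∈ S, ¬ (i < l ∧ l < k) then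
      (1 - β k * y k * y i / β i) * (1 - p * β k * y k * y i / β i) else 1) /
    (∏ i ∈ S, ((1 - y i ^ 2) * (1 - p * y i ^ 2))) *
    (∏ i ∈ S, if ∀ l ∈ S, l ≤ i then
      (1 - β N * ζ * y i / β i) * (1 - β N * y i / (β i * ζ)) else 1)

theorem phiGen_map_succ (p ζ : ℂ) {N : ℕ} (β : ℕ → ℂ) (L : ℂ × ℂ × ℂ) (S : Finset (Fin N))
    (y : Fin (N + 1) → ℂ) :
    phiGen p ζ β L (S.map (Fin.succEmb N)) y =
      phiGen p ζ (fun i => β (i + 1)) L S (Fin.tail y) := by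
  simp [phiGen, prod_map, Fin.tail]

/-- The factor of the first element of the support. -/
theorem phiGen_insert_zero {p ζ : ℂ} {N : ℕ} (β : ℕ → ℂ) (L M : ℂ × ℂ × ℂ) (S : Finset (Fin N))
    (y : Fin (N + 1) → ℂ) (hS : S.Nonempty)
    (hM : ∀ u, quadEval M u = (1 - u * y 0 / β 0) * (1 - p * u * y 0 / β 0)) :
    phiGen p ζ β L (insert 0 (S.map (Fin.succEmb N))) y =
      quadEval L (β 0 * y 0) / ((1 - y 0 ^ 2) * (1 - p * y 0 ^ 2)) *
        phiGen p ζ (fun i => β (i + 1)) M S (Fin.tail y) := by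
  have h0 : (0 : Fin (N + 1)) ∉ S.map (Fin.succEmb N) := by simp [Fin.succ_ne_zero]
  have hne : ∃ l ∈ S, True := by obtain ⟨x, hx⟩ := hS; exact ⟨x, hx, trivial⟩
  unfold phiGen
  simp only [prod_insert h0, prod_map, forall_mem_insert, forall_mem_map]
  simp only [Fin.coe_succEmb, Fin.succ_le_succ_iff, Fin.succ_lt_succ_iff, Fin.succ_pos, Fin.not_lt_zero,
    Fin.zero_le, lt_irrefl, Fin.val_succ, Fin.val_zero, le_refl, true_and, false_and, and_true,
    and_false, not_false_iff, if_true, if_false, implies_true, Fin.le_zero_iff,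
    Fin.succ_ne_zero, one_mul, Fin.tail, hM, prod_const_one, not_lt]
  -- As the rest of the support is nonempty, position `0` is not its last element and carries no
  -- right boundary factor.
  rw [if_neg fun h => hne.elim fun l hl => h l hl.1]
  simp only [mul_assoc p]
  rw [mul_one, one_mul, mul_div_mul_comm, mul_assoc]

theorem phiGen_singleton_zero {p ζ : ℂ} {N : ℕ} (β : ℕ → ℂ) (L : ℂ × ℂ × ℂ)
    (y : Fin (N + 1) → ℂ) :
    phiGen p ζ β L {0} y =
      quadEval L (β 0 * y 0) / ((1 - y 0 ^ 2) * (1 - p * y 0 ^ 2)) *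
        ((1 - β (N + 1) * ζ * y 0 / β 0) * (1 - β (N + 1) * y 0 / (β 0 * ζ))) := by
  simp [phiGen]

theorem phiRec_of_support_empty (p ζ : ℂ) (N : ℕ) (β : ℕ → ℂ) (L : ℂ × ℂ × ℂ)
    (ν : Fin N → SignType) (z : Fin N → ℂ) (hν : ∀ i, ν i = 0) :
    phiRec p ζ N β L ν z = siteEval p (β N) ζ L 0 := by
  induction N generalizing β L with
  | zero => rfl
  | succ N ih =>
    rw [phiRec, if_pos (hν 0)]
    exact ih _ _ _ _ fun i => hν i.succ

theorem mem_signSupport {N : ℕ} (ν : Fin N → SignType) (i : Fin N) :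
    i ∈ signSupport ν ↔ ν i ≠ 0 := by
  simp [signSupport]

theorem signSupport_succ_of_eq {N : ℕ} (ν : Fin (N + 1) → SignType) (h : ν 0 = 0) :
    signSupport ν = (signSupport (Fin.tail ν)).map (Fin.succEmb N) := by
  ext i
  refine Fin.cases ?_ (fun j => ?_) i
  · simp [mem_signSupport, h, Fin.succ_ne_zero]
  · simp [mem_signSupport, Fin.tail]

theorem signSupport_succ_of_ne {N : ℕ} (ν : Fin (N + 1) → SignType) (h : ν 0 ≠ 0) :
    signSupport ν = insert 0 ((signSupport (Fin.tail ν)).map (Fin.succEmb N)) := by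
  ext i
  refine Fin.cases ?_ (fun j => ?_) i
  · simp [mem_signSupport, h]
  · simp [mem_signSupport, Fin.tail, Fin.succ_ne_zero]

/-- In the states `±1` the quadratic `siteNext` is precisely the pair of factors linking an element
of the support to its successor, so the product over consecutive pairs can be peeled off from the
left. Sites in state `0` merely pass the datum on. -/
theorem phiGen_eq_phiRec {p ζ : ℂ} (hp : p ≠ 0) (hp' : 1 + p ≠ 0) (hζ : ζ ≠ 0) :
    ∀ (N : ℕ) (β : ℕ → ℂ) (L : ℂ × ℂ × ℂ) (ν : Fin N → SignType) (z : Fin N → ℂ),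
      (∀ i < N, β i ≠ 0) → (signSupport ν).Nonempty →
      phiGen p ζ β L (signSupport ν) (fun i => if ν i = -1 then (z i)⁻¹ else z i) =
        phiRec p ζ N β L ν z
  | 0, _, _, ν, _ => fun _ h => h.elim fun i _ => i.elim0
  | N + 1, β, L, ν, z => by
    intro hβ hS
    have ih := fun L' => phiGen_eq_phiRec hp hp' hζ N (fun i => β (i + 1)) L' (Fin.tail ν)
      (Fin.tail z) (fun i hi => hβ (i + 1) (by omega))
    by_cases h0 : ν 0 = 0
    · rw [phiRec, if_pos h0, signSupport_succ_of_eq ν h0, phiGen_map_succ]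
      rw [signSupport_succ_of_eq ν h0, map_nonempty] at hS
      exact ih L hS
    · rw [phiRec, if_neg h0, signSupport_succ_of_ne ν h0]
      set y : Fin (N + 1) → ℂ := fun i => if ν i = -1 then (z i)⁻¹ else z i with hy
      have hM : ∀ u, quadEval (siteNext p (β 0) (z 0) (ν 0)) u =
          (1 - u * y 0 / β 0) * (1 - p * u * y 0 / β 0) := by
        intro u
        simp only [hy]
        rcases h : ν 0 with _ | _ | _
        · exact absurd h h0
        · rw [if_pos (show SignType.neg = -1 from rfl)]
          simp only [siteNext, quadEval]; ring
        · rw [if_neg (by decide)]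
          simp only [siteNext, quadEval]; ring
      have hE : siteEval p (β 0) (z 0) L (ν 0) / siteDen p (z 0) (ν 0) =
          quadEval L (β 0 * y 0) / ((1 - y 0 ^ 2) * (1 - p * y 0 ^ 2)) := by
        simp only [hy]
        rcases h : ν 0 with _ | _ | _
        · exact absurd h h0
        · rw [if_pos (show SignType.neg = -1 from rfl)]; rfl
        · rw [if_neg (by decide)]; rfl
      rcases (signSupport (Fin.tail ν)).eq_empty_or_nonempty with hT | hT
      -- Position `0` is also the last element. Its right boundary factors are the state `0`
      -- evaluation at `(β_N, ζ)`: the boundary acts as a site frozen in state `0`.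
      · rw [hT, map_empty, insert_empty_eq, phiGen_singleton_zero (ζ := ζ), hE,
          phiRec_of_support_empty]
        · congr 1
          simp only [hy]
          rcases h : ν 0 with _ | _ | _
          · exact absurd h h0
          · rw [if_pos (show SignType.neg = -1 from rfl)]
            change _ = siteEval p _ ζ _ .zero
            simp only [siteNext, siteEval]
            field_simp
            ring
          · rw [if_neg (by decide)]
            change _ = siteEval p _ ζ _ .zero
            simp only [siteNext, siteEval]
            field_simp
            ring
        · intro i
          by_contra hi
          have : i ∈ signSupport (Fin.tail ν) := by simpa [signSupport] using hi
          simp [hT] at this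
      · rw [phiGen_insert_zero β L _ _ y hT hM, hE]
        congr 1
        exact ih _ hT

/-! ### Expansion of the difference operators -/

theorem coordDiff_succ_apply {N : ℕ} (q : ℂ) (j : Fin N) (s : SignType)
    (f : (Fin (N + 1) → ℂ) → ℂ) (c : ℂ) :
    (fun y => coordDiff q j.succ s f (Fin.cons c y)) =
      coordDiff q j s (fun y => f (Fin.cons c y)) := by
  funext y
  cases s <;> simp [coordDiff, scaleShift, LinearMap.funLeft_apply, Fin.cons_update]

theorem prod_coordDiff_succ_apply {N : ℕ} (q : ℂ) (l : List (Fin N)) (ν : Fin N → SignType)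
    (f : (Fin (N + 1) → ℂ) → ℂ) (c : ℂ) :
    (fun y => (l.map fun j => coordDiff q j.succ (ν j)).prod f (Fin.cons c y)) =
      (l.map fun j => coordDiff q j (ν j)).prod (fun y => f (Fin.cons c y)) := by
  induction l with
  | nil => rfl
  | cons j l ih =>
    simp only [List.map_cons, List.prod_cons, Module.End.mul_apply]
    rw [coordDiff_succ_apply, ih]

theorem multiDiff_cons_apply {N : ℕ} (q : ℂ) (s : SignType) (ν : Fin N → SignType)
    (f : (Fin (N + 1) → ℂ) → ℂ) (z : Fin (N + 1) → ℂ) :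
    multiDiff q (Fin.cons s ν : Fin (N + 1) → SignType) f z =
      coordDiff q 0 s (fun w => multiDiff q ν (fun y => f (Fin.cons (w 0) y)) (Fin.tail w)) z := by
  have h : multiDiff q (Fin.cons s ν : Fin (N + 1) → SignType) f = coordDiff q 0 s
      (((List.finRange N).map fun j => coordDiff q j.succ (ν j)).prod f) := by
    simp only [multiDiff, List.finRange_succ, List.map_cons, List.prod_cons, List.map_map,
      Module.End.mul_apply, Fin.cons_zero, Function.comp_def, Fin.cons_succ]
  rw [h]
  refine congrFun (congrArg _ (funext fun w => ?_)) z
  have := congrFun (prod_coordDiff_succ_apply q (List.finRange N) ν f (w 0)) (Fin.tail w)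
  simp only [Fin.cons_self_tail] at this
  exact this

/-- The sign turns each `∇ = 1 - E⁻¹` into `E⁻¹ - 1`, so both directions contribute "shifted minus
unshifted", as in `diffSum`. -/
theorem sum_phiRec_multiDiff (q ζ : ℂ) :
    ∀ (N : ℕ) (β : ℕ → ℂ) (L : ℂ × ℂ × ℂ) (f : (Fin N → ℂ) → ℂ) (z : Fin N → ℂ),
      ∑ ν : Fin N → SignType, (∏ i, if ν i = -1 then (-1 : ℂ) else 1) *
        (phiRec (q ^ 2) ζ N β L ν z * multiDiff q ν f z) = diffSum (q ^ 2) ζ N β L f z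
  | 0, β, L, f, z => by
    simp [phiRec, multiDiff, diffSum]
  | N + 1, β, L, f, z => by
    have ih := fun L' f' => sum_phiRec_multiDiff q ζ N (fun i => β (i + 1)) L' f' (Fin.tail z)
    rw [← (Fin.consEquiv fun _ => SignType).sum_comp, Fintype.sum_prod_type, SignType.univ_eq,
      sum_insert (by decide), diffSum, sum_insert (by decide), sum_insert (by decide),
      sum_singleton, sum_singleton]
    have hc : ∀ s ν, (Fin.consEquiv fun _ : Fin (N + 1) => SignType) (s, ν) = Fin.cons s ν :=
      fun _ _ => rfl
    have hupd : ∀ c, Function.update z 0 c = Fin.cons c (Fin.tail z) := fun c => by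
      conv_lhs => rw [← Fin.cons_self_tail z]
      rw [Fin.update_cons_zero]
    simp only [hc, Fin.prod_univ_succ, Fin.cons_zero, Fin.cons_succ, phiRec,
      Fin.tail_cons, multiDiff_cons_apply]
    have c0 : ∀ g : (Fin (N + 1) → ℂ) → ℂ, coordDiff q 0 0 g z = g z := fun g => rfl
    have c1 : ∀ g : (Fin (N + 1) → ℂ) → ℂ, coordDiff q 0 1 g z =
        g (Fin.cons (q ^ 2 * z 0) (Fin.tail z)) - g z := fun g => by
      rw [← hupd]
      rfl
    have c2 : ∀ g : (Fin (N + 1) → ℂ) → ℂ, coordDiff q 0 (-1) g z =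
        g z - g (Fin.cons ((q ^ 2)⁻¹ * z 0) (Fin.tail z)) := fun g => by
      rw [← hupd]
      rfl
    simp only [c0, c1, c2, Fin.cons_zero, Fin.tail_cons, if_true,
      if_neg (show ¬ ((0 : SignType) = -1) by decide), if_neg (show ¬ ((1 : SignType) = -1) by decide),
      if_neg (show ¬ ((-1 : SignType) = 0) by decide), if_neg (show ¬ ((1 : SignType) = 0) by decide),
      ← ih, mul_sub, mul_sum, ← sum_sub_distrib]
    rw [show shiftFactor (q ^ 2) 1 = q ^ 2 from rfl,
      show shiftFactor (q ^ 2) (-1) = (q ^ 2)⁻¹ from rfl]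
    congr 1
    · exact sum_congr rfl fun ν _ => by ring
    congr 1 <;> exact sum_congr rfl fun ν _ => by ring

/-- The quadratic polynomial `(1 - c u)(1 - c s u)`. -/
noncomputable def leftDatum (s c : ℂ) : ℂ × ℂ × ℂ := (1, -(c * (1 + s)), c ^ 2 * s)

theorem PhiSupport_eq_phiGen {N : ℕ} (q : ℂ) (α : ℕ → ℂ) (S : Finset (Fin N)) (y : Fin N → ℂ) :
    PhiSupport q α S y =
      phiGen (q ^ 2) (α (N + 2)) (fun i => α (i + 1)) (leftDatum (1 / α 0 ^ 2) 1) S y := by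
  unfold PhiSupport phiGen
  congr 3
  refine prod_congr rfl fun i _ => ?_
  congr 1
  simp only [quadEval, leftDatum]
  ring

theorem one_add_sq_ne_zero {q : ℂ} (hq1 : ∀ m : ℕ, 0 < m → q ^ m ≠ 1) : 1 + q ^ 2 ≠ 0 :=
  fun h => hq1 4 (by norm_num) (by linear_combination (q ^ 2 - 1) * h)

/-- The nearest-neighbour form of the operator `qDiffOp` at generic points. -/
theorem qDiffOp_apply {N : ℕ} {q : ℂ} (hq : q ≠ 0) (hq1 : ∀ m : ℕ, 0 < m → q ^ m ≠ 1)
    (α : ℕ → ℂ) (hα : ∀ k ≤ N + 2, α k ≠ 0) (f : (Fin N → ℂ) → ℂ) (z : Fin N → ℂ)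
    (hz : ∀ i, z i ≠ 0) (hgen : ∀ i, ∀ m : ℤ, z i ^ 2 ≠ (q ^ 2) ^ m) :
    qDiffOp q α f z = α 0 * q / α (N + 1) *
      (nnSum (q ^ 2) (α (N + 2)) N (fun i => α (i + 1)) (leftDatum (1 / α 0 ^ 2) 1) f z +
        (1 + α (N + 1) ^ 2 / (q ^ 2 * α 0 ^ 2) -
          siteEval (q ^ 2) (α (N + 1)) (α (N + 2)) (leftDatum (1 / α 0 ^ 2) 1) 0) * f z) := by
  have nq := one_add_sq_ne_zero hq1
  -- The operator omits `ν = 0`, whereas the nearest-neighbour sum includes it. That term is a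
  -- multiple of `f` and is compensated in the constant.
  rw [← diffSum_eq_nnSum hq nq N _ _ _ _ hz hgen (fun i hi => hα _ (by omega)),
    ← sum_phiRec_multiDiff, ← add_sum_erase _ _ (mem_univ (0 : Fin N → SignType))]
  have h0 : phiRec (q ^ 2) (α (N + 2)) N (fun i => α (i + 1)) (leftDatum (1 / α 0 ^ 2) 1) 0 z =
      siteEval (q ^ 2) (α (N + 1)) (α (N + 2)) (leftDatum (1 / α 0 ^ 2) 1) 0 :=
    phiRec_of_support_empty _ _ _ _ _ _ _ fun _ => rfl
  have h1 : multiDiff q (0 : Fin N → SignType) f = f := by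
    have : ∀ l : List (Fin N), (l.map fun j => coordDiff q j ((0 : Fin N → SignType) j)).prod = 1 := by
      intro l
      induction l with
      | nil => rfl
      | cons j l ih => rw [List.map_cons, List.prod_cons, ih, mul_one]; rfl
    rw [multiDiff, this]; rfl
  have h2 : (∏ i : Fin N, if (0 : Fin N → SignType) i = -1 then (-1 : ℂ) else 1) = 1 :=
    prod_eq_one fun i _ => by rw [if_neg (by simp)]
  rw [h0, h1, h2]
  unfold qDiffOp
  simp only [LinearMap.smul_apply, LinearMap.add_apply, LinearMap.sum_apply, Pi.smul_apply,
    Pi.add_apply, Finset.sum_apply, smul_eq_mul, Module.End.one_apply, Module.End.mul_apply,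
    LinearMap.mulLeft_apply, Pi.mul_apply]
  have h3 : ∀ ν ∈ univ.erase (0 : Fin N → SignType),
      (-1 : ℂ) ^ (univ.filter fun i => ν i = -1).card * (Phi q α ν z * multiDiff q ν f z) =
      (∏ i, if ν i = -1 then (-1 : ℂ) else 1) * (phiRec (q ^ 2) (α (N + 2)) N (fun i => α (i + 1))
        (leftDatum (1 / α 0 ^ 2) 1) ν z * multiDiff q ν f z) := by
    intro ν hν
    have hS : (signSupport ν).Nonempty := by
      obtain ⟨i, hi⟩ := Function.ne_iff.1 (ne_of_mem_erase hν)
      exact ⟨i, (mem_signSupport ν i).2 hi⟩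
    rw [prod_ite, prod_const, prod_const_one, mul_one, Phi, PhiSupport_eq_phiGen,
      phiGen_eq_phiRec (pow_ne_zero _ hq) nq (hα _ le_rfl) N _ _ ν z (fun i hi => hα _ (by omega)) hS]
  rw [sum_congr rfl h3]
  ring

/-! ### Elimination of the first variable -/

/-- The first coordinate, or the boundary value `ζ` if there is none. -/
noncomputable def headCoord (ζ : ℂ) : {N : ℕ} → (Fin N → ℂ) → ℂ
  | 0, _ => ζ
  | _ + 1, z => z 0

/-- The product of Askey-Wilson polynomials, with left datum `(s, c)` and right boundary `(β N, ζ)`. -/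
noncomputable def grProd (p s ζ : ℂ) : (N : ℕ) → (ℕ → ℂ) → ℂ → (Fin N → ℕ) → (Fin N → ℂ) → ℂ
  | 0, _, _, _, _ => 1
  | N + 1, β, c, n, z => askeyWilson p (n 0) (z 0) (β 0 * c) (β 0 * c * s)
        (β 1 / β 0 * headCoord ζ (Fin.tail z)) (β 1 / β 0 * (headCoord ζ (Fin.tail z))⁻¹) *
      grProd p s ζ N (fun i => β (i + 1)) (c * p ^ n 0) (Fin.tail n) (Fin.tail z)

theorem partialSum_succ {N : ℕ} (n : Fin (N + 1) → ℕ) (j : ℕ) :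
    partialSum n (j + 1) = n 0 + partialSum (Fin.tail n) j := by
  simp [partialSum, Fin.sum_univ_succ, Fin.tail]

theorem grProd_eq_prod (p s ζ : ℂ) : ∀ (N : ℕ) (β : ℕ → ℂ) (c : ℂ) (n : Fin N → ℕ) (z : Fin N → ℂ),
    grProd p s ζ N β c n z = ∏ i : Fin N, askeyWilson p (n i) (z i)
      (β i * (c * p ^ partialSum n i)) (β i * (c * p ^ partialSum n i) * s)
      (β (i + 1) / β i * (if h : (i : ℕ) + 1 < N then z ⟨i + 1, h⟩ else ζ))
      (β (i + 1) / β i * (if h : (i : ℕ) + 1 < N then z ⟨i + 1, h⟩ else ζ)⁻¹)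
  | 0, _, _, _, _ => rfl
  | N + 1, β, c, n, z => by
    have hh : headCoord ζ (Fin.tail z) =
        if h : ((0 : Fin (N + 1)) : ℕ) + 1 < N + 1 then z ⟨(0 : Fin (N + 1)) + 1, h⟩ else ζ := by
      cases N <;> rfl
    rw [grProd, grProd_eq_prod p s ζ N, Fin.prod_univ_succ, hh]
    congr 1
    · simp [partialSum]
    · refine prod_congr rfl fun i _ => ?_
      simp only [Fin.val_succ, partialSum_succ, pow_add, mul_assoc, Fin.tail,
        Nat.add_lt_add_iff_right]
      rfl

theorem gasperRahman_eq_grProd {N : ℕ} (q : ℂ) (α : ℕ → ℂ) (n : Fin N → ℕ) (z : Fin N → ℂ) :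
    gasperRahman q α n z =
      grProd (q ^ 2) (1 / α 0 ^ 2) (α (N + 2)) N (fun i => α (i + 1)) 1 n z := by
  rw [grProd_eq_prod, gasperRahman]
  refine prod_congr rfl fun i _ => ?_
  simp only [zCoord, pow_mul, one_mul]
  congr 1
  ring

/-- A factor depending only on the first coordinate sees only the state of the first site. This
isolates the coupling of an Askey-Wilson factor to its right neighbour. -/
theorem nnSum_head_mul (p ζ : ℂ) (N : ℕ) (β : ℕ → ℂ) (L : ℂ × ℂ × ℂ) (h : ℂ → ℂ)
    (g : (Fin (N + 1) → ℂ) → ℂ) (z : Fin (N + 1) → ℂ) :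
    nnSum p ζ (N + 1) β L (fun y => h (headCoord ζ y) * g y) z =
      ∑ s : SignType, siteEval p (β 0) (z 0) L s / siteDen p (z 0) s *
        (h (shiftFactor p s * z 0) * nnSum p ζ N (fun i => β (i + 1)) (siteNext p (β 0) (z 0) s)
        (fun y => g (Fin.cons (shiftFactor p s * z 0) y)) (Fin.tail z)) := by
  rw [nnSum]
  refine sum_congr rfl fun s _ => congrArg _ ?_
  rw [← nnSum_const_mul]
  rfl

/-- Elimination of the first variable, for a fixed state `t` of the next site. -/
theorem sum_site_askeyWilson {q : ℂ} (hq : q ≠ 0) (hq1 : ∀ m : ℕ, 0 < m → q ^ m ≠ 1)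
    {z w β β' c s : ℂ} (hz : z ≠ 0) (hgen : ∀ m : ℤ, z ^ 2 ≠ (q ^ 2) ^ m) (hw : w ≠ 0)
    (hβ : β ≠ 0) (hβ' : β' ≠ 0) (hc : c ≠ 0) (hs : s ≠ 0) (n : ℕ) (t : SignType) :
    ∑ r : SignType, siteEval (q ^ 2) β z (leftDatum s c) r / siteDen (q ^ 2) z r *
      (siteEval (q ^ 2) β' w (siteNext (q ^ 2) β z r) t *
        askeyWilson (q ^ 2) n (shiftFactor (q ^ 2) r * z) (β * c) (β * c * s)
          (β' / β * (shiftFactor (q ^ 2) t * w)) (β' / β * (shiftFactor (q ^ 2) t * w)⁻¹)) =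
    ((q ^ 2) ^ n)⁻¹ * siteEval (q ^ 2) β' w (leftDatum s (c * (q ^ 2) ^ n)) t *
      askeyWilson (q ^ 2) n z (β * c) (β * c * s) (β' / β * w) (β' / β * w⁻¹) := by
  have ha : β * c ≠ 0 := mul_ne_zero hβ hc
  have hb : β * c * s ≠ 0 := mul_ne_zero ha hs
  have nq := one_add_sq_ne_zero hq1
  obtain ⟨n1, n2, n3, n4⟩ := generic_ne_zero hgen
  rw [SignType.univ_eq, sum_insert (by decide), sum_insert (by decide), sum_singleton]
  -- Shifting the neighbour `w` by `q²` moves the last two Askey-Wilson parameters in opposite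
  -- directions, the situation of `askeyWilson_contiguous`.
  have contig : ∀ {w : ℂ}, w ≠ 0 →
      (siteEval (q ^ 2) β z (leftDatum s c) .zero / siteDen (q ^ 2) z .zero *
        (quadEval (siteNext (q ^ 2) β z .zero) (β' * w) *
          askeyWilson (q ^ 2) n z (β * c) (β * c * s)
            (β' / β * (q ^ 2 * w)) (β' / β * (q ^ 2 * w)⁻¹)) +
      (siteEval (q ^ 2) β z (leftDatum s c) .neg / siteDen (q ^ 2) z .neg *
        (quadEval (siteNext (q ^ 2) β z .neg) (β' * w) *
          askeyWilson (q ^ 2) n ((q ^ 2)⁻¹ * z) (β * c) (β * c * s)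
            (β' / β * (q ^ 2 * w)) (β' / β * (q ^ 2 * w)⁻¹)) +
      siteEval (q ^ 2) β z (leftDatum s c) .pos / siteDen (q ^ 2) z .pos *
        (quadEval (siteNext (q ^ 2) β z .pos) (β' * w) *
          askeyWilson (q ^ 2) n (q ^ 2 * z) (β * c) (β * c * s)
            (β' / β * (q ^ 2 * w)) (β' / β * (q ^ 2 * w)⁻¹)))) =
      ((q ^ 2) ^ n)⁻¹ * quadEval (leftDatum s (c * (q ^ 2) ^ n)) (β' * w) *
        askeyWilson (q ^ 2) n z (β * c) (β * c * s) (β' / β * w) (β' / β * w⁻¹) := by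
    intro w hw
    have key := askeyWilson_contiguous (c := β' / β * w) (d := β' / β * w⁻¹) hq hq1 hz hgen ha hb n
    rw [show q ^ 2 * (β' / β * w) = β' / β * (q ^ 2 * w) by ring,
      show (q ^ 2)⁻¹ * (β' / β * w⁻¹) = β' / β * (q ^ 2 * w)⁻¹ by rw [mul_inv]; ring] at key
    have e1 : siteEval (q ^ 2) β z (leftDatum s c) .zero = 1 - (β * c + β * c * s) * (z + z⁻¹) /
        (1 + q ^ 2) + β * c * (β * c * s) / q ^ 2 := by
      simp only [siteEval, leftDatum]; ring
    have e2 : siteEval (q ^ 2) β z (leftDatum s c) .pos = (1 - β * c * z) * (1 - β * c * s * z) := by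
      simp only [siteEval, leftDatum, quadEval]; ring
    have e3 : siteEval (q ^ 2) β z (leftDatum s c) .neg =
        (1 - β * c * z⁻¹) * (1 - β * c * s * z⁻¹) := by
      simp only [siteEval, leftDatum, quadEval]; ring
    have f1 : quadEval (siteNext (q ^ 2) β z .zero) (β' * w) =
        (1 - β' / β * w * z) * (1 - β' / β * w * z⁻¹) := by
      simp only [siteNext, quadEval]; field_simp; ring
    have f2 : quadEval (siteNext (q ^ 2) β z .pos) (β' * w) =
        (1 - β' / β * w * z) * (1 - β' / β * (q ^ 2 * w) * z) := by
      simp only [siteNext, quadEval]; field_simp; ring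
    have f3 : quadEval (siteNext (q ^ 2) β z .neg) (β' * w) =
        (1 - β' / β * w * z⁻¹) * (1 - β' / β * (q ^ 2 * w) * z⁻¹) := by
      simp only [siteNext, quadEval]; field_simp; ring
    have g1 : quadEval (leftDatum s (c * (q ^ 2) ^ n)) (β' * w) =
        (1 - (q ^ 2) ^ n * (β * c * (β' / β * w))) * (1 - (q ^ 2) ^ n * (β * c * s * (β' / β * w))) := by
      simp only [leftDatum, quadEval]; field_simp; ring
    rw [e1, e2, e3, f1, f2, f3, g1]
    simp only [siteDen]
    linear_combination key
  rcases t with _ | _ | _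
  -- An unshifted neighbour leaves the parameters unchanged, so the ordinary `q`-difference equation
  -- applies.
  · have key := askeyWilson_qDiff (b := β * c * s) (c := β' / β * w) (d := β' / β * w⁻¹) hq hq1 hz hgen
      ha (mul_ne_zero (div_ne_zero hβ' hβ) hw) n
    have e1 : siteEval (q ^ 2) β z (leftDatum s c) .zero = 1 - (β * c + β * c * s) * (z + z⁻¹) /
        (1 + q ^ 2) + β * c * (β * c * s) / q ^ 2 := by
      simp only [siteEval, leftDatum]; ring
    have e2 : siteEval (q ^ 2) β z (leftDatum s c) .pos = (1 - β * c * z) * (1 - β * c * s * z) := by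
      simp only [siteEval, leftDatum, quadEval]; ring
    have e3 : siteEval (q ^ 2) β z (leftDatum s c) .neg =
        (1 - β * c * z⁻¹) * (1 - β * c * s * z⁻¹) := by
      simp only [siteEval, leftDatum, quadEval]; ring
    have f1 : siteEval (q ^ 2) β' w (siteNext (q ^ 2) β z .zero) .zero =
        1 - (β' / β * w + β' / β * w⁻¹) * (z + z⁻¹) / (1 + q ^ 2) +
          β' / β * w * (β' / β * w⁻¹) / q ^ 2 := by
      simp only [siteNext, siteEval]; field_simp; ring
    have f2 : siteEval (q ^ 2) β' w (siteNext (q ^ 2) β z .pos) .zero =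
        (1 - β' / β * w * z) * (1 - β' / β * w⁻¹ * z) := by
      simp only [siteNext, siteEval]; field_simp; ring
    have f3 : siteEval (q ^ 2) β' w (siteNext (q ^ 2) β z .neg) .zero =
        (1 - β' / β * w * z⁻¹) * (1 - β' / β * w⁻¹ * z⁻¹) := by
      simp only [siteNext, siteEval]; field_simp; ring
    have g1 : siteEval (q ^ 2) β' w (leftDatum s (c * (q ^ 2) ^ n)) .zero =
        1 - (q ^ 2) ^ n * ((β * c + β * c * s) * (β' / β * w + β' / β * w⁻¹)) / (1 + q ^ 2) +
      β * c * (β * c * s) * (β' / β * w) * (β' / β * w⁻¹) * ((q ^ 2) ^ n) ^ 2 / q ^ 2 := by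
      simp only [leftDatum, siteEval]; field_simp; ring
    change siteEval (q ^ 2) β z (leftDatum s c) .zero / siteDen (q ^ 2) z .zero *
        (siteEval (q ^ 2) β' w (siteNext (q ^ 2) β z .zero) .zero *
          askeyWilson (q ^ 2) n (1 * z) (β * c) (β * c * s) (β' / β * (1 * w)) (β' / β * (1 * w)⁻¹)) +
      (siteEval (q ^ 2) β z (leftDatum s c) .neg / siteDen (q ^ 2) z .neg *
        (siteEval (q ^ 2) β' w (siteNext (q ^ 2) β z .neg) .zero *
          askeyWilson (q ^ 2) n ((q ^ 2)⁻¹ * z) (β * c) (β * c * s) (β' / β * (1 * w))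
            (β' / β * (1 * w)⁻¹)) +
      siteEval (q ^ 2) β z (leftDatum s c) .pos / siteDen (q ^ 2) z .pos *
        (siteEval (q ^ 2) β' w (siteNext (q ^ 2) β z .pos) .zero *
          askeyWilson (q ^ 2) n (q ^ 2 * z) (β * c) (β * c * s) (β' / β * (1 * w))
            (β' / β * (1 * w)⁻¹))) = _
    rw [e1, e2, e3, f1, f2, f3, one_mul, one_mul]
    rw [show siteEval (q ^ 2) β' w (leftDatum s (c * (q ^ 2) ^ n)) .zero = _ from g1]
    simp only [siteDen]
    linear_combination key
  -- A backward shift of `w` is a forward shift of `w⁻¹`; inverting `w` exchanges the last two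
  -- parameters.
  · have key := contig (inv_ne_zero hw)
    rw [inv_inv] at key
    change siteEval (q ^ 2) β z (leftDatum s c) .zero / siteDen (q ^ 2) z .zero *
        (quadEval (siteNext (q ^ 2) β z .zero) (β' * w⁻¹) *
          askeyWilson (q ^ 2) n (1 * z) (β * c) (β * c * s)
            (β' / β * ((q ^ 2)⁻¹ * w)) (β' / β * ((q ^ 2)⁻¹ * w)⁻¹)) +
      (siteEval (q ^ 2) β z (leftDatum s c) .neg / siteDen (q ^ 2) z .neg *
        (quadEval (siteNext (q ^ 2) β z .neg) (β' * w⁻¹) *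
          askeyWilson (q ^ 2) n ((q ^ 2)⁻¹ * z) (β * c) (β * c * s)
            (β' / β * ((q ^ 2)⁻¹ * w)) (β' / β * ((q ^ 2)⁻¹ * w)⁻¹)) +
      siteEval (q ^ 2) β z (leftDatum s c) .pos / siteDen (q ^ 2) z .pos *
        (quadEval (siteNext (q ^ 2) β z .pos) (β' * w⁻¹) *
          askeyWilson (q ^ 2) n (q ^ 2 * z) (β * c) (β * c * s)
            (β' / β * ((q ^ 2)⁻¹ * w)) (β' / β * ((q ^ 2)⁻¹ * w)⁻¹))) =
      ((q ^ 2) ^ n)⁻¹ * quadEval (leftDatum s (c * (q ^ 2) ^ n)) (β' * w⁻¹) * _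
    have hi : (q ^ 2 * w⁻¹)⁻¹ = (q ^ 2)⁻¹ * w := by rw [mul_inv, inv_inv]
    have hi' : q ^ 2 * w⁻¹ = ((q ^ 2)⁻¹ * w)⁻¹ := by rw [← hi, inv_inv]
    rw [hi, hi'] at key
    rw [one_mul]
    simp only [askeyWilson_swap_cd _ _ _ _ _ (β' / β * ((q ^ 2)⁻¹ * w)),
      askeyWilson_swap_cd _ _ _ _ _ (β' / β * w)]
    exact key
  · have key := contig hw
    change siteEval (q ^ 2) β z (leftDatum s c) .zero / siteDen (q ^ 2) z .zero *
        (quadEval (siteNext (q ^ 2) β z .zero) (β' * w) *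
          askeyWilson (q ^ 2) n (1 * z) (β * c) (β * c * s)
            (β' / β * (q ^ 2 * w)) (β' / β * (q ^ 2 * w)⁻¹)) + _ = _
    rw [one_mul]
    exact key

/-- The products of Askey-Wilson polynomials are eigenfunctions of the nearest-neighbour sum. -/
theorem nnSum_grProd {q s ζ : ℂ} (hq : q ≠ 0) (hq1 : ∀ m : ℕ, 0 < m → q ^ m ≠ 1) (hs : s ≠ 0)
    (hζ : ζ ≠ 0) :
    ∀ (N : ℕ) (β : ℕ → ℂ) (c : ℂ) (n : Fin N → ℕ) (z : Fin N → ℂ),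
      (∀ i, z i ≠ 0) → (∀ i, ∀ m : ℤ, z i ^ 2 ≠ (q ^ 2) ^ m) → (∀ i ≤ N, β i ≠ 0) → c ≠ 0 →
      nnSum (q ^ 2) ζ N β (leftDatum s c) (grProd (q ^ 2) s ζ N β c n) z =
        ((q ^ 2) ^ (∑ i, n i))⁻¹ *
          siteEval (q ^ 2) (β N) ζ (leftDatum s (c * (q ^ 2) ^ (∑ i, n i))) 0 *
          grProd (q ^ 2) s ζ N β c n z
  | 0, β, c, n, z => by
    intro _ _ _ _
    simp [nnSum]
  | N + 1, β, c, n, z => by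
    intro hz hgen hβ hc
    have ih := nnSum_grProd hq hq1 hs hζ N (fun i => β (i + 1)) (c * (q ^ 2) ^ n 0) (Fin.tail n)
      (Fin.tail z) (fun i => hz i.succ) (fun i => hgen i.succ) (fun i hi => hβ (i + 1) (by omega))
      (mul_ne_zero hc (pow_ne_zero _ (pow_ne_zero _ hq)))
    have hsum : ∑ i, n i = n 0 + ∑ i, Fin.tail n i := by rw [Fin.sum_univ_succ]; rfl
    set g := grProd (q ^ 2) s ζ N (fun i => β (i + 1)) (c * (q ^ 2) ^ n 0) (Fin.tail n) with hg
    have hβ0 := hβ 0 (by omega)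
    have hβ1 := hβ 1 (by omega)
    -- Summing out the first site turns the left datum `c` into `c p^{n_0}`, which is the datum
    -- built into the remaining product `g`. Thus the induction closes.
    suffices h : nnSum (q ^ 2) ζ (N + 1) β (leftDatum s c) (grProd (q ^ 2) s ζ (N + 1) β c n) z =
        ((q ^ 2) ^ n 0)⁻¹ * askeyWilson (q ^ 2) (n 0) (z 0) (β 0 * c) (β 0 * c * s)
          (β 1 / β 0 * headCoord ζ (Fin.tail z)) (β 1 / β 0 * (headCoord ζ (Fin.tail z))⁻¹) *
        nnSum (q ^ 2) ζ N (fun i => β (i + 1)) (leftDatum s (c * (q ^ 2) ^ n 0)) g (Fin.tail z) by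
      rw [h, ih, hsum, grProd, ← hg, pow_add, mul_inv, mul_assoc c]
      ring
    rw [nnSum]
    have hf : ∀ r : SignType, (fun y : Fin N → ℂ => grProd (q ^ 2) s ζ (N + 1) β c n
        (Fin.cons (shiftFactor (q ^ 2) r * z 0) y)) = fun y =>
        (fun w => askeyWilson (q ^ 2) (n 0) (shiftFactor (q ^ 2) r * z 0) (β 0 * c) (β 0 * c * s)
          (β 1 / β 0 * w) (β 1 / β 0 * w⁻¹)) (headCoord ζ y) * g y := by
      intro r
      funext y
      simp only [grProd, Fin.cons_zero, Fin.tail_cons, hg]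
    simp only [hf]
    -- The right neighbour is either the boundary, treated as state `0` with coordinate `ζ`, or a
    -- genuine site whose state `t` is fixed by exchanging the sums.
    cases N with
    | zero =>
      have key := sum_site_askeyWilson hq hq1 (hz 0) (hgen 0) hζ hβ0 hβ1 hc hs (n 0) 0
      simp only [show shiftFactor (q ^ 2) 0 = 1 from rfl, one_mul] at key
      simp only [nnSum, headCoord, Nat.zero_add]
      rw [show ∀ a b c d : ℂ, a * b * (c * d) = (a * c * b) * d from fun a b c d => by ring, ← key,
        sum_mul]
      exact sum_congr rfl fun r _ => by ring
    | succ N =>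
      refine (sum_congr rfl fun r _ => congrArg _ (nnSum_head_mul (q ^ 2) ζ N (fun i => β (i + 1)) _
        (fun w => askeyWilson (q ^ 2) (n 0) (shiftFactor (q ^ 2) r * z 0) (β 0 * c) (β 0 * c * s)
          (β 1 / β 0 * w) (β 1 / β 0 * w⁻¹)) g (Fin.tail z))).trans ?_
      rw [nnSum]
      simp only [mul_sum]
      rw [sum_comm]
      refine sum_congr rfl fun t _ => ?_
      have key := sum_site_askeyWilson hq hq1 (hz 0) (hgen 0) (hz 1) hβ0 hβ1 hc hs (n 0) t
      set G := nnSum (q ^ 2) ζ N (fun i => β (i + 1 + 1))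
        (siteNext (q ^ 2) (β 1) (z 1) t) (fun y => g (Fin.cons (shiftFactor (q ^ 2) t * z 1) y))
        (Fin.tail (Fin.tail z)) with hG
      change ∑ r : SignType, siteEval (q ^ 2) (β 0) (z 0) (leftDatum s c) r /
          siteDen (q ^ 2) (z 0) r * (siteEval (q ^ 2) (β 1) (z 1) (siteNext (q ^ 2) (β 0) (z 0) r) t /
          siteDen (q ^ 2) (z 1) t * (askeyWilson (q ^ 2) (n 0) (shiftFactor (q ^ 2) r * z 0) (β 0 * c)
            (β 0 * c * s) (β 1 / β 0 * (shiftFactor (q ^ 2) t * z 1))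
            (β 1 / β 0 * (shiftFactor (q ^ 2) t * z 1)⁻¹) * G)) =
        ((q ^ 2) ^ n 0)⁻¹ * askeyWilson (q ^ 2) (n 0) (z 0) (β 0 * c) (β 0 * c * s)
          (β 1 / β 0 * z 1) (β 1 / β 0 * (z 1)⁻¹) *
        (siteEval (q ^ 2) (β 1) (z 1) (leftDatum s (c * (q ^ 2) ^ n 0)) t /
          siteDen (q ^ 2) (z 1) t * G)
      rw [show ∀ a b c d e : ℂ, a * b * (c / d * e) = (a * c * b) * (e / d) from
        fun a b c d e => by ring, ← key, sum_mul]
      exact sum_congr rfl fun r _ => by ring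

/-- The eigenvalue of `opW1` on the polynomials of total degree `k`. -/
noncomputable def w1Eigenvalue (q γ : ℂ) (k : ℕ) : ℂ :=
  (γ * (q ^ 2) ^ k + (γ * (q ^ 2) ^ k)⁻¹) / 2

theorem opW1_gasperRahmanHat {N : ℕ} {q : ℂ} (hq : q ≠ 0) (hq1 : ∀ m : ℕ, 0 < m → q ^ m ≠ 1)
    (α : ℕ → ℂ) (hα : ∀ k ≤ N + 2, α k ≠ 0) (n : Fin N → ℕ) (z : Fin N → ℂ)
    (hz : ∀ i, z i ≠ 0) (hgen : ∀ i, ∀ m : ℤ, z i ^ 2 ≠ (q ^ 2) ^ m) :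
    opW1 q α (gasperRahmanHat q α n) z =
      w1Eigenvalue q (α (N + 1) / (α 0 * q)) (∑ i, n i) * gasperRahmanHat q α n z := by
  have h0 := hα 0 (by omega)
  have hN2 := hα (N + 2) le_rfl
  set C := (α (N + 1) * α (N + 2)) ^ (∑ i, n i) /
      (qPoch (α (N + 1) * α (N + 2)) (q ^ 2) (∑ i, n i) *
        qPoch (α (N + 1) * α (N + 2) / α 0 ^ 2) (q ^ 2) (∑ i, n i)) *
    (1 / ∏ i : Fin N, (α (i + 1) ^ n i * qPoch (α (i + 2) ^ 2 / α (i + 1) ^ 2) (q ^ 2) (n i)))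
    with hC
  have hhat : gasperRahmanHat q α n = fun z => C *
      grProd (q ^ 2) (1 / α 0 ^ 2) (α (N + 2)) N (fun i => α (i + 1)) 1 n z := by
    funext y
    rw [gasperRahmanHat, ← hC, gasperRahman_eq_grProd]
  have key := nnSum_grProd hq hq1 (one_div_ne_zero (pow_ne_zero 2 h0)) hN2 N (fun i => α (i + 1)) 1 n z
    hz hgen (fun i hi => hα _ (by omega)) one_ne_zero
  rw [opW1, LinearMap.smul_apply, Pi.smul_apply, smul_eq_mul,
    qDiffOp_apply hq hq1 α hα _ z hz hgen, hhat, nnSum_const_mul, key, w1Eigenvalue]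
  beta_reduce
  clear key hhat
  generalize grProd (q ^ 2) (1 / α 0 ^ 2) (α (N + 2)) N (fun i => α (i + 1)) 1 n z = G
  have hr : (q ^ 2) ^ (∑ i, n i) ≠ 0 := pow_ne_zero _ (pow_ne_zero _ hq)
  generalize (q ^ 2) ^ (∑ i, n i) = r at *
  -- The evaluation is quadratic in `x = p^{|n|}`. After division by `x` its linear term is
  -- independent of `n` and cancels against the additive constant, leaving the two exponentials of
  -- the eigenvalue.
  have he : ∀ x, siteEval (q ^ 2) (α (N + 1)) (α (N + 2)) (leftDatum (1 / α 0 ^ 2) x) 0 =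
      1 - x * ((1 + 1 / α 0 ^ 2) * α (N + 1) * (α (N + 2) + (α (N + 2))⁻¹) / (1 + q ^ 2)) +
        x ^ 2 * (1 / α 0 ^ 2 * α (N + 1) ^ 2 / q ^ 2) := by
    intro x
    change siteEval _ _ _ _ .zero = _
    simp only [siteEval, leftDatum]
    ring
  simp only [he]
  generalize (1 + 1 / α 0 ^ 2) * α (N + 1) * (α (N + 2) + (α (N + 2))⁻¹) / (1 + q ^ 2) = x
  field_simp
  ring

/-! ### The coefficients of the nearest-neighbour sum -/

/-- The coefficient of the shift by `ν` in the nearest-neighbour sum. -/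
noncomputable def nnCoeff (p ζ : ℂ) : (N : ℕ) → (ℕ → ℂ) → ℂ × ℂ × ℂ → (Fin N → ℂ) →
    (Fin N → SignType) → ℂ
  | 0, β, L, _, _ => siteEval p (β 0) ζ L 0
  | N + 1, β, L, z, ν => siteEval p (β 0) (z 0) L (ν 0) / siteDen p (z 0) (ν 0) *
      nnCoeff p ζ N (fun i => β (i + 1)) (siteNext p (β 0) (z 0) (ν 0)) (Fin.tail z) (Fin.tail ν)

theorem nnSum_eq_sum_nnCoeff (p ζ : ℂ) :
    ∀ (N : ℕ) (β : ℕ → ℂ) (L : ℂ × ℂ × ℂ) (f : (Fin N → ℂ) → ℂ) (z : Fin N → ℂ),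
      nnSum p ζ N β L f z =
        ∑ ν : Fin N → SignType, nnCoeff p ζ N β L z ν * f fun i => shiftFactor p (ν i) * z i
  | 0, β, L, f, z => by
    simp only [nnSum, nnCoeff, univ_unique, sum_singleton]
    congr 2
    exact funext fun i => i.elim0
  | N + 1, β, L, f, z => by
    have hc : ∀ s ν, (Fin.consEquiv fun _ : Fin (N + 1) => SignType) (s, ν) = Fin.cons s ν :=
      fun _ _ => rfl
    rw [nnSum, ← (Fin.consEquiv fun _ => SignType).sum_comp, Fintype.sum_prod_type]
    refine sum_congr rfl fun s _ => ?_
    rw [nnSum_eq_sum_nnCoeff p ζ N, mul_sum]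
    refine sum_congr rfl fun ν _ => ?_
    simp only [hc, nnCoeff, Fin.cons_zero, Fin.tail_cons]
    rw [mul_assoc]
    congr 3
    funext i
    refine Fin.cases ?_ (fun j => ?_) i <;> simp [Fin.tail]

/-- Bonds that would lead out of the grid have weight zero. -/
theorem bond_ne_zero {p β β' z w : ℂ} (hp : p ≠ 0) (hp' : 1 + p ≠ 0) (hβ : β ≠ 0) (hβ' : β' ≠ 0)
    (hz : z ≠ 0) (hw : w ≠ 0) {r J : ℕ} (hr : r ≤ J) (hzw : z * β = β' * w * p ^ r)
    (hJ : β' ^ 2 * p ^ J = β ^ 2) {s t : SignType}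
    (h : siteEval p β' w (siteNext p β z s) t ≠ 0) :
    0 ≤ (r : ℤ) + (s : ℤ) - (t : ℤ) ∧ (r : ℤ) + (s : ℤ) - (t : ℤ) ≤ J := by
  -- Here `r` is the exponent gap between neighbouring grid coordinates, and it becomes `r + s - t`
  -- after the shifts. The ratios below are `p^{-r}` and `p^{r-J}`; the weight vanishes when one of
  -- them makes a factor `1 - x` or `1 - p x` zero, at the ends of `0, …, J`.
  have low : r = 0 → β' * w / (z * β) = 1 := fun h0 => by
    rw [div_eq_one_iff_eq (mul_ne_zero hz hβ), hzw, h0, pow_zero, mul_one]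
  have low' : r = 1 → p * (β' * w / (z * β)) = 1 := fun h0 => by
    rw [hzw, h0, pow_one]; field_simp
  have hu : β' * z / (w * β) = p ^ r / p ^ J := by
    have : β' * z / (w * β) = β' * (z * β) / (w * β ^ 2) := by field_simp
    rw [this, hzw, ← hJ]
    have := pow_ne_zero J hp
    field_simp
  have high : r = J → β' * z / (w * β) = 1 := fun h0 => by
    rw [hu, h0, div_self (pow_ne_zero _ hp)]
  have high' : r + 1 = J → p * (β' * z / (w * β)) = 1 := fun h0 => by
    rw [hu, ← h0, pow_succ]
    have := pow_ne_zero r hp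
    field_simp
  rcases s with _ | _ | _ <;> rcases t with _ | _ | _
  · change 0 ≤ (r : ℤ) + 0 - 0 ∧ (r : ℤ) + 0 - 0 ≤ J; omega
  · change 0 ≤ (r : ℤ) + 0 - -1 ∧ (r : ℤ) + 0 - -1 ≤ J
    have : r ≠ J := fun h0 => h <| by
      have : siteEval p β' w (siteNext p β z .zero) .neg =
          (1 - β' * z / (w * β)) * (1 - β' / (z * w * β)) := by
        simp only [siteEval, siteNext, quadEval]; field_simp; ring
      rw [this, high h0]; ring
    omega
  · change 0 ≤ (r : ℤ) + 0 - 1 ∧ (r : ℤ) + 0 - 1 ≤ J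
    have : r ≠ 0 := fun h0 => h <| by
      have : siteEval p β' w (siteNext p β z .zero) .pos =
          (1 - β' * w / (z * β)) * (1 - β' * w * z / β) := by
        simp only [siteEval, siteNext, quadEval]; field_simp; ring
      rw [this, low h0]; ring
    omega
  · change 0 ≤ (r : ℤ) + -1 - 0 ∧ (r : ℤ) + -1 - 0 ≤ J
    have : r ≠ 0 := fun h0 => h <| by
      have : siteEval p β' w (siteNext p β z .neg) .zero =
          (1 - β' * w / (z * β)) * (1 - β' / (z * w * β)) := by
        simp only [siteEval, siteNext]; field_simp; ring
      rw [this, low h0]; ring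
    omega
  · change 0 ≤ (r : ℤ) + -1 - -1 ∧ (r : ℤ) + -1 - -1 ≤ J; omega
  · change 0 ≤ (r : ℤ) + -1 - 1 ∧ (r : ℤ) + -1 - 1 ≤ J
    have e : siteEval p β' w (siteNext p β z .neg) .pos =
          (1 - β' * w / (z * β)) * (1 - p * (β' * w / (z * β))) := by
        simp only [siteEval, siteNext, quadEval]; field_simp; ring
    have h0 : r ≠ 0 := fun h0 => h <| by rw [e, low h0]; ring
    have h1 : r ≠ 1 := fun h0 => h <| by rw [e, low' h0]; ring
    omega
  · change 0 ≤ (r : ℤ) + 1 - 0 ∧ (r : ℤ) + 1 - 0 ≤ J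
    have : r ≠ J := fun h0 => h <| by
      have : siteEval p β' w (siteNext p β z .pos) .zero =
          (1 - β' * z / (w * β)) * (1 - β' * w * z / β) := by
        simp only [siteEval, siteNext]; field_simp; ring
      rw [this, high h0]; ring
    omega
  · change 0 ≤ (r : ℤ) + 1 - -1 ∧ (r : ℤ) + 1 - -1 ≤ J
    have e : siteEval p β' w (siteNext p β z .pos) .neg =
          (1 - β' * z / (w * β)) * (1 - p * (β' * z / (w * β))) := by
        simp only [siteEval, siteNext, quadEval]; field_simp; ring
    have h0 : r ≠ J := fun h0 => h <| by rw [e, high h0]; ring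
    have h1 : r + 1 ≠ J := fun h0 => h <| by rw [e, high' h0]; ring
    omega
  · change 0 ≤ (r : ℤ) + 1 - 1 ∧ (r : ℤ) + 1 - 1 ≤ J; omega

/-- The entry of `ν` at position `k`, extended by zero. -/
def signAt {N : ℕ} (ν : Fin N → SignType) (k : ℕ) : SignType :=
  if h : k < N then ν ⟨k, h⟩ else 0

/-- The coordinate at position `k`, extended by the boundary value `ζ`. -/
noncomputable def coordAt {N : ℕ} (ζ : ℂ) (z : Fin N → ℂ) (k : ℕ) : ℂ :=
  if h : k < N then z ⟨k, h⟩ else ζ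

theorem signAt_succ {N : ℕ} (ν : Fin (N + 1) → SignType) (k : ℕ) :
    signAt ν (k + 1) = signAt (Fin.tail ν) k := by
  simp only [signAt, Nat.add_lt_add_iff_right]
  rfl

theorem coordAt_succ {N : ℕ} (ζ : ℂ) (z : Fin (N + 1) → ℂ) (k : ℕ) :
    coordAt ζ z (k + 1) = coordAt ζ (Fin.tail z) k := by
  simp only [coordAt, Nat.add_lt_add_iff_right]
  rfl

/-- A nonzero coefficient has every bond weight nonzero, so `bond_ne_zero` applies at each bond; the
boundary enters as a site in state `0`, which is why `signAt` is padded with `0`. -/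
theorem nnCoeff_ne_zero {p ζ : ℂ} (hp : p ≠ 0) (hp' : 1 + p ≠ 0) (hζ : ζ ≠ 0) :
    ∀ (N : ℕ) (β : ℕ → ℂ) (L : ℂ × ℂ × ℂ) (z : Fin N → ℂ) (ν : Fin N → SignType) (r J : Fin N → ℕ),
      (∀ i, z i ≠ 0) → (∀ i ≤ N, β i ≠ 0) → (∀ i, r i ≤ J i) →
      (∀ i : Fin N, z i * β i = β (i + 1) * coordAt ζ z (i + 1) * p ^ r i) →
      (∀ i : Fin N, β (i + 1) ^ 2 * p ^ J i = β i ^ 2) →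
      nnCoeff p ζ N β L z ν ≠ 0 → ∀ i : Fin N,
        0 ≤ (r i : ℤ) + (ν i : ℤ) - (signAt ν (i + 1) : ℤ) ∧
          (r i : ℤ) + (ν i : ℤ) - (signAt ν (i + 1) : ℤ) ≤ J i
  | 0, _, _, _, _, _, _ => fun _ _ _ _ _ _ i => i.elim0
  | N + 1, β, L, z, ν, r, J => by
    intro hz hβ hr hzr hJ hne i
    rw [nnCoeff] at hne
    have hne' := right_ne_zero_of_mul hne
    refine Fin.cases ?_ (fun j => ?_) i
    · refine bond_ne_zero hp hp' (hβ 0 (by omega)) (hβ 1 (by omega)) (hz 0) ?_ (hr 0) (hzr 0) (hJ 0) ?_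
      · cases N with
        | zero => exact hζ
        | succ N => exact hz 1
      · cases N with
        | zero => exact hne'
        | succ N => exact fun h0 => hne' (by
            rw [nnCoeff]
            change siteEval p (β 1) (z 1) (siteNext p (β 0) (z 0) (ν 0)) (ν 1) / _ * _ = 0
            rw [show siteEval p (β 1) (z 1) (siteNext p (β 0) (z 0) (ν 0)) (ν 1) = 0 from h0,
              zero_div, zero_mul])
    · have := nnCoeff_ne_zero hp hp' hζ N (fun i => β (i + 1)) _ (Fin.tail z) (Fin.tail ν)
        (fun i => r i.succ) (fun i => J i.succ) (fun i => hz i.succ)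
        (fun i hi => hβ (i + 1) (by omega)) (fun i => hr i.succ)
        (fun i => by have := hzr i.succ; rw [Fin.val_succ, coordAt_succ] at this; exact this)
        (fun i => hJ i.succ) hne' j
      rw [Fin.val_succ, signAt_succ]
      exact this

/-! ### The grid -/

/-- `gridPoint` for an arbitrary dual multi-index. -/
noncomputable def gridPt {N : ℕ} (q : ℂ) (α : ℕ → ℂ) (m : Fin N → ℕ) : Fin N → ℂ :=
  fun i => α (N + 1) * α (N + 2) / α (i + 1) * q ^ (2 * partialSum m (N - i))

theorem partialSum_zero {N : ℕ} (m : Fin N → ℕ) : partialSum m 0 = 0 := by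
  simp [partialSum]

theorem partialSum_add_one {N : ℕ} (m : Fin N → ℕ) (j : ℕ) (h : j < N) :
    partialSum m (j + 1) = partialSum m j + m ⟨j, h⟩ := by
  have : m ⟨j, h⟩ = ∑ i : Fin N, if i = ⟨j, h⟩ then m i else 0 := by simp
  rw [this, partialSum, partialSum, ← sum_add_distrib]
  refine sum_congr rfl fun i _ => ?_
  simp only [Fin.ext_iff]
  split_ifs <;> omega

theorem partialSum_self {N : ℕ} (m : Fin N → ℕ) : partialSum m N = ∑ i, m i := by
  simp [partialSum]

theorem partialSum_sub {N : ℕ} (m : Fin N → ℕ) (i : Fin N) :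
    partialSum m (N - i) = partialSum m (N - (i + 1)) + m i.rev := by
  have h := partialSum_add_one m (N - (i + 1)) (by omega)
  rw [show N - ((i : ℕ) + 1) + 1 = N - i by omega] at h
  exact h

theorem coordAt_gridPt {N : ℕ} {q : ℂ} (α : ℕ → ℂ) (hα : ∀ k ≤ N + 2, α k ≠ 0) (m : Fin N → ℕ)
    (k : ℕ) (hk : k ≤ N) : coordAt (α (N + 2)) (gridPt q α m) k =
      α (N + 1) * α (N + 2) / α (k + 1) * (q ^ 2) ^ partialSum m (N - k) := by
  unfold coordAt
  split_ifs with h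
  · simp only [gridPt, pow_mul]
  · obtain rfl : k = N := by omega
    rw [Nat.sub_self, partialSum_zero, pow_zero, mul_one, mul_div_cancel_left₀ _ (hα _ (by omega))]

theorem gridPt_ne_zero {N : ℕ} {q : ℂ} (hq : q ≠ 0) (α : ℕ → ℂ) (hα : ∀ k ≤ N + 2, α k ≠ 0)
    (m : Fin N → ℕ) (i : Fin N) : gridPt q α m i ≠ 0 :=
  mul_ne_zero (div_ne_zero (mul_ne_zero (hα _ (by omega)) (hα _ le_rfl)) (hα _ (by omega)))
    (pow_ne_zero _ hq)

theorem exists_zpow_ratio {N : ℕ} {q : ℂ} (hq : q ≠ 0) (α : ℕ → ℂ) (hα : ∀ k ≤ N + 2, α k ≠ 0)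
    (J : Fin N → ℕ) (hαJ : ∀ k : Fin N, α (k + 2) / α (k + 1) = q ^ (-(J k : ℤ))) :
    ∀ j ≤ N, ∃ e : ℤ, α (N + 1) = α (N - j + 1) * q ^ e := by
  intro j
  induction j with
  | zero => exact fun _ => ⟨0, by simp⟩
  | succ j ih =>
    intro hj
    obtain ⟨e, he⟩ := ih (by omega)
    have h := hαJ ⟨N - (j + 1), by omega⟩
    simp only at h
    rw [show N - (j + 1) + 2 = N - j + 1 by omega, div_eq_iff (hα _ (by omega))] at h
    exact ⟨-(J ⟨N - (j + 1), by omega⟩ : ℤ) + e, by rw [he, h, zpow_add₀ hq]; ring⟩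

/-- All ratios `α_{N+1} / α_k` with `1 ≤ k ≤ N + 1` are integral powers of `q`, so every grid
coordinate is `α_{N+2}` times such a power. One condition on `α_{N+2}²` covers the whole grid. -/
theorem gridPt_generic {N : ℕ} {q : ℂ} (hq : q ≠ 0) (α : ℕ → ℂ) (hα : ∀ k ≤ N + 2, α k ≠ 0)
    (J : Fin N → ℕ) (hαJ : ∀ k : Fin N, α (k + 2) / α (k + 1) = q ^ (-(J k : ℤ)))
    (hgen : ∀ m : ℤ, α (N + 2) ^ 2 ≠ (q ^ 2) ^ m) (m : Fin N → ℕ) (i : Fin N) (k : ℤ) :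
    gridPt q α m i ^ 2 ≠ (q ^ 2) ^ k := by
  obtain ⟨e, he⟩ := exists_zpow_ratio hq α hα J hαJ (N - i) (by omega)
  rw [show N - (N - (i : ℕ)) = i by omega] at he
  have h := generic_mul_left hq hgen (e + 2 * partialSum m (N - i)) k
  have : gridPt q α m i = q ^ (e + 2 * (partialSum m (N - i) : ℤ)) * α (N + 2) := by
    have := hα (i + 1) (by omega)
    rw [gridPt, he, zpow_add₀ hq, ← zpow_natCast]
    push_cast
    field_simp
  rwa [this]

/-- The increments of the multi-index are differences of adjacent states and telescope, so shifting
coordinates by `ν` is the same as moving to the multi-index `m'`. -/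
theorem partialSum_toNat_shift {N : ℕ} (m m' : Fin N → ℕ) (ν : Fin N → SignType)
    (h : ∀ i : Fin N, (m' i.rev : ℤ) = m i.rev + (ν i : ℤ) - (signAt ν (i + 1) : ℤ)) :
    ∀ j ≤ N, (partialSum m' j : ℤ) = partialSum m j + (signAt ν (N - j) : ℤ) := by
  intro j
  induction j with
  | zero => simp [partialSum_zero, signAt]
  | succ j ih =>
    intro hj
    have h' := h (Fin.rev ⟨j, hj⟩)
    rw [Fin.rev_rev, Fin.val_rev] at h'
    simp only at h'
    rw [partialSum_add_one m j hj, partialSum_add_one m' j hj]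
    push_cast
    rw [ih (by omega), h', show N - (j + 1) + 1 = N - j by omega]
    have : signAt ν (N - (j + 1)) = ν (Fin.rev ⟨j, hj⟩) := by
      rw [signAt, dif_pos (by omega)]
      congr 1
    rw [this]
    ring

/-- On the grid, `opW1` acts by a matrix that changes the total degree by at most one. -/
theorem exists_gridMatrix {N : ℕ} {q : ℂ} (hq : q ≠ 0) (hq1 : ∀ m : ℕ, 0 < m → q ^ m ≠ 1)
    (α : ℕ → ℂ) (hα : ∀ k ≤ N + 2, α k ≠ 0) (J : Fin N → ℕ)
    (hαJ : ∀ k : Fin N, α (k + 2) / α (k + 1) = q ^ (-(J k.rev : ℤ)))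
    (hgen : ∀ m : ℤ, α (N + 2) ^ 2 ≠ (q ^ 2) ^ m) :
    ∃ K : Box J → Box J → ℂ,
      (∀ f m, opW1 q α f (gridPt q α m.toNat) = ∑ m', K m m' * f (gridPt q α m'.toNat)) ∧
      ∀ m m', K m m' ≠ 0 → m.deg ≤ m'.deg + 1 ∧ m'.deg ≤ m.deg + 1 := by
  have hp : q ^ 2 ≠ 0 := pow_ne_zero _ hq
  have nq := one_add_sq_ne_zero hq1
  set L := leftDatum (1 / α 0 ^ 2) 1 with hL
  set β : ℕ → ℂ := fun i => α (i + 1) with hβ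
  set C : Box J → (Fin N → SignType) → ℂ := fun m ν =>
    nnCoeff (q ^ 2) (α (N + 2)) N β L (gridPt q α m.toNat) ν with hC
  -- Each shift with nonzero coefficient has a target on the grid. When the coefficient is zero, `m`
  -- itself serves as a harmless default.
  have step : ∀ (m : Box J) (ν : Fin N → SignType), ∃ m' : Box J,
      (m.deg ≤ m'.deg + 1 ∧ m'.deg ≤ m.deg + 1) ∧ (C m ν ≠ 0 →
        (fun i => shiftFactor (q ^ 2) (ν i) * gridPt q α m.toNat i) = gridPt q α m'.toNat) := by
    intro m ν
    by_cases h0 : C m ν = 0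
    · exact ⟨m, ⟨by omega, by omega⟩, fun h => absurd h0 h⟩
    have hb := nnCoeff_ne_zero hp nq (hα _ le_rfl) N β L (gridPt q α m.toNat) ν
      (fun i => m.toNat i.rev) (fun i => J i.rev) (gridPt_ne_zero hq α hα _)
      (fun i hi => hα _ (by omega)) (fun i => Nat.lt_succ_iff.1 (m i.rev).2)
      (fun i => by
        rw [coordAt_gridPt α hα _ _ (by omega), hβ, gridPt, partialSum_sub, pow_mul, pow_add]
        have h1 := hα (i + 1) (by omega)
        have h2 := hα (i + 1 + 1) (by omega)
        field_simp)
      (fun i => by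
        have h1 := hα (i + 1) (by omega)
        have h := hαJ i
        rw [div_eq_iff h1] at h
        simp only [hβ]
        rw [h, zpow_neg, zpow_natCast]
        field_simp
        ring) h0
    have hb' : ∀ k : Fin N, 0 ≤ (m.toNat k : ℤ) + (ν k.rev : ℤ) - (signAt ν (k.rev + 1) : ℤ) ∧
        (m.toNat k : ℤ) + (ν k.rev : ℤ) - (signAt ν (k.rev + 1) : ℤ) ≤ J k := fun k => by
      have := hb k.rev
      rwa [Fin.rev_rev] at this
    set m' : Box J := fun k =>
      ⟨((m.toNat k : ℤ) + (ν k.rev : ℤ) - (signAt ν (k.rev + 1) : ℤ)).toNat, by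
        have := hb' k
        omega⟩ with hm'
    have hv : ∀ i : Fin N, (m'.toNat i.rev : ℤ) =
        m.toNat i.rev + (ν i : ℤ) - (signAt ν (i + 1) : ℤ) := fun i => by
      have := (hb' i.rev).1
      simp only [Fin.rev_rev] at this
      simp only [hm', Box.toNat, Fin.rev_rev] at this ⊢
      rw [Int.toNat_of_nonneg this]
    have hps := partialSum_toNat_shift m.toNat m'.toNat ν hv
    refine ⟨m', ?_, fun _ => funext fun i => ?_⟩
    -- The total degree is the exponent of the first coordinate, so it changes only by the state of
    -- the first site.
    · have h := hps N le_rfl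
      rw [partialSum_self, partialSum_self, Nat.sub_self] at h
      have hd : m.deg = ∑ i, m.toNat i := rfl
      have hd' : m'.deg = ∑ i, m'.toNat i := rfl
      rw [← hd, ← hd'] at h
      have hs : -1 ≤ (signAt ν 0 : ℤ) ∧ (signAt ν 0 : ℤ) ≤ 1 := by
        rcases signAt ν 0 with _ | _ | _ <;> decide
      omega
    · have h := hps (N - i) (by omega)
      rw [show N - (N - (i : ℕ)) = i by omega] at h
      have hsg : signAt ν i = ν i := by rw [signAt, dif_pos i.2]
      rw [hsg] at h
      have e : ∀ x : ℕ, q ^ (2 * x) = (q ^ 2) ^ (x : ℤ) := fun x => by rw [zpow_natCast, pow_mul]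
      simp only [gridPt, e, h]
      rw [zpow_add₀ hp, mul_left_comm, mul_comm (shiftFactor _ _)]
      congr 2
      rcases ν i with _ | _ | _
      · exact (zpow_zero _).symm
      · exact (zpow_neg_one _).symm
      · exact (zpow_one _).symm
  choose t ht1 ht2 using step
  set a := 1 / 2 * (α 0 * q / α (N + 1)) with ha
  set b := 1 + α (N + 1) ^ 2 / (q ^ 2 * α 0 ^ 2) -
          siteEval (q ^ 2) (α (N + 1)) (α (N + 2)) L 0 with hb
  refine ⟨fun m m' => a * ((∑ ν, if t m ν = m' then C m ν else 0) + if m = m' then b else 0), ?_, ?_⟩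
  · intro f m
    rw [opW1, LinearMap.smul_apply, Pi.smul_apply, smul_eq_mul, qDiffOp_apply hq hq1 α hα f _
      (gridPt_ne_zero hq α hα _) (gridPt_generic hq α hα (fun k => J k.rev) hαJ hgen _),
      nnSum_eq_sum_nnCoeff]
    simp only [mul_assoc, ← mul_sum, add_mul, sum_add_distrib, sum_mul, ite_mul, zero_mul]
    rw [sum_comm, sum_ite_eq, if_pos (mem_univ _), ha, ← hL, ← hb, mul_assoc]
    congr 3
    refine sum_congr rfl fun ν _ => ?_
    rw [sum_ite_eq, if_pos (mem_univ _)]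
    by_cases h0 : C m ν = 0
    · rw [h0, zero_mul]; exact mul_eq_zero_of_left h0 _
    · rw [← ht2 m ν h0]
  · intro m m' hne
    have hne' := right_ne_zero_of_mul hne
    by_cases hm : m = m'
    · subst hm; omega
    · rw [if_neg hm, add_zero] at hne'
      obtain ⟨ν, _, hν⟩ := exists_ne_zero_of_sum_ne_zero hne'
      have : t m ν = m' := by
        by_contra h
        exact hν (if_neg h)
      rw [← this]
      exact ht1 m ν

/-! ### Duality -/

/-- The terminating balanced series `₄φ₃(p⁻ⁿ, p⁻ᵐ, u, v; p⁻ᴶ, x, y; p, p)`. -/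
noncomputable def phi43 (p : ℂ) (J n m : ℕ) (u v x y : ℂ) : ℂ :=
  ∑ k ∈ range (J + 1), qPoch (p ^ (-(n : ℤ))) p k * qPoch (p ^ (-(m : ℤ))) p k * qPoch u p k *
    qPoch v p k / (qPoch p p k * qPoch (p ^ (-(J : ℤ))) p k * qPoch x p k * qPoch y p k) * p ^ k

/-- The summation range depends on `J` alone, which makes the exchange symmetry termwise. -/
theorem phi43_swap (p : ℂ) (J n m : ℕ) (u v x y : ℂ) :
    phi43 p J n m u v x y = phi43 p J m n v u x y :=
  sum_congr rfl fun k _ => by ring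

theorem qPoch_zpow_neg_eq_zero {p : ℂ} (hp : p ≠ 0) {n k : ℕ} (h : n < k) :
    qPoch (p ^ (-(n : ℤ))) p k = 0 :=
  prod_eq_zero (mem_range.2 h) (by
    rw [zpow_neg, zpow_natCast, inv_mul_cancel₀ (pow_ne_zero _ hp), sub_self])

theorem qPoch_zpow_neg_ne_zero {p : ℂ} (hp : p ≠ 0) (hp1 : ∀ m : ℕ, 0 < m → p ^ m ≠ 1) {n k : ℕ}
    (h : k ≤ n) : qPoch (p ^ (-(n : ℤ))) p k ≠ 0 :=
  prod_ne_zero_iff.2 fun i hi => by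
    have hi' := mem_range.1 hi
    obtain ⟨d, rfl⟩ : ∃ d, n = i + d := ⟨n - i, by omega⟩
    rw [zpow_neg, zpow_natCast, pow_add, mul_inv, mul_comm, mul_inv_cancel_left₀ (pow_ne_zero _ hp)]
    exact sub_ne_zero.2 fun h => hp1 d (by omega) (inv_eq_one.1 h.symm)

theorem qPoch_ne_zero {p x : ℂ} (hx : ∀ m : ℤ, x ≠ p ^ m) (k : ℕ) : qPoch x p k ≠ 0 :=
  prod_ne_zero_iff.2 fun i _ => sub_ne_zero.2 fun h => hx (-i) (by
    rw [zpow_neg, zpow_natCast]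
    exact eq_inv_of_mul_eq_one_left h.symm)

theorem mul_pow_ne_zpow {p x : ℂ} (hp : p ≠ 0) (hx : ∀ m : ℤ, x ≠ p ^ m) (j : ℕ) :
    ∀ m : ℤ, x * p ^ j ≠ p ^ m := fun m h => hx (m - j) (by
  rw [zpow_sub₀ hp, ← h, zpow_natCast, mul_div_cancel_right₀ _ (pow_ne_zero _ hp)])

/-- The values of the Askey-Wilson polynomials at `z = c pᵐ` with `cd = p⁻ᴶ`. -/
theorem askeyWilson_grid {q : ℂ} (hq : q ≠ 0) (hq1 : ∀ m : ℕ, 0 < m → q ^ m ≠ 1) {J n : ℕ}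
    (hn : n ≤ J) (m : ℕ) {z a b c d : ℂ} (ha : a ≠ 0) (hc : c ≠ 0) (hz : z = c * (q ^ 2) ^ m)
    (hgen : ∀ m : ℤ, z ^ 2 ≠ (q ^ 2) ^ m) (hcd : c * d = (q ^ 2) ^ (-(J : ℤ)))
    (hx : ∀ m : ℤ, c * a ≠ (q ^ 2) ^ m) (hy : ∀ m : ℤ, c * b ≠ (q ^ 2) ^ m) :
    askeyWilson (q ^ 2) n z a b c d = (c ^ n)⁻¹ * (qPoch (c * a) (q ^ 2) n *
      qPoch (c * b) (q ^ 2) n * qPoch ((q ^ 2) ^ (-(J : ℤ))) (q ^ 2) n) *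
      phi43 (q ^ 2) J n m (a * b * (q ^ 2) ^ ((n : ℤ) - 1 - J)) (c ^ 2 * (q ^ 2) ^ m) (c * a) (c * b) := by
  have hp : q ^ 2 ≠ 0 := pow_ne_zero _ hq
  have hp1 : ∀ m : ℕ, 0 < m → (q ^ 2) ^ m ≠ 1 := fun m hm => by
    rw [← pow_mul]; exact hq1 _ (by omega)
  have hz0 : z ≠ 0 := hz ▸ mul_ne_zero hc (pow_ne_zero _ hp)
  -- Expanding about `c` instead of `a` makes `c/z = p⁻ᵐ`, so the series terminates in `m` as well
  -- as in `n`.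
  rw [askeyWilson_swap_bc, askeyWilson_swap_ab hq hq1 n _ _ hz0 hgen ha hc]
  unfold askeyWilson phi43
  refine Eq.trans ?_ (mul_assoc _ _ _).symm
  congr 1
  -- The range is extended from `n` to `J`; the added terms contain `(p⁻ⁿ; p)_k = 0`.
  rw [mul_sum, ← sum_subset (range_subset_range.2 (Nat.succ_le_succ hn))]
  · refine sum_congr rfl fun k hk => ?_
    have hk' : k ≤ n := by simpa [Nat.lt_succ_iff] using hk
    have split : ∀ x, qPoch x (q ^ 2) n = qPoch x (q ^ 2) k *
        qPoch (x * (q ^ 2) ^ k) (q ^ 2) (n - k) := fun x => by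
      rw [← qPoch_add, Nat.add_sub_cancel' hk']
    have h1 : c * z = c ^ 2 * (q ^ 2) ^ m := by rw [hz]; ring
    have h2 : c * z⁻¹ = (q ^ 2) ^ (-(m : ℤ)) := by
      rw [hz, zpow_neg, zpow_natCast, mul_inv, mul_inv_cancel_left₀ hc]
    have h3 : c * a * b * d * (q ^ 2) ^ ((n : ℤ) - 1) = a * b * (q ^ 2) ^ ((n : ℤ) - 1 - J) := by
      rw [sub_eq_add_neg _ (J : ℤ), zpow_add₀ hp, ← hcd]; ring
    rw [h1, h2, h3, hcd, split (c * a), split (c * b), split ((q ^ 2) ^ (-(J : ℤ)))]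
    have n1 := qPoch_ne_zero hx k
    have n2 := qPoch_ne_zero hy k
    have n3 := qPoch_zpow_neg_ne_zero hp hp1 (hk'.trans hn)
    generalize qPoch (c * a) (q ^ 2) k = X₁ at *
    generalize qPoch (c * b) (q ^ 2) k = X₂ at *
    generalize qPoch ((q ^ 2) ^ (-(J : ℤ))) (q ^ 2) k = X₃ at *
    field_simp
  · intro k _ hk
    rw [qPoch_zpow_neg_eq_zero hp (n := n) (k := k) (by simpa [Nat.lt_succ_iff] using hk)]
    simp

/-- The symmetric function `(A, B; p)_{i+j} p^{-ij}`. -/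
noncomputable def pairWeight (p A B : ℂ) (i j : ℕ) : ℂ :=
  qPoch A p (i + j) * qPoch B p (i + j) * (p ^ (i * j))⁻¹

theorem pairWeight_comm (p A B : ℂ) (i j : ℕ) : pairWeight p A B i j = pairWeight p A B j i := by
  simp only [pairWeight, add_comm i j, mul_comm i j]

/-- The values of the normalized polynomials on the grid. -/
theorem gasperRahmanHat_gridPt {N : ℕ} {q : ℂ} (hq : q ≠ 0) (hq1 : ∀ m : ℕ, 0 < m → q ^ m ≠ 1)
    (α : ℕ → ℂ) (hα : ∀ k ≤ N + 2, α k ≠ 0) (J : Fin N → ℕ)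
    (hαJ : ∀ k : Fin N, α (k + 2) / α (k + 1) = q ^ (-(J k : ℤ)))
    (hgen₂ : ∀ m : ℤ, α (N + 2) ^ 2 ≠ (q ^ 2) ^ m)
    (hgen₃ : ∀ m : ℤ, α (N + 1) * α (N + 2) ≠ (q ^ 2) ^ m)
    (hgen₄ : ∀ m : ℤ, α (N + 1) * α (N + 2) / α 0 ^ 2 ≠ (q ^ 2) ^ m)
    (n m : Fin N → ℕ) (hn : ∀ k, n k ≤ J k) :
    gasperRahmanHat q α n (gridPt q α m) =
      (∏ i : Fin N, pairWeight (q ^ 2) (α (N + 1) * α (N + 2)) (α (N + 1) * α (N + 2) / α 0 ^ 2)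
            (partialSum n (i + 1)) (partialSum m (N - (i + 1))) /
          pairWeight (q ^ 2) (α (N + 1) * α (N + 2)) (α (N + 1) * α (N + 2) / α 0 ^ 2)
            (partialSum n i) (partialSum m (N - (i + 1)))) *
      (∏ i : Fin N, phi43 (q ^ 2) (J i) (n i) (m i.rev)
        ((α (i + 1) / α 0) ^ 2 * (q ^ 2) ^ (2 * (partialSum n i : ℤ) + n i - 1 - J i))
        ((α (N + 1) * α (N + 2) / α (i + 1)) ^ 2 *
          (q ^ 2) ^ (2 * (partialSum m (N - (i + 1)) : ℤ) + m i.rev))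
        (α (N + 1) * α (N + 2) * (q ^ 2) ^ (partialSum n i + partialSum m (N - (i + 1))))
        (α (N + 1) * α (N + 2) / α 0 ^ 2 *
          (q ^ 2) ^ (partialSum n i + partialSum m (N - (i + 1))))) /
      (qPoch (α (N + 1) * α (N + 2)) (q ^ 2) (∑ i, n i) *
        qPoch (α (N + 1) * α (N + 2) / α 0 ^ 2) (q ^ 2) (∑ i, n i)) := by
  have hp : q ^ 2 ≠ 0 := pow_ne_zero _ hq
  have hp1 : ∀ m : ℕ, 0 < m → (q ^ 2) ^ m ≠ 1 := fun m hm => by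
    rw [← pow_mul]; exact hq1 _ (by omega)
  have hA : α (N + 1) * α (N + 2) ≠ 0 := mul_ne_zero (hα _ (by omega)) (hα _ le_rfl)
  set A := α (N + 1) * α (N + 2) with hAdef
  rw [gasperRahmanHat, gasperRahman, ← hAdef, ← prod_mul_distrib]
  have hpow : A ^ (∑ i, n i) = ∏ i, A ^ n i := (prod_pow_eq_pow_sum _ _ _).symm
  rw [hpow, div_mul_eq_mul_div, div_mul_eq_mul_div]
  congr 1
  rw [one_div, ← prod_inv_distrib, ← prod_mul_distrib, ← prod_mul_distrib]
  refine prod_congr rfl fun i _ => ?_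
  have hi := hα (i + 1) (by omega)
  have hi' := hα (i + 2) (by omega)
  set s := partialSum n i with hs
  set t := partialSum m (N - (i + 1)) with ht
  have hzc : zCoord α (gridPt q α m) (i + 2) = A / α (i + 2) * (q ^ 2) ^ t := by
    have := coordAt_gridPt (q := q) α hα m (i + 1) (by omega)
    rw [← hAdef, ← ht] at this
    exact this
  have hJ : α (i + 2) ^ 2 / α (i + 1) ^ 2 = (q ^ 2) ^ (-(J i : ℤ)) := by
    rw [← div_pow, hαJ i, ← zpow_natCast, ← zpow_natCast, ← zpow_mul, ← zpow_mul, mul_comm]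
  have hc : α (i + 2) / α (i + 1) * zCoord α (gridPt q α m) (i + 2) =
      A / α (i + 1) * (q ^ 2) ^ t := by
    rw [hzc]; field_simp
  have hc0 : A / α (i + 1) * (q ^ 2) ^ t ≠ 0 := mul_ne_zero (div_ne_zero hA hi) (pow_ne_zero _ hp)
  have ea : A / α (i + 1) * (q ^ 2) ^ t * (α (i + 1) * q ^ (2 * s)) = A * (q ^ 2) ^ (s + t) := by
    rw [pow_mul, pow_add]; field_simp
  have eb : A / α (i + 1) * (q ^ 2) ^ t * (α (i + 1) / α 0 ^ 2 * q ^ (2 * s)) =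
      A / α 0 ^ 2 * (q ^ 2) ^ (s + t) := by
    rw [pow_mul, pow_add]; field_simp
  have eu : α (i + 1) * q ^ (2 * s) * (α (i + 1) / α 0 ^ 2 * q ^ (2 * s)) *
      (q ^ 2) ^ ((n i : ℤ) - 1 - J i) =
      (α (i + 1) / α 0) ^ 2 * (q ^ 2) ^ (2 * (s : ℤ) + n i - 1 - J i) := by
    rw [show 2 * (s : ℤ) + n i - 1 - J i = (s : ℤ) + s + ((n i : ℤ) - 1 - J i) by ring,
      zpow_add₀ hp, zpow_add₀ hp, zpow_natCast, pow_mul]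
    field_simp
  have ev : (A / α (i + 1) * (q ^ 2) ^ t) ^ 2 * (q ^ 2) ^ m i.rev =
      (A / α (i + 1)) ^ 2 * (q ^ 2) ^ (2 * (t : ℤ) + m i.rev) := by
    rw [show 2 * (t : ℤ) + m i.rev = (t : ℤ) + t + m i.rev by ring,
      zpow_add₀ hp, zpow_add₀ hp, zpow_natCast, zpow_natCast]
    ring
  have key := askeyWilson_grid hq hq1 (hn i) (m i.rev) (z := gridPt q α m i)
    (a := α (i + 1) * q ^ (2 * s)) (b := α (i + 1) / α 0 ^ 2 * q ^ (2 * s))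
    (c := A / α (i + 1) * (q ^ 2) ^ t)
    (d := α (i + 2) / α (i + 1) * (zCoord α (gridPt q α m) (i + 2))⁻¹)
    (mul_ne_zero hi (pow_ne_zero _ hq)) hc0
    (by rw [gridPt, ← hAdef, partialSum_sub, pow_mul, pow_add, mul_assoc])
    (gridPt_generic hq α hα J hαJ hgen₂ m i)
    (by
      rw [hzc, ← hJ]
      have := pow_ne_zero t hp
      field_simp)
    (by rw [ea]; exact mul_pow_ne_zpow hp hgen₃ _)
    (by rw [eb]; exact mul_pow_ne_zpow hp hgen₄ _)
  rw [ea, eb, eu, ev] at key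
  rw [hc, key, hJ, partialSum_add_one n i i.2, ← hs, Fin.eta]
  have hJn := qPoch_zpow_neg_ne_zero hp hp1 (hn i)
  have n1 := qPoch_ne_zero hgen₃ (s + t)
  have n2 := qPoch_ne_zero hgen₄ (s + t)
  have s1 := qPoch_add A (q ^ 2) (s + t) (n i)
  have s2 := qPoch_add (A / α 0 ^ 2) (q ^ 2) (s + t) (n i)
  simp only [pairWeight]
  clear_value A
  -- The power `p^{t n_i}` left over from `c^{n_i}` is the quotient of the factors `p^{ij}` in two
  -- consecutive values of `pairWeight`.
  have hcp : (A / α (i + 1) * (q ^ 2) ^ t) ^ n i = A ^ n i / α (i + 1) ^ n i * (q ^ 2) ^ (t * n i) := by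
    rw [mul_pow, div_pow, ← pow_mul]
  have hst : (q ^ 2) ^ ((s + n i) * t) = (q ^ 2) ^ (s * t) * (q ^ 2) ^ (t * n i) := by
    rw [← pow_add]; ring
  rw [show s + n i + t = s + t + n i by ring, s1, s2, hcp, hst]
  have n3 := pow_ne_zero (s * t) hp
  generalize (q ^ 2) ^ (s * t) = r1 at *
  generalize (q ^ 2) ^ (t * n i) = r2 at *
  generalize phi43 _ _ _ _ _ _ _ _ = F
  field_simp

/-- The parameters of the dual polynomials. -/
noncomputable def dualParam (N : ℕ) (q : ℂ) (α : ℕ → ℂ) (k : ℕ) : ℂ :=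
  if k = 0 then α 0 else if k = N + 2 then α 1 / (α 0 * q)
  else q * α 0 * (α (N + 1) * α (N + 2)) / α (N + 2 - k)

theorem dualParam_zero (N : ℕ) (q : ℂ) (α : ℕ → ℂ) : dualParam N q α 0 = α 0 := rfl

theorem dualParam_last (N : ℕ) (q : ℂ) (α : ℕ → ℂ) :
    dualParam N q α (N + 2) = α 1 / (α 0 * q) := by
  rw [dualParam, if_neg (by omega), if_pos rfl]

theorem dualParam_succ (N : ℕ) (q : ℂ) (α : ℕ → ℂ) (k : ℕ) (hk : k ≤ N) :
    dualParam N q α (k + 1) = q * α 0 * (α (N + 1) * α (N + 2)) / α (N + 1 - k) := by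
  rw [dualParam, if_neg (by omega), if_neg (by omega), show N + 2 - (k + 1) = N + 1 - k by omega]

/-- With `α_0` also kept fixed, `pairWeight` and the last two genericity conditions are self-dual.
-/
theorem dualParam_mul {N : ℕ} {q : ℂ} (hq : q ≠ 0) (α : ℕ → ℂ) (hα : ∀ k ≤ N + 2, α k ≠ 0) :
    dualParam N q α (N + 1) * dualParam N q α (N + 2) = α (N + 1) * α (N + 2) := by
  have h0 := hα 0 (by omega)
  have h1 := hα 1 (by omega)
  rw [dualParam_last, dualParam_succ N q α N le_rfl, show N + 1 - N = 1 by omega]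
  field_simp

theorem dualParam_ne_zero {N : ℕ} {q : ℂ} (hq : q ≠ 0) (α : ℕ → ℂ) (hα : ∀ k ≤ N + 2, α k ≠ 0) :
    ∀ k ≤ N + 2, dualParam N q α k ≠ 0 := by
  intro k hk
  have h0 := hα 0 (by omega)
  unfold dualParam
  split_ifs
  · exact h0
  · exact div_ne_zero (hα 1 (by omega)) (mul_ne_zero h0 hq)
  · exact div_ne_zero (mul_ne_zero (mul_ne_zero hq h0) (mul_ne_zero (hα _ (by omega)) (hα _ le_rfl)))
      (hα _ (by omega))

theorem dualParam_ratio {N : ℕ} {q : ℂ} (hq : q ≠ 0) (α : ℕ → ℂ) (hα : ∀ k ≤ N + 2, α k ≠ 0)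
    (J : Fin N → ℕ) (hαJ : ∀ k : Fin N, α (k + 2) / α (k + 1) = q ^ (-(J k : ℤ))) (k : Fin N) :
    dualParam N q α (k + 2) / dualParam N q α (k + 1) = q ^ (-(J k.rev : ℤ)) := by
  rw [dualParam_succ N q α (k + 1) (by omega), dualParam_succ N q α k (by omega), ← hαJ,
    Fin.val_rev, show N - ((k : ℕ) + 1) + 2 = N + 1 - k by omega,
    show N - ((k : ℕ) + 1) + 1 = N + 1 - (k + 1) by omega]
  have h0 := hα 0 (by omega)
  have h1 := hα (N + 1) (by omega)
  have h2 := hα (N + 2) le_rfl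
  field_simp

/-- Dually, the condition on `α_{N+2}²` becomes the one on `α_1² / α_0²`, up to a factor `q²`. -/
theorem dualParam_generic {N : ℕ} {q : ℂ} (hq : q ≠ 0) (α : ℕ → ℂ)
    (hgen₁ : ∀ m : ℤ, α 1 ^ 2 / α 0 ^ 2 ≠ (q ^ 2) ^ m) (m : ℤ) :
    dualParam N q α (N + 2) ^ 2 ≠ (q ^ 2) ^ m := by
  have hp : q ^ 2 ≠ 0 := pow_ne_zero _ hq
  intro h
  refine hgen₁ (m + 1) ?_
  rw [zpow_add_one₀ hp, ← h, dualParam_last, div_pow, mul_pow]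
  field_simp

/-- The duality of the normalized Gasper-Rahman polynomials on the grid. -/
theorem gasperRahmanHat_dual {N : ℕ} {q : ℂ} (hq : q ≠ 0) (hq1 : ∀ m : ℕ, 0 < m → q ^ m ≠ 1)
    (α : ℕ → ℂ) (hα : ∀ k ≤ N + 2, α k ≠ 0) (J : Fin N → ℕ)
    (hαJ : ∀ k : Fin N, α (k + 2) / α (k + 1) = q ^ (-(J k : ℤ)))
    (hgen₁ : ∀ m : ℤ, α 1 ^ 2 / α 0 ^ 2 ≠ (q ^ 2) ^ m)
    (hgen₂ : ∀ m : ℤ, α (N + 2) ^ 2 ≠ (q ^ 2) ^ m)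
    (hgen₃ : ∀ m : ℤ, α (N + 1) * α (N + 2) ≠ (q ^ 2) ^ m)
    (hgen₄ : ∀ m : ℤ, α (N + 1) * α (N + 2) / α 0 ^ 2 ≠ (q ^ 2) ^ m)
    (n m : Fin N → ℕ) (hn : ∀ k, n k ≤ J k) (hm : ∀ k, m k ≤ J k.rev) :
    gasperRahmanHat q α n (gridPt q α m) =
      gasperRahmanHat q (dualParam N q α) m (gridPt q (dualParam N q α) n) := by
  have hp : q ^ 2 ≠ 0 := pow_ne_zero _ hq
  have hmul := dualParam_mul hq α hα
  have h0 := hα 0 (by omega)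
  rw [gasperRahmanHat_gridPt hq hq1 α hα J hαJ hgen₂ hgen₃ hgen₄ n m hn,
    gasperRahmanHat_gridPt hq hq1 (dualParam N q α) (dualParam_ne_zero hq α hα) (fun k => J k.rev)
      (dualParam_ratio hq α hα J hαJ) (dualParam_generic hq α hgen₁) (by rwa [hmul])
      (by rwa [hmul, dualParam_zero]) m n hm]
  rw [hmul, dualParam_zero]
  set A := α (N + 1) * α (N + 2) with hA
  have hA0 : A ≠ 0 := mul_ne_zero (hα _ (by omega)) (hα _ le_rfl)
  set e := pairWeight (q ^ 2) A (A / α 0 ^ 2) with he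
  have hrev : ∀ i : Fin N, N - ((i.rev : ℕ) + 1) = i := fun i => by rw [Fin.val_rev]; omega
  -- Factor `i` matches the dual factor at the reversed position. The upper parameters exchange
  -- roles because `(α̃_{i+1}/α_0)² p^{-1-J} = (A/α_{k+1})²`, with `k` the reversed position and `J
  -- = J_k`.
  have hphi : ∀ i : Fin N, phi43 (q ^ 2) (J i.rev) (n i.rev) (m i.rev.rev)
        ((α (i.rev + 1) / α 0) ^ 2 * (q ^ 2) ^ (2 * (partialSum n i.rev : ℤ) + n i.rev - 1 - J i.rev))
        ((A / α (i.rev + 1)) ^ 2 * (q ^ 2) ^ (2 * (partialSum m (N - (i.rev + 1)) : ℤ) + m i.rev.rev))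
        (A * (q ^ 2) ^ (partialSum n i.rev + partialSum m (N - (i.rev + 1))))
        (A / α 0 ^ 2 * (q ^ 2) ^ (partialSum n i.rev + partialSum m (N - (i.rev + 1)))) =
      phi43 (q ^ 2) (J i.rev) (m i) (n i.rev)
        ((dualParam N q α (i + 1) / α 0) ^ 2 *
          (q ^ 2) ^ (2 * (partialSum m i : ℤ) + m i - 1 - J i.rev))
        ((A / dualParam N q α (i + 1)) ^ 2 *
          (q ^ 2) ^ (2 * (partialSum n (N - (i + 1)) : ℤ) + n i.rev))
        (A * (q ^ 2) ^ (partialSum m i + partialSum n (N - (i + 1))))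
        (A / α 0 ^ 2 * (q ^ 2) ^ (partialSum m i + partialSum n (N - (i + 1)))) := by
    intro i
    have hJ := hαJ i.rev
    rw [show (i.rev : ℕ) + 2 = N + 1 - i by rw [Fin.val_rev]; omega,
      div_eq_iff (hα _ (by omega)), zpow_neg, zpow_natCast] at hJ
    have hd := dualParam_succ N q α i (by omega)
    rw [hJ, ← hA] at hd
    rw [phi43_swap, hrev, Fin.rev_rev, show N - ((i : ℕ) + 1) = i.rev by rw [Fin.val_rev],
      add_comm (partialSum n i.rev)]
    have hexp : ∀ x : ℤ, (q ^ 2) ^ (x - 1 - J i.rev) = (q ^ 2) ^ x * (q ^ 2 * (q ^ J i.rev) ^ 2)⁻¹ := by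
      intro x
      rw [show x - 1 - J i.rev = x + -((J i.rev + 1 : ℕ) : ℤ) by push_cast; ring, zpow_add₀ hp, zpow_neg,
        zpow_natCast, show (q ^ 2) ^ (J i.rev + 1) = q ^ 2 * (q ^ J i.rev) ^ 2 by ring]
    rw [hexp, hexp, hd]
    congr 1 <;> field_simp
  set F := ∏ i : Fin N, phi43 (q ^ 2) (J i.rev) (m i) (n i.rev)
        ((dualParam N q α (i + 1) / α 0) ^ 2 *
          (q ^ 2) ^ (2 * (partialSum m i : ℤ) + m i - 1 - J i.rev))
        ((A / dualParam N q α (i + 1)) ^ 2 *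
          (q ^ 2) ^ (2 * (partialSum n (N - (i + 1)) : ℤ) + n i.rev))
        (A * (q ^ 2) ^ (partialSum m i + partialSum n (N - (i + 1))))
        (A / α 0 ^ 2 * (q ^ 2) ^ (partialSum m i + partialSum n (N - (i + 1)))) with hF
  have hF' : ∏ i : Fin N, phi43 (q ^ 2) (J i) (n i) (m i.rev)
        ((α (i + 1) / α 0) ^ 2 * (q ^ 2) ^ (2 * (partialSum n i : ℤ) + n i - 1 - J i))
        ((A / α (i + 1)) ^ 2 * (q ^ 2) ^ (2 * (partialSum m (N - (i + 1)) : ℤ) + m i.rev))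
        (A * (q ^ 2) ^ (partialSum n i + partialSum m (N - (i + 1))))
        (A / α 0 ^ 2 * (q ^ 2) ^ (partialSum n i + partialSum m (N - (i + 1)))) = F :=
    (Equiv.prod_comp Fin.revPerm _).symm.trans (prod_congr rfl fun i _ => hphi i)
  rw [hF']
  -- the prefactors
  set g : ℕ → ℂ := fun i => e (partialSum n i) (partialSum m (N - i)) with hg
  have hgN : g N = qPoch A (q ^ 2) (∑ i, n i) * qPoch (A / α 0 ^ 2) (q ^ 2) (∑ i, n i) := by
    simp only [hg, he, pairWeight, Nat.sub_self, partialSum_zero, partialSum_self]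
    simp
  have hg0 : g 0 = qPoch A (q ^ 2) (∑ i, m i) * qPoch (A / α 0 ^ 2) (q ^ 2) (∑ i, m i) := by
    simp only [hg, he, pairWeight, Nat.sub_zero, partialSum_zero, partialSum_self]
    simp
  -- The values of `g` at the two ends are the normalizing factors of the two polynomials, so
  -- telescoping converts one normalization into the other.
  have htel : (∏ i : Fin N, g (i + 1)) * g 0 = (∏ i : Fin N, g i) * g N := by
    rw [Fin.prod_univ_eq_prod_range (fun i => g (i + 1)) N, Fin.prod_univ_eq_prod_range g N,
      ← prod_range_succ', ← prod_range_succ]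
  have hdual : ∏ i : Fin N, e (partialSum m (i + 1)) (partialSum n (N - (i + 1))) /
        e (partialSum m i) (partialSum n (N - (i + 1))) =
      ∏ i : Fin N, g i / e (partialSum n i) (partialSum m (N - (i + 1))) := by
    refine Eq.trans (prod_congr rfl fun i _ => ?_) (Equiv.prod_comp Fin.revPerm _)
    rw [Fin.revPerm_apply]
    rw [hrev, he, pairWeight_comm _ _ _ (partialSum m (i + 1)), pairWeight_comm _ _ _ (partialSum m i)]
    simp only [hg, ← he]
    rw [show N - ((i : ℕ) + 1) = i.rev by rw [Fin.val_rev],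
      show (i : ℕ) + 1 = N - i.rev by rw [Fin.val_rev]; omega]
  rw [hdual, prod_div_distrib, prod_div_distrib, ← hgN, ← hg0]
  have hge : ∀ i, g i ≠ 0 := fun i => mul_ne_zero (mul_ne_zero (qPoch_ne_zero hgen₃ _)
    (qPoch_ne_zero hgen₄ _)) (inv_ne_zero (pow_ne_zero _ hp))
  have hD : (∏ i : Fin N, e (partialSum n i) (partialSum m (N - (i + 1)))) ≠ 0 :=
    prod_ne_zero_iff.2 fun i _ => mul_ne_zero (mul_ne_zero (qPoch_ne_zero hgen₃ _)
      (qPoch_ne_zero hgen₄ _)) (inv_ne_zero (pow_ne_zero _ hp))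
  have a1 := hge 0
  have a2 := hge N
  change (∏ i : Fin N, g (i + 1)) / _ * F / g N = _
  field_simp
  linear_combination F * htel

/-! ### Operators on spans -/

section Spans

variable {E ι : Type*} [AddCommGroup E] [Module ℂ E]

theorem mapsTo_span (v : ι → E) (S : Set ι) (A : Module.End ℂ E)
    (h : ∀ i ∈ S, A (v i) ∈ Submodule.span ℂ (v '' S)) :
    ∀ w ∈ Submodule.span ℂ (v '' S), A w ∈ Submodule.span ℂ (v '' S) := by
  have : Submodule.span ℂ (v '' S) ≤ (Submodule.span ℂ (v '' S)).comap A :=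
    Submodule.span_le.2 (by rintro _ ⟨i, hi, rfl⟩; exact h i hi)
  exact this

/-- An operator on a span is determined on spanning vectors, and a stable ambient operator supplies
one. No linear independence of the `v i` is needed for well-definedness. -/
theorem eq_restrict_iff (v : ι → E) (A : Module.End ℂ E)
    (hA : ∀ w ∈ Submodule.span ℂ (v '' Set.univ), A w ∈ Submodule.span ℂ (v '' Set.univ))
    (T : Module.End ℂ (Submodule.span ℂ (v '' Set.univ))) :
    (∀ (i : ι) (w : Submodule.span ℂ (v '' Set.univ)), (w : E) = v i → (T w : E) = A (v i)) ↔
      T = A.restrict hA := by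
  constructor
  · intro h
    have : ∀ w (hw : w ∈ Submodule.span ℂ (v '' Set.univ)), (T ⟨w, hw⟩ : E) = A w := by
      intro w hw
      induction hw using Submodule.span_induction with
      | mem w hw =>
        obtain ⟨i, _, rfl⟩ := hw
        exact h i _ rfl
      | zero => rw [map_zero]; exact congrArg Subtype.val (map_zero T)
      | add x y hx hy ihx ihy =>
        rw [map_add, ← ihx, ← ihy]
        exact congrArg Subtype.val (map_add T ⟨x, hx⟩ ⟨y, hy⟩)
      | smul c x hx ihx =>
        rw [map_smul, ← ihx]
        exact congrArg Subtype.val (map_smul T c ⟨x, hx⟩)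
    exact LinearMap.ext fun w => Subtype.ext (this w w.2)
  · rintro rfl i w hw
    exact congrArg A hw

theorem dolanGradyFirst_apply (q ω₀ ω₁ gp gm : ℂ) (X Y : Module.End ℂ E) (w : E) :
    dolanGradyFirst q ω₀ ω₁ gp gm X Y w = ω₀ • X w + ω₁ • Y w +
      gp • (q • Y (X w) - q⁻¹ • X (Y w)) + gm • (q • X (Y w) - q⁻¹ • Y (X w)) := rfl

theorem restrict_dolanGradyFirst (q ω₀ ω₁ gp gm : ℂ) (X Y : Module.End ℂ E) (V : Submodule ℂ E)
    (hX : ∀ w ∈ V, X w ∈ V) (hY : ∀ w ∈ V, Y w ∈ V)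
    (hI : ∀ w ∈ V, dolanGradyFirst q ω₀ ω₁ gp gm X Y w ∈ V) :
    (dolanGradyFirst q ω₀ ω₁ gp gm X Y).restrict hI =
      dolanGradyFirst q ω₀ ω₁ gp gm (X.restrict hX) (Y.restrict hY) :=
  LinearMap.ext fun _ => rfl

theorem dolanGradyFirst_mem (q ω₀ ω₁ gp gm : ℂ) (X Y : Module.End ℂ E) (V : Submodule ℂ E)
    (hX : ∀ w ∈ V, X w ∈ V) (hY : ∀ w ∈ V, Y w ∈ V) (w : E) (hw : w ∈ V) :
    dolanGradyFirst q ω₀ ω₁ gp gm X Y w ∈ V := by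
  rw [dolanGradyFirst_apply]
  have h1 := hX w hw
  have h2 := hY w hw
  exact V.add_mem (V.add_mem (V.add_mem (V.smul_mem _ h1) (V.smul_mem _ h2))
    (V.smul_mem _ (V.sub_mem (V.smul_mem _ (hY _ h1)) (V.smul_mem _ (hX _ h2)))))
    (V.smul_mem _ (V.sub_mem (V.smul_mem _ (hX _ h2)) (V.smul_mem _ (hY _ h1))))

variable [Fintype ι]

/-- With `A` diagonal, each `q`-commutator rescales the matrix entry `K i j` by a scalar in the two
eigenvalues. Only entries leading out of `S` must be killed. -/
theorem dolanGradyFirst_invariant (q ωB ωA g₁ g₂ : ℂ) (A B : Module.End ℂ E) (v : ι → E)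
    (θ : ι → ℂ) (K : ι → ι → ℂ) (hA : ∀ i, A (v i) = θ i • v i)
    (hB : ∀ i, B (v i) = ∑ j, K i j • v j) (S : Set ι)
    (hS : ∀ i ∈ S, ∀ j ∉ S, K i j ≠ 0 →
      ωB + g₁ * (q * θ j - q⁻¹ * θ i) + g₂ * (q * θ i - q⁻¹ * θ j) = 0) :
    ∀ w ∈ Submodule.span ℂ (v '' S),
      dolanGradyFirst q ωB ωA g₁ g₂ B A w ∈ Submodule.span ℂ (v '' S) := by
  refine mapsTo_span v S _ fun i hi => ?_
  have h : dolanGradyFirst q ωB ωA g₁ g₂ B A (v i) = (ωA * θ i) • v i +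
      ∑ j, (K i j * (ωB + g₁ * (q * θ j - q⁻¹ * θ i) + g₂ * (q * θ i - q⁻¹ * θ j))) • v j := by
    have hAB : A (B (v i)) = ∑ j, (K i j * θ j) • v j := by
      rw [hB, map_sum]
      exact sum_congr rfl fun j _ => by rw [map_smul, hA, smul_smul]
    rw [dolanGradyFirst_apply, hAB, hA, map_smul, hB]
    simp only [smul_sum, smul_smul, ← sum_sub_distrib, ← sub_smul]
    rw [add_comm (∑ j, _) ((ωA * θ i) • v i), add_assoc, add_assoc]
    congr 1
    rw [← sum_add_distrib, ← sum_add_distrib]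
    refine sum_congr rfl fun j _ => ?_
    rw [← add_smul, ← add_smul]
    congr 1
    ring
  rw [h]
  refine Submodule.add_mem _ (Submodule.smul_mem _ _ (Submodule.subset_span ⟨i, hi, rfl⟩))
    (Submodule.sum_mem _ fun j _ => ?_)
  by_cases hj : j ∈ S
  · exact Submodule.smul_mem _ _ (Submodule.subset_span ⟨j, hj, rfl⟩)
  · by_cases hK : K i j = 0
    · rw [hK, zero_mul, zero_smul]; exact Submodule.zero_mem _
    · rw [hS i hi j hj hK, mul_zero, zero_smul]; exact Submodule.zero_mem _

/-- The `q`-weights are tuned so that the decaying exponential `γ⁻¹ q^{-2k}` cancels; in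
`w1Eigenvalue_down` the other one does. -/
theorem w1Eigenvalue_up {q γ : ℂ} (hq : q ≠ 0) (hγ : γ ≠ 0) (k : ℕ) :
    q * w1Eigenvalue q γ (k + 1) - q⁻¹ * w1Eigenvalue q γ k =
      (q ^ 2 - (q ^ 2)⁻¹) / 2 * (γ * q ^ (2 * (k : ℤ) + 1)) := by
  have h : q ^ (2 * (k : ℤ) + 1) = (q ^ k) ^ 2 * q := by
    rw [zpow_add_one₀ hq, ← pow_mul, mul_comm k, ← zpow_natCast]; push_cast; rfl
  rw [h, w1Eigenvalue, w1Eigenvalue, show (q ^ 2) ^ (k + 1) = (q ^ k) ^ 2 * q ^ 2 by ring,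
    show (q ^ 2) ^ k = (q ^ k) ^ 2 by ring]
  have := pow_ne_zero k hq
  generalize q ^ k = r at *
  field_simp
  ring

theorem w1Eigenvalue_down {q γ : ℂ} (hq : q ≠ 0) (hγ : γ ≠ 0) (k : ℕ) :
    q * w1Eigenvalue q γ k - q⁻¹ * w1Eigenvalue q γ (k + 1) =
      (q ^ 2 - (q ^ 2)⁻¹) / 2 * (γ⁻¹ * q ^ (-2 * (k : ℤ) - 1)) := by
  have h : q ^ (-2 * (k : ℤ) - 1) = ((q ^ k) ^ 2 * q)⁻¹ := by
    rw [show -2 * (k : ℤ) - 1 = -((2 * k + 1 : ℕ) : ℤ) by push_cast; ring, zpow_neg, zpow_natCast,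
      pow_succ, ← pow_mul, mul_comm k]
  rw [h, w1Eigenvalue, w1Eigenvalue, show (q ^ 2) ^ (k + 1) = (q ^ k) ^ 2 * q ^ 2 by ring,
    show (q ^ 2) ^ k = (q ^ k) ^ 2 by ring]
  have := pow_ne_zero k hq
  generalize q ^ k = r at *
  field_simp
  ring

/-- The invariant subspaces of `I₁`, for operators `A` (diagonal) and `B` (tridiagonal). -/
theorem dolanGradyFirst_invariant_deg {q γ : ℂ} (hq : q ≠ 0) (hγ : γ ≠ 0) (ωB ωA g₁ g₂ : ℂ)
    (A B : Module.End ℂ E) (v : ι → E) (deg : ι → ℕ) (K : ι → ι → ℂ)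
    (hA : ∀ i, A (v i) = w1Eigenvalue q γ (deg i) • v i)
    (hB : ∀ i, B (v i) = ∑ j, K i j • v j)
    (hK : ∀ i j, K i j ≠ 0 → deg i ≤ deg j + 1 ∧ deg j ≤ deg i + 1) (P : ℤ) :
    (ωB + (q ^ 2 - (q ^ 2)⁻¹) / 2 *
          (g₂ * γ⁻¹ * q ^ (-2 * P - 1) + g₁ * γ * q ^ (2 * P + 1)) = 0 →
      ∀ w ∈ Submodule.span ℂ (v '' {i | (deg i : ℤ) ≤ P}),
        dolanGradyFirst q ωB ωA g₁ g₂ B A w ∈ Submodule.span ℂ (v '' {i | (deg i : ℤ) ≤ P})) ∧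
    (ωB + (q ^ 2 - (q ^ 2)⁻¹) / 2 *
          (g₂ * γ * q ^ (2 * P + 1) + g₁ * γ⁻¹ * q ^ (-2 * P - 1)) = 0 →
      ∀ w ∈ Submodule.span ℂ (v '' {i | P + 1 ≤ (deg i : ℤ)}),
        dolanGradyFirst q ωB ωA g₁ g₂ B A w ∈
          Submodule.span ℂ (v '' {i | P + 1 ≤ (deg i : ℤ)})) := by
  constructor <;> intro h <;>
    refine dolanGradyFirst_invariant q ωB ωA g₁ g₂ A B v _ K hA hB _ fun i hi j hj hij => ?_
  · have hd := hK i j hij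
    simp only [Set.mem_ofPred_eq, not_le] at hi hj
    -- A transition out of the subspace can only cross between `P` and `P + 1`, so one scalar
    -- condition suffices.
    have e1 : deg j = deg i + 1 := by omega
    obtain rfl : P = deg i := by omega
    rw [e1, w1Eigenvalue_up hq hγ, w1Eigenvalue_down hq hγ]
    linear_combination h
  · have hd := hK i j hij
    simp only [Set.mem_ofPred_eq, not_le] at hi hj
    have e1 : deg i = deg j + 1 := by omega
    obtain rfl : P = deg j := by omega
    rw [e1, w1Eigenvalue_up hq hγ, w1Eigenvalue_down hq hγ]
    linear_combination h

end Spans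

/-! ### Recurrence relations by duality, and the main theorem. -/

theorem opW0_gridPt {N : ℕ} [NeZero N] (q : ℂ) (α : ℕ → ℂ) (f : (Fin N → ℂ) → ℂ) (m : Fin N → ℕ) :
    opW0 f (gridPt q α m) =
      w1Eigenvalue q (α (N + 1) * α (N + 2) / α 1) (∑ i, m i) * f (gridPt q α m) := by
  have h : gridPt q α m 0 = α (N + 1) * α (N + 2) / α 1 * (q ^ 2) ^ ∑ i, m i := by
    rw [gridPt, Fin.val_zero, Nat.sub_zero, partialSum_self, pow_mul]
  rw [w1Eigenvalue, ← h]
  rfl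

/-- The polynomials on the grid satisfy recurrence relations in `n`, by duality. -/
theorem exists_recurrence {N : ℕ} {q : ℂ} (hq : q ≠ 0) (hq1 : ∀ m : ℕ, 0 < m → q ^ m ≠ 1)
    (α : ℕ → ℂ) (hα : ∀ k ≤ N + 2, α k ≠ 0) (J : Fin N → ℕ)
    (hαJ : ∀ k : Fin N, α (k + 2) / α (k + 1) = q ^ (-(J k : ℤ)))
    (hgen₁ : ∀ m : ℤ, α 1 ^ 2 / α 0 ^ 2 ≠ (q ^ 2) ^ m)
    (hgen₂ : ∀ m : ℤ, α (N + 2) ^ 2 ≠ (q ^ 2) ^ m)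
    (hgen₃ : ∀ m : ℤ, α (N + 1) * α (N + 2) ≠ (q ^ 2) ^ m)
    (hgen₄ : ∀ m : ℤ, α (N + 1) * α (N + 2) / α 0 ^ 2 ≠ (q ^ 2) ^ m) :
    ∃ K : Box J → Box J → ℂ,
      (∀ (n : Box J) (m : DualBox J),
        w1Eigenvalue q (α (N + 1) * α (N + 2) / α 1) m.deg * gridPoly q α J n m =
          ∑ n', K n n' * gridPoly q α J n' m) ∧
      ∀ n n', K n n' ≠ 0 → n.deg ≤ n'.deg + 1 ∧ n'.deg ≤ n.deg + 1 := by
  have hα' := dualParam_ne_zero hq α hα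
  have hr := dualParam_ratio hq α hα J hαJ
  have hg := dualParam_generic (N := N) hq α hgen₁
  obtain ⟨K, hK, hdeg⟩ := exists_gridMatrix hq hq1 (dualParam N q α) hα' J hr hg
  refine ⟨K, fun n m => ?_, hdeg⟩
  have hdual : ∀ n' : Box J, gridPoly q α J n' m =
      gasperRahmanHat q (dualParam N q α) m.toNat (gridPt q (dualParam N q α) n'.toNat) := fun n' =>
    gasperRahmanHat_dual hq hq1 α hα J hαJ hgen₁ hgen₂ hgen₃ hgen₄ n'.toNat m.toNat
      (fun k => Nat.lt_succ_iff.1 (n' k).2) (fun k => Nat.lt_succ_iff.1 (m k).2)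
  have h := hK (gasperRahmanHat q (dualParam N q α) m.toNat) n
  rw [opW1_gasperRahmanHat hq hq1 (dualParam N q α) hα' m.toNat _
    (gridPt_ne_zero hq _ hα' _) (gridPt_generic hq _ hα' (fun k => J k.rev) hr hg _)] at h
  -- The dual eigenvalue of `𝒲₁` is the value of `x_1` on the grid, so the dual eigenvalue equation
  -- reads as a recurrence for multiplication by `x_1`.
  have hγ : dualParam N q α (N + 1) / (dualParam N q α 0 * q) = α (N + 1) * α (N + 2) / α 1 := by
    have h0 := hα 0 (by omega)
    rw [dualParam_zero, dualParam_succ N q α N le_rfl, show N + 1 - N = 1 by omega]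
    field_simp
  rw [hγ] at h
  simp only [hdual]
  exact h

theorem mainTheorem6 (N : ℕ) [NeZero N] (q : ℂ) (hq0 : q ≠ 0) (hq : ∀ m : ℕ, 0 < m → q ^ m ≠ 1)
    (α : ℕ → ℂ) (hα : ∀ k ≤ N + 2, α k ≠ 0)
    (J : Fin N → ℕ) (hJ : ∀ k, 0 < J k)
    (hαJ : ∀ k : Fin N, α (k + 2) / α (k + 1) = q ^ (-(J k : ℤ)))
    (hgen₁ : ∀ m : ℤ, α 1 ^ 2 / α 0 ^ 2 ≠ (q ^ 2) ^ m)
    (hgen₂ : ∀ m : ℤ, α (N + 2) ^ 2 ≠ (q ^ 2) ^ m)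
    (hgen₃ : ∀ m : ℤ, α (N + 1) * α (N + 2) ≠ (q ^ 2) ^ m)
    (hgen₄ : ∀ m : ℤ, α (N + 1) * α (N + 2) / α 0 ^ 2 ≠ (q ^ 2) ^ m)
    (ω₀ ω₁ gp gm : ℂ) :
    ∃ (X Y I : Module.End ℂ (modV q α J)) (X' Y' I' : Module.End ℂ (dualModV q α J)),
      -- the operators induced by `W₀`, `W₁` and `I₁` exist and are unique
      (∀ T, IsInduced q α J opW0 T ↔ T = X) ∧
      (∀ T, IsInduced q α J (opW1 q α) T ↔ T = Y) ∧
      (∀ T, IsInduced q α J (dolanGradyFirst q ω₀ ω₁ gp gm opW0 (opW1 q α)) T ↔ T = I) ∧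
      (∀ T, IsDualInduced q α J opW0 T ↔ T = X') ∧
      (∀ T, IsDualInduced q α J (opW1 q α) T ↔ T = Y') ∧
      (∀ T, IsDualInduced q α J (dolanGradyFirst q ω₀ ω₁ gp gm opW0 (opW1 q α)) T ↔ T = I') ∧
      -- composition is preserved on `𝒱*` and reversed on `𝒱` (which exchanges `G₁` and `G̃₁`)
      I = dolanGradyFirst q ω₀ ω₁ gp gm X Y ∧
      I' = dolanGradyFirst q ω₀ ω₁ gm gp X' Y' ∧
      -- the invariant subspaces
      (∀ P : ℤ,
        (ω₀ + (q ^ 2 - (q ^ 2)⁻¹) / 2 *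
            (gm * (α 0 * q / α (N + 1)) * q ^ (-2 * P - 1) +
              gp * (α (N + 1) / (α 0 * q)) * q ^ (2 * P + 1)) = 0 →
          LeavesInvariant I (spanPoly q α J {n | (n.deg : ℤ) ≤ P})) ∧
        (ω₀ + (q ^ 2 - (q ^ 2)⁻¹) / 2 *
            (gm * (α (N + 1) / (α 0 * q)) * q ^ (2 * P + 1) +
              gp * (α 0 * q / α (N + 1)) * q ^ (-2 * P - 1)) = 0 →
          LeavesInvariant I (spanPoly q α J {n | P + 1 ≤ (n.deg : ℤ)}))) ∧
      (∀ P : ℤ,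
        (ω₁ + (q ^ 2 - (q ^ 2)⁻¹) / 2 *
            (gp * (α (N + 1) * α (N + 2) / α 1) * q ^ (2 * P + 1) +
              gm * (α 1 / (α (N + 1) * α (N + 2))) * q ^ (-2 * P - 1)) = 0 →
          LeavesInvariant I' (dualSpanPoly q α J {m | (m.deg : ℤ) ≤ P})) ∧
        (ω₁ + (q ^ 2 - (q ^ 2)⁻¹) / 2 *
            (gp * (α 1 / (α (N + 1) * α (N + 2))) * q ^ (-2 * P - 1) +
              gm * (α (N + 1) * α (N + 2) / α 1) * q ^ (2 * P + 1)) = 0 →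
          LeavesInvariant I' (dualSpanPoly q α J {m | P + 1 ≤ (m.deg : ℤ)})))  := by
  have h0 := hα 0 (by omega)
  have h1 := hα 1 (by omega)
  have hN := hα (N + 1) (by omega)
  have hN2 := hα (N + 2) le_rfl
  set γ := α (N + 1) / (α 0 * q) with hγ
  set γ' := α (N + 1) * α (N + 2) / α 1 with hγ'
  have hγ0 : γ ≠ 0 := div_ne_zero hN (mul_ne_zero h0 hq0)
  have hγ0' : γ' ≠ 0 := div_ne_zero (mul_ne_zero hN hN2) h1
  have hγi : α 0 * q / α (N + 1) = γ⁻¹ := by rw [hγ, inv_div]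
  have hγi' : α 1 / (α (N + 1) * α (N + 2)) = γ'⁻¹ := by rw [hγ', inv_div]
  rw [hγi, hγi']
  -- The grid is indexed by the dual box, hence the reversed sizes.
  obtain ⟨K, hK, hKdeg⟩ := exists_gridMatrix hq0 hq α hα (fun k => J k.rev)
    (fun k => by rw [Fin.rev_rev]; exact hαJ k) hgen₂
  obtain ⟨R, hR, hRdeg⟩ := exists_recurrence hq0 hq α hα J hαJ hgen₁ hgen₂ hgen₃ hgen₄
  rw [← hγ'] at hR
  -- the operators on the full function spaces
  let x : DualBox J → ℂ := fun m => w1Eigenvalue q γ' m.deg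
  let y : Box J → ℂ := fun n => w1Eigenvalue q γ n.deg
  let X : Module.End ℂ (DualBox J → ℂ) := LinearMap.mulLeft ℂ x
  let Y : Module.End ℂ (DualBox J → ℂ) := Matrix.toLin' (Matrix.of K)
  let X' : Module.End ℂ (Box J → ℂ) := Matrix.toLin' (Matrix.of R)
  let Y' : Module.End ℂ (Box J → ℂ) := LinearMap.mulLeft ℂ y
  have hYapp : ∀ g m, Y g m = ∑ m', K m m' * g m' := fun g m => rfl
  -- restriction to the grid
  let ρ : ((Fin N → ℂ) → ℂ) →ₗ[ℂ] (DualBox J → ℂ) :=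
    LinearMap.funLeft ℂ ℂ fun m : DualBox J => gridPoint q α m
  have hρ0 : ∀ f, ρ (opW0 f) = X (ρ f) := fun f => funext fun m => opW0_gridPt q α f m.toNat
  have hρ1 : ∀ f, ρ (opW1 q α f) = Y (ρ f) := fun f => funext fun m => hK f m
  have hρI : ∀ f, ρ (dolanGradyFirst q ω₀ ω₁ gp gm opW0 (opW1 q α) f) =
      dolanGradyFirst q ω₀ ω₁ gp gm X Y (ρ f) := fun f => by
    simp only [dolanGradyFirst_apply, map_add, map_sub, map_smul, hρ0, hρ1]
  have hG : ∀ n : Box J, gridPoly q α J n = ρ (gasperRahmanHat q α n.toNat) := fun n => rfl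
  have hval : ∀ A n, gridValue q α J A n = ρ (A (gasperRahmanHat q α n.toNat)) := fun A n => rfl
  have hYG : ∀ n, Y (gridPoly q α J n) = y n • gridPoly q α J n := fun n => by
    rw [hG, ← hρ1]
    funext m
    exact opW1_gasperRahmanHat hq0 hq α hα n.toNat _ (gridPt_ne_zero hq0 α hα _)
      (gridPt_generic hq0 α hα J hαJ hgen₂ _)
  have hXG : ∀ n, X (gridPoly q α J n) = ∑ n', R n n' • gridPoly q α J n' := fun n => by
    funext m
    rw [Finset.sum_apply]
    exact hR n m
  -- the dual side
  let G' : DualBox J → Box J → ℂ := fun m n => gridPoly q α J n m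
  -- These are the eigenvalue equation and the recurrence again, read as functions of `n`: diagonal
  -- and tridiagonal operators exchange roles.
  have hXG' : ∀ m, X' (G' m) = x m • G' m := fun m => funext fun n => (hR n m).symm
  have hYG' : ∀ m, Y' (G' m) = ∑ m', K m m' • G' m' := fun m => by
    funext n
    rw [Finset.sum_apply]
    exact (congrFun (hYG n) m).symm
  have hIG' : ∀ m, (fun n => gridValue q α J
      (dolanGradyFirst q ω₀ ω₁ gp gm opW0 (opW1 q α)) n m) =
      dolanGradyFirst q ω₀ ω₁ gm gp X' Y' (G' m) := fun m => by
    funext n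
    rw [hval, hρI, ← hG]
    -- Operators acting through `ñ` become operators acting through `n` in the opposite order, which
    -- exchanges the two `q`-commutators.
    have e1 : Y (X (gridPoly q α J n)) m = X' (Y' (G' m)) n := by
      rw [hYG', map_sum, Finset.sum_apply, hYapp]
      refine sum_congr rfl fun m' _ => ?_
      rw [map_smul, hXG']
      rfl
    have e2 : X (Y (gridPoly q α J n)) m = Y' (X' (G' m)) n := by
      rw [hYG, hXG', map_smul, map_smul]
      change y n * (x m * gridPoly q α J n m) = x m * (y n * gridPoly q α J n m)
      ring
    have e3 : Y (gridPoly q α J n) m = Y' (G' m) n := congrFun (hYG n) m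
    have e4 : X (gridPoly q α J n) m = X' (G' m) n := (congrFun (hXG' m) n).symm
    rw [dolanGradyFirst_apply, dolanGradyFirst_apply]
    simp only [Pi.add_apply, Pi.sub_apply, Pi.smul_apply]
    rw [e1, e2, e3, e4]
    abel
  -- the spans are stable
  have sX : ∀ w ∈ modV q α J, X w ∈ modV q α J := mapsTo_span _ _ X fun n _ => by
    rw [hXG]
    exact Submodule.sum_mem _ fun n' _ =>
      Submodule.smul_mem _ _ (Submodule.subset_span ⟨n', trivial, rfl⟩)
  have sY : ∀ w ∈ modV q α J, Y w ∈ modV q α J := mapsTo_span _ _ Y fun n _ => by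
    rw [hYG]
    exact Submodule.smul_mem _ _ (Submodule.subset_span ⟨n, trivial, rfl⟩)
  have sX' : ∀ w ∈ dualModV q α J, X' w ∈ dualModV q α J := mapsTo_span G' _ X' fun m _ => by
    rw [hXG']
    exact Submodule.smul_mem _ _ (Submodule.subset_span ⟨m, trivial, rfl⟩)
  have sY' : ∀ w ∈ dualModV q α J, Y' w ∈ dualModV q α J := mapsTo_span G' _ Y' fun m _ => by
    rw [hYG']
    exact Submodule.sum_mem _ fun m' _ =>
      Submodule.smul_mem _ _ (Submodule.subset_span ⟨m', trivial, rfl⟩)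
  have sI := dolanGradyFirst_mem q ω₀ ω₁ gp gm X Y _ sX sY
  have sI' := dolanGradyFirst_mem q ω₀ ω₁ gm gp X' Y' _ sX' sY'
  -- On the dual side `Y'` is the tridiagonal operator. Exchanging the operators together with their
  -- coefficients puts it in the slot that the invariance lemma expects, so the condition falls on
  -- `ω₁`.
  have hcomm : dolanGradyFirst q ω₀ ω₁ gm gp X' Y' = dolanGradyFirst q ω₁ ω₀ gp gm Y' X' := by
    unfold dolanGradyFirst
    abel
  refine ⟨X.restrict sX, Y.restrict sY, (dolanGradyFirst q ω₀ ω₁ gp gm X Y).restrict sI,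
    X'.restrict sX', Y'.restrict sY', (dolanGradyFirst q ω₀ ω₁ gm gp X' Y').restrict sI',
    fun T => ?_, fun T => ?_, fun T => ?_, fun T => ?_, fun T => ?_, fun T => ?_,
    restrict_dolanGradyFirst _ _ _ _ _ X Y _ sX sY sI,
    restrict_dolanGradyFirst _ _ _ _ _ X' Y' _ sX' sY' sI', fun P => ?_, fun P => ?_⟩
  · refine Iff.trans ?_ (eq_restrict_iff (gridPoly q α J) X sX T)
    have : ∀ n, gridValue q α J opW0 n = X (gridPoly q α J n) :=
      fun n => by rw [hval, hρ0, ← hG]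
    simp only [IsInduced, this]
    exact Iff.rfl
  · refine Iff.trans ?_ (eq_restrict_iff (gridPoly q α J) Y sY T)
    have : ∀ n, gridValue q α J (opW1 q α) n = Y (gridPoly q α J n) :=
      fun n => by rw [hval, hρ1, ← hG]
    simp only [IsInduced, this]
    exact Iff.rfl
  · refine Iff.trans ?_ (eq_restrict_iff (gridPoly q α J) (dolanGradyFirst q ω₀ ω₁ gp gm X Y) sI T)
    have : ∀ n, gridValue q α J (dolanGradyFirst q ω₀ ω₁ gp gm opW0 (opW1 q α)) n = (dolanGradyFirst q ω₀ ω₁ gp gm X Y) (gridPoly q α J n) :=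
      fun n => by rw [hval, hρI, ← hG]
    simp only [IsInduced, this]
    exact Iff.rfl
  · refine Iff.trans ?_ (eq_restrict_iff G' X' sX' T)
    have : ∀ m, (fun n => gridValue q α J opW0 n m) = X' (G' m) := fun m => by
      rw [hXG']
      funext n
      rw [hval, hρ0]
      rfl
    simp only [IsDualInduced, this]
    exact Iff.rfl
  · refine Iff.trans ?_ (eq_restrict_iff G' Y' sY' T)
    have : ∀ m, (fun n => gridValue q α J (opW1 q α) n m) = Y' (G' m) := fun m => by
      funext n
      rw [hval, hρ1, ← hG, hYG]
      rfl
    simp only [IsDualInduced, this]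
    exact Iff.rfl
  · refine Iff.trans ?_ (eq_restrict_iff G' (dolanGradyFirst q ω₀ ω₁ gm gp X' Y') sI' T)
    simp only [IsDualInduced, hIG']
    exact Iff.rfl
  · have inv := dolanGradyFirst_invariant_deg hq0 hγ0 ω₀ ω₁ gp gm Y X (gridPoly q α J) Box.deg R
      hYG hXG hRdeg P
    exact ⟨fun h => ⟨Submodule.span_mono (Set.image_mono (Set.subset_univ _)),
        fun w hw => inv.1 h w hw⟩,
      fun h => ⟨Submodule.span_mono (Set.image_mono (Set.subset_univ _)),
        fun w hw => inv.2 h w hw⟩⟩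
  · have inv := dolanGradyFirst_invariant_deg hq0 hγ0' ω₁ ω₀ gp gm X' Y' G' Box.deg K
      hXG' hYG' hKdeg P
    rw [← hcomm] at inv
    exact ⟨fun h => ⟨Submodule.span_mono (Set.image_mono (Set.subset_univ _)),
        fun w hw => inv.1 (by rw [← h]; ring) w hw⟩,
      fun h => ⟨Submodule.span_mono (Set.image_mono (Set.subset_univ _)),
        fun w hw => inv.2 (by rw [← h]; ring) w hw⟩⟩
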